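/- **Theorem 2.2.** Let $\Gamma\subset\mathbb R^n\times\mathbb R^n\times\mathbb R$ be an open set (for instance a domain) such that $I(x,y)=\{z : (x,y,z)\in\Gamma\}$ is an open (possibly empty) interval for all $x,y$, and let $g\in C^2(\Gamma)$ be a real function with $g_z<0$ in $\Gamma$. Put $$\mathcal U=\{(x,g(x,y,z),g_x(x,y,z)) : (x,y,z)\in\Gamma\},\quad E=g_{x,y}-(g_z)^{-1}g_{x,z}\otimes g_y,\quad Q=-g_y/g_z ,$$ and assume * **A1**: for each $(x,u,p)\in\mathcal U$ there is a unique $(x,y,z)\in\Gamma$ with $g(x,y,z)=u$, $g_x(x,y,z)=p$; write $y=Y(x,u,p)$, $z=Z(x,u,p)$; * **A2**: $\det E\neq0$ in $\Gamma$; * **A1\***: for all $(y,z)$ the mapping $x\mapsto Q(x,y,z)$ is one-to-one on $\{x : (x,y,z)\in\Gamma\}$. Let $A(x,u,p)=g_{xx}(x,Y(x,u,p),Z(x,u,p))$ for $(x,u,p)\in\mathcal U$. For $(x_0,u_0,[p_0,p_1])\subset\mathcal U$ and $\theta\in[0,1]$ put $p_\theta=(1-\theta)p_0+\theta p_1$,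 $y_\theta=Y(x_0,u_0,p_\theta)$, $z_\theta=Z(x_0,u_0,p_\theta)$. Consider the following conditions, in which $\mathcal U'\subset\subset\mathcal U$ means that the closure of $\mathcal U'$ is compact and contained in $\mathcal U$. * **A3s**: for every $\mathcal U'\subset\subset\mathcal U$ there is $\delta>0$ such that $$(A\xi,\xi)(x_0,u_0,p_\theta)\le(1-\theta)(A\xi,\xi)(x_0,u_0,p_0)+\theta(A\xi,\xi)(x_0,u_0,p_1)-\delta\,\theta(1-\theta)|p_1-p_0|^2|\xi|^2$$ for all $(x_0,u_0,[p_0,p_1])\subset\mathcal U'$, $\theta\in[0,1]$ and $\xi\in\mathbb R^n$ with $\xi\cdot(p_1-p_0)=0$. * **A3s(1)**: for every $\mathcal U'\subset\subset\mathcal U$ there is $\delta>0$ such that, for all $(x_0,u_0,[p_0,p_1])\subset\mathcal U'$, the set $$S_{1,\delta}=\Big\{x : (x,u_0,[p_0,p_1])\subset\mathcal U,\ (x,y_0,z_0),(x,y_1,z_1)\in\Gamma,\ g(x,y_1,z_1)-g(x,y_0,z_0)-\tfrac{\delta}{2}|p_1-p_0|^2|x-x_0|^2<0\Big\}$$ is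 locally $g$-convex at $x_0$ with respect to $(y_0,z_0)$; that is, $x_0$ has an open neighbourhood $\mathcal N_0$ such that $(x,y_0,z_0)\in\Gamma$ for all $x\in S_{1,\delta}\cap\mathcal N_0$ and $Q(\cdot,y_0,z_0)(S_{1,\delta}\cap\mathcal N_0)$ is convex. * **A3s(2)**: for every $\mathcal U'\subset\subset\mathcal U$ there is $\delta_0>0$ such that every $(x_0,u_0,[p_0,p_1])\subset\mathcal U'$ admits an open neighbourhood $\mathcal N_0$ of $x_0$ with $(x,y_\theta,z_\theta)\in\Gamma$ and $$g(x,y_\theta,z_\theta)\le\max\{g(x,y_0,z_0),g(x,y_1,z_1)\}-\delta_0\,[\theta(1-\theta)|p_1-p_0||x-x_0|]^2$$ for all $x\in\mathcal N_0$, $\theta\in[0,1]$. Let $\Gamma^*=\{(x,y,g(x,y,z)) : (x,y,z)\in\Gamma\}$ and let the dual generating function $g^*$ on $\Gamma^*$ be defined by $(x,y,g^*(x,y,u))\in\Gamma$, $g(x,y,g^*(x,y,u))=u$. Then: 1. A3s is invariant under duality: $g$ satisfies A3s if and only if $g^*$ does, where for $g^*$ the roles of $x$ and $y$ (and of $u$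 and $z$) are exchanged; 2. A3s is equivalent to A3s(1); 3. A3s is equivalent to A3s(2). -/

import Mathlib

noncomputable section

namespace GenFun

/-- Euclidean space `ℝⁿ`. -/
abbrev Vec (n : ℕ) : Type := EuclideanSpace ℝ (Fin n)

/-- The space of triples `(x, y, z) ∈ ℝⁿ × ℝⁿ × ℝ`. -/
abbrev Trip (n : ℕ) : Type := Vec n × Vec n × ℝ

/-- The space of one-jets `(x, u, p) ∈ ℝⁿ × ℝ × ℝⁿ`. -/
abbrev Jet (n : ℕ) : Type := Vec n × ℝ × Vec n

variable {n : ℕ}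

/-- The partial gradient `g_x`. -/
def gx (g : Trip n → ℝ) (x y : Vec n) (z : ℝ) : Vec n :=
  gradient (fun x' : Vec n => g (x', y, z)) x

/-- The partial gradient `g_y`. -/
def gy (g : Trip n → ℝ) (x y : Vec n) (z : ℝ) : Vec n :=
  gradient (fun y' : Vec n => g (x, y', z)) y

/-- The partial derivative `g_z`. -/
def gz (g : Trip n → ℝ) (x y : Vec n) (z : ℝ) : ℝ :=
  deriv (fun t : ℝ => g (x, y, t)) z

/-- The Hessian `g_xx`, as a linear map of `ℝⁿ` (the derivative of `g_x` in `x`). -/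
def gxx (g : Trip n → ℝ) (x y : Vec n) (z : ℝ) : Vec n →L[ℝ] Vec n :=
  fderiv ℝ (fun x' : Vec n => gx g x' y z) x

/-- The matrix `E = g_{x,y} - (g_z)⁻¹ g_{x,z} ⊗ g_y`. -/
def matE (g : Trip n → ℝ) (x y : Vec n) (z : ℝ) : Matrix (Fin n) (Fin n) ℝ :=
  Matrix.of fun i j =>
    (fderiv ℝ (fun y' : Vec n => gx g x y' z) y (EuclideanSpace.single j 1)) i
      - (gz g x y z)⁻¹ * (deriv (fun t : ℝ => gx g x y t) z) i * (gy g x y z) j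

/-- The mapping `Q = - g_y / g_z`. -/
def mapQ (g : Trip n → ℝ) (x y : Vec n) (z : ℝ) : Vec n :=
  -((gz g x y z)⁻¹ • gy g x y z)

/-- `g` is a `C²` generating function on the open set `Γ`: the fibres
`I(x,y) = {z | (x,y,z) ∈ Γ}` are open intervals (possibly empty), and `g_z < 0`. -/
structure IsGeneratingFunction (Γ : Set (Trip n)) (g : Trip n → ℝ) : Prop where
  isOpen : IsOpen Γ
  interval : ∀ x y : Vec n, {z : ℝ | (x, y, z) ∈ Γ}.OrdConnected
  contDiffOn : ContDiffOn ℝ 2 g Γ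
  gz_neg : ∀ x y z, (x, y, z) ∈ Γ → gz g x y z < 0

/-- The set `𝒰 = {(x, g(x,y,z), g_x(x,y,z)) | (x,y,z) ∈ Γ}` of one-jets. -/
def jets (Γ : Set (Trip n)) (g : Trip n → ℝ) : Set (Jet n) :=
  {j | ∃ x y z, (x, y, z) ∈ Γ ∧ j = (x, g (x, y, z), gx g x y z)}

/-- Condition A1. -/
def A1 (Γ : Set (Trip n)) (g : Trip n → ℝ) : Prop :=
  ∀ x u p, (x, u, p) ∈ jets Γ g →
    ∃! w : Vec n × ℝ, (x, w.1, w.2) ∈ Γ ∧ g (x, w.1, w.2) = u ∧ gx g x w.1 w.2 = p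

/-- Condition A2. -/
def A2 (Γ : Set (Trip n)) (g : Trip n → ℝ) : Prop :=
  ∀ x y z, (x, y, z) ∈ Γ → (matE g x y z).det ≠ 0

/-- Condition A1*. -/
def A1star (Γ : Set (Trip n)) (g : Trip n → ℝ) : Prop :=
  ∀ y z, Set.InjOn (fun x : Vec n => mapQ g x y z) {x | (x, y, z) ∈ Γ}

/-- The pair `(Y, Z)(x,u,p)` solving `g(x,Y,Z) = u`, `g_x(x,Y,Z) = p` (for `(x,u,p) ∈ 𝒰`,
where the solution is unique under A1). -/
def mapYZ (Γ : Set (Trip n)) (g : Trip n → ℝ) (x : Vec n) (u : ℝ) (p : Vec n) : Vec n × ℝ :=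
  Classical.epsilon fun w : Vec n × ℝ =>
    (x, w.1, w.2) ∈ Γ ∧ g (x, w.1, w.2) = u ∧ gx g x w.1 w.2 = p

/-- The mapping `Y(x,u,p)`. -/
def mapY (Γ : Set (Trip n)) (g : Trip n → ℝ) (x : Vec n) (u : ℝ) (p : Vec n) : Vec n :=
  (mapYZ Γ g x u p).1

/-- The mapping `Z(x,u,p)`. -/
def mapZ (Γ : Set (Trip n)) (g : Trip n → ℝ) (x : Vec n) (u : ℝ) (p : Vec n) : ℝ :=
  (mapYZ Γ g x u p).2

/-- The matrix function `A(x,u,p) = g_xx(x, Y(x,u,p), Z(x,u,p))`. -/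
def matA (Γ : Set (Trip n)) (g : Trip n → ℝ) (x : Vec n) (u : ℝ) (p : Vec n) :
    Vec n →L[ℝ] Vec n :=
  gxx g x (mapY Γ g x u p) (mapZ Γ g x u p)

/-- `p_θ = (1 - θ) p₀ + θ p₁`. -/
def pt (p₀ p₁ : Vec n) (θ : ℝ) : Vec n := (1 - θ) • p₀ + θ • p₁

/-- `(x₀, u₀, [p₀, p₁]) ⊂ U`. -/
def SegIn (U : Set (Jet n)) (x₀ : Vec n) (u₀ : ℝ) (p₀ p₁ : Vec n) : Prop :=
  ∀ p ∈ segment ℝ p₀ p₁, (x₀, u₀, p) ∈ U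

/-- `U' ⊂⊂ U`: the closure of `U'` is compact and contained in `U`. -/
def CompactlyIn (U' U : Set (Jet n)) : Prop :=
  IsCompact (closure U') ∧ closure U' ⊆ U

/-- Condition A3s: `A` is locally uniformly co-dimension one convex in `p`. -/
def A3s (Γ : Set (Trip n)) (g : Trip n → ℝ) : Prop :=
  ∀ U' : Set (Jet n), CompactlyIn U' (jets Γ g) → ∃ δ : ℝ, 0 < δ ∧
    ∀ (x₀ : Vec n) (u₀ : ℝ) (p₀ p₁ : Vec n), SegIn U' x₀ u₀ p₀ p₁ →
      ∀ ξ : Vec n, inner ℝ ξ (p₁ - p₀) = 0 → ∀ θ ∈ Set.Icc (0 : ℝ) 1,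
        inner ℝ (matA Γ g x₀ u₀ (pt p₀ p₁ θ) ξ) ξ
          ≤ (1 - θ) * inner ℝ (matA Γ g x₀ u₀ p₀ ξ) ξ
            + θ * inner ℝ (matA Γ g x₀ u₀ p₁ ξ) ξ
            - δ * θ * (1 - θ) * ‖p₁ - p₀‖ ^ 2 * ‖ξ‖ ^ 2

/-- `Ω` is `g`-convex with respect to `(y₀, z₀)`: `(Ω, y₀, z₀) ⊂ Γ` and
`Q(·, y₀, z₀)(Ω)` is convex. -/
def GConvex (Γ : Set (Trip n)) (g : Trip n → ℝ) (Ω : Set (Vec n)) (y₀ : Vec n) (z₀ : ℝ) : Prop :=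
  (∀ x ∈ Ω, (x, y₀, z₀) ∈ Γ) ∧ Convex ℝ ((fun x : Vec n => mapQ g x y₀ z₀) '' Ω)

/-- `S` is locally `g`-convex at `x₀` with respect to `(y₀, z₀)`. -/
def LocallyGConvexAt (Γ : Set (Trip n)) (g : Trip n → ℝ) (S : Set (Vec n)) (x₀ y₀ : Vec n)
    (z₀ : ℝ) : Prop :=
  ∃ N : Set (Vec n), IsOpen N ∧ x₀ ∈ N ∧ GConvex Γ g (S ∩ N) y₀ z₀

/-- The function `h_{θ,δ}(x) = g(x,y_θ,z_θ) - g(x,y_0,z_0) - (δ/2)|p_θ - p_0|²|x - x_0|²`,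
where `y_θ = Y(x₀,u₀,p_θ)` and `z_θ = Z(x₀,u₀,p_θ)`. -/
def hfun (Γ : Set (Trip n)) (g : Trip n → ℝ) (x₀ : Vec n) (u₀ : ℝ) (p₀ p₁ : Vec n)
    (θ δ : ℝ) (x : Vec n) : ℝ :=
  g (x, mapY Γ g x₀ u₀ (pt p₀ p₁ θ), mapZ Γ g x₀ u₀ (pt p₀ p₁ θ))
    - g (x, mapY Γ g x₀ u₀ p₀, mapZ Γ g x₀ u₀ p₀)
    - δ / 2 * ‖pt p₀ p₁ θ - p₀‖ ^ 2 * ‖x - x₀‖ ^ 2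

/-- The set `S_{θ,δ} = {x ∈ Ω₀ | h_{θ,δ}(x) < 0}`, where
`Ω₀ = {x | (x, u₀, [p₀, p₁]) ⊂ 𝒰}` and `x` is restricted to points at which
both values of `g` in `h_{θ,δ}` are defined. -/
def sectionS (Γ : Set (Trip n)) (g : Trip n → ℝ) (x₀ : Vec n) (u₀ : ℝ) (p₀ p₁ : Vec n)
    (θ δ : ℝ) : Set (Vec n) :=
  {x | SegIn (jets Γ g) x u₀ p₀ p₁ ∧
    (x, mapY Γ g x₀ u₀ p₀, mapZ Γ g x₀ u₀ p₀) ∈ Γ ∧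
    (x, mapY Γ g x₀ u₀ (pt p₀ p₁ θ), mapZ Γ g x₀ u₀ (pt p₀ p₁ θ)) ∈ Γ ∧
    hfun Γ g x₀ u₀ p₀ p₁ θ δ x < 0}

/-- Condition A3s(1). -/
def A3sOne (Γ : Set (Trip n)) (g : Trip n → ℝ) : Prop :=
  ∀ U' : Set (Jet n), CompactlyIn U' (jets Γ g) → ∃ δ : ℝ, 0 < δ ∧
    ∀ (x₀ : Vec n) (u₀ : ℝ) (p₀ p₁ : Vec n), SegIn U' x₀ u₀ p₀ p₁ →
      LocallyGConvexAt Γ g (sectionS Γ g x₀ u₀ p₀ p₁ 1 δ) x₀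
        (mapY Γ g x₀ u₀ p₀) (mapZ Γ g x₀ u₀ p₀)

/-- Condition A3s(2). -/
def A3sTwo (Γ : Set (Trip n)) (g : Trip n → ℝ) : Prop :=
  ∀ U' : Set (Jet n), CompactlyIn U' (jets Γ g) → ∃ δ₀ : ℝ, 0 < δ₀ ∧
    ∀ (x₀ : Vec n) (u₀ : ℝ) (p₀ p₁ : Vec n), SegIn U' x₀ u₀ p₀ p₁ →
      ∃ N : Set (Vec n), IsOpen N ∧ x₀ ∈ N ∧ ∀ x ∈ N, ∀ θ ∈ Set.Icc (0 : ℝ) 1,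
        (x, mapY Γ g x₀ u₀ (pt p₀ p₁ θ), mapZ Γ g x₀ u₀ (pt p₀ p₁ θ)) ∈ Γ ∧
        g (x, mapY Γ g x₀ u₀ (pt p₀ p₁ θ), mapZ Γ g x₀ u₀ (pt p₀ p₁ θ))
          ≤ max (g (x, mapY Γ g x₀ u₀ p₀, mapZ Γ g x₀ u₀ p₀))
                (g (x, mapY Γ g x₀ u₀ p₁, mapZ Γ g x₀ u₀ p₁))
            - δ₀ * (θ * (1 - θ) * ‖p₁ - p₀‖ * ‖x - x₀‖) ^ 2

/-- The dual domain `Γ* = {(x, y, g(x,y,z)) | (x,y,z) ∈ Γ}`, with the roles of `x` and `y`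
exchanged: its points are written `(y, x, u)`. -/
def dualDomain (Γ : Set (Trip n)) (g : Trip n → ℝ) : Set (Trip n) :=
  {w | ∃ x y z, (x, y, z) ∈ Γ ∧ w = (y, x, g (x, y, z))}

/-- The dual generating function: `dualFun Γ g (y, x, u) = g*(x,y,u)` is the solution `z` of
`g(x,y,z) = u` with `(x,y,z) ∈ Γ` (unique since `g_z < 0` and the fibres are intervals). -/
def dualFun (Γ : Set (Trip n)) (g : Trip n → ℝ) : Trip n → ℝ := fun w =>
  Classical.epsilon fun z : ℝ => (w.2.1, w.1, z) ∈ Γ ∧ g (w.2.1, w.1, z) = w.2.2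

end GenFun

end

/-! The three equivalences all pass through one quadratic gap, `GapAt`. Let g(·,y,z) and g(·,ȳ,z̄)
agree at x̄, with gradients differing by E e. In the coordinates Q(·,ȳ,z̄) the set where the two
functions agree has normal e at x̄. Under A3s, on the half space ⟨e, Q(x) - Q(x̄)⟩ ≥ 0, the first
function exceeds the second by a multiple of |Δp|²|x - x̄|². In the dual form, the solution of
g(x,y,·) = g(x,ȳ,z̄) exceeds z by a multiple of |y - ȳ|²|ΔQ|². This second form is a statement about
g*, for which Q plays the role of p; hence the invariance under duality.

As g is only C², A3s cannot be differentiated in p and dualised as a condition on a fourth order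
tensor. It is integrated instead. For a fixed base, let w(x,y) be the height z with g(x,y,z) =
g(x,ȳ,z̄) (`levelZ`). Then w(·,ȳ) is constant, the x-gradient m of w is the difference of the g_x
divided by -g_z, and ∂w/∂y at ȳ is Q(x,ȳ,z̄). Convexity of A in p becomes a Jensen inequality for
the x-Hessians of w in directions orthogonal to the gradients involved (`level_hess_le`,
`exists_localModel`).

The core is `slice_estimate`. Follow a curve γ on which w(·,y₁) and w(·,ρ bᵢ) are constant, for all
but two vectors bᵢ of an orthonormal basis; as ρ → 0 this approximates a planar slice, in the
coordinates Q, of a level set of w(·,y₁). For a moving test point Y(s) of size ρ, the function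
⟨m(γ,Y),γ'⟩ starts negative. At each of its zeros m(γ,Y) is a nonnegative combination of the
gradients that vanish on γ', so the Hessian inequality makes its derivative negative; hence it never
becomes positive. Integration and the limit ρ → 0 show that the level set bends quadratically away
from its tangent hyperplane in the coordinates Q (`inner_le_of_level`). Sliding points onto the
level set yields `quadratic_gap`, then `exists_gapAt`, and by compactness `exists_uniform_gapAt`.

In the other direction `A3s_of_midpointGap` recovers A3s from a gap at midpoints of short segments:
a second order expansion along a suitably bent curve gives a midpoint inequality for A, which strong
convexity needs only at small distances.

For duality, the z-form of the gap is the midpoint gap for g* (`midpointGap_dual`), and the double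
dual is g. For A3s(2), the gap at each p_θ says that θ ↦ g(x,y_θ,z_θ) grows in one of the two
directions, and growth propagates to an end point (`chain_max`). From A3s(1) to A3s, the two
sections from the midpoint lie in opposite half spaces, hence share no interior. From A3s to A3s(1),
a nonconvex section would produce a local maximum along a segment in the coordinates Q. Comparison
at that point with a function of slightly different gradient contradicts the uniform convexity of A
(`not_isLocalMax_of_uniform_convexity`). -/

open scoped InnerProductSpace Topology
open Set Filter Metric

/-! ### First and second derivatives of g, the matrix E and the map Q. -/

namespace GenFun

variable {n : ℕ}

/-- `g_x` as a function of the triple. -/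
noncomputable def gxF (g : Trip n → ℝ) (t : Trip n) : Vec n := gx g t.1 t.2.1 t.2.2

/-- `g_y` as a function of the triple. -/
noncomputable def gyF (g : Trip n → ℝ) (t : Trip n) : Vec n := gy g t.1 t.2.1 t.2.2

/-- `g_z` as a function of the triple. -/
noncomputable def gzF (g : Trip n → ℝ) (t : Trip n) : ℝ := gz g t.1 t.2.1 t.2.2

/-- `Q` as a function of the triple. -/
noncomputable def mapQF (g : Trip n → ℝ) (t : Trip n) : Vec n := mapQ g t.1 t.2.1 t.2.2

/-- The linear map with matrix `E`: the derivative of `g_x` along the level sets of `g (x, ·, ·)`. -/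
noncomputable def linE (g : Trip n → ℝ) (t : Trip n) : Vec n →L[ℝ] Vec n :=
  (fderiv ℝ (gxF g) t).comp
    ((0 : Vec n →L[ℝ] Vec n).prod
      ((ContinuousLinearMap.id ℝ (Vec n)).prod (innerSL ℝ (mapQF g t))))

theorem linE_apply (g : Trip n → ℝ) (t : Trip n) (η : Vec n) :
    linE g t η = fderiv ℝ (gxF g) t (0, η, ⟪mapQF g t, η⟫_ℝ) := by
  simp [linE]

section Partial

variable {F : Type*} [NormedAddCommGroup F] [NormedSpace ℝ F]

theorem HasFDerivAt.partial_fst {f : Trip n → F} {f' : Trip n →L[ℝ] F} {x y : Vec n} {z : ℝ}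
    (h : HasFDerivAt f f' (x, y, z)) :
    HasFDerivAt (fun x' : Vec n => f (x', y, z))
      (f'.comp (ContinuousLinearMap.inl ℝ (Vec n) (Vec n × ℝ))) x :=
  HasFDerivAt.comp x h (hasFDerivAt_prodMk_left x (y, z))

theorem HasFDerivAt.partial_snd {f : Trip n → F} {f' : Trip n →L[ℝ] F} {x y : Vec n} {z : ℝ}
    (h : HasFDerivAt f f' (x, y, z)) :
    HasFDerivAt (fun y' : Vec n => f (x, y', z))
      (f'.comp ((ContinuousLinearMap.inr ℝ (Vec n) (Vec n × ℝ)).comp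
        (ContinuousLinearMap.inl ℝ (Vec n) ℝ))) y :=
  HasFDerivAt.comp (g := f) y h
    (HasFDerivAt.comp (g := fun w => (x, w)) y (hasFDerivAt_prodMk_right x (y, z))
      (hasFDerivAt_prodMk_left y z))

theorem HasFDerivAt.partial_thd {f : Trip n → F} {f' : Trip n →L[ℝ] F} {x y : Vec n} {z : ℝ}
    (h : HasFDerivAt f f' (x, y, z)) :
    HasDerivAt (fun t : ℝ => f (x, y, t)) (f' (0, 0, 1)) z := by
  have h1 : HasFDerivAt (fun t : ℝ => f (x, y, t))
      (f'.comp ((ContinuousLinearMap.inr ℝ (Vec n) (Vec n × ℝ)).comp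
        (ContinuousLinearMap.inr ℝ (Vec n) ℝ))) z :=
    HasFDerivAt.comp (g := f) z h
      (HasFDerivAt.comp (g := fun w => (x, w)) z (hasFDerivAt_prodMk_right x (y, z))
        (hasFDerivAt_prodMk_right y z))
  simpa using h1.hasDerivAt

end Partial

theorem inner_gradient_of_hasFDerivAt {f : Vec n → ℝ} {f' : Vec n →L[ℝ] ℝ} {x : Vec n}
    (h : HasFDerivAt f f' x) (ξ : Vec n) : ⟪gradient f x, ξ⟫_ℝ = f' ξ := by
  rw [gradient, h.fderiv, InnerProductSpace.toDual_symm_apply]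

section Diff

variable {g : Trip n → ℝ} {t : Trip n}

theorem inner_gxF (h : DifferentiableAt ℝ g t) (ξ : Vec n) :
    ⟪gxF g t, ξ⟫_ℝ = fderiv ℝ g t (ξ, 0, 0) := by
  obtain ⟨x, y, z⟩ := t
  exact (inner_gradient_of_hasFDerivAt (HasFDerivAt.partial_fst h.hasFDerivAt) ξ)

theorem inner_gyF (h : DifferentiableAt ℝ g t) (η : Vec n) :
    ⟪gyF g t, η⟫_ℝ = fderiv ℝ g t (0, η, 0) := by
  obtain ⟨x, y, z⟩ := t
  exact (inner_gradient_of_hasFDerivAt (HasFDerivAt.partial_snd h.hasFDerivAt) η)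

theorem gzF_eq (h : DifferentiableAt ℝ g t) : gzF g t = fderiv ℝ g t (0, 0, 1) := by
  obtain ⟨x, y, z⟩ := t
  exact (HasFDerivAt.partial_thd h.hasFDerivAt).deriv

theorem fderiv_apply (h : DifferentiableAt ℝ g t) (ξ η : Vec n) (ζ : ℝ) :
    fderiv ℝ g t (ξ, η, ζ) = ⟪gxF g t, ξ⟫_ℝ + ⟪gyF g t, η⟫_ℝ + gzF g t * ζ := by
  rw [inner_gxF h, inner_gyF h, gzF_eq h]
  have : ((ξ, η, ζ) : Trip n) = (ξ, 0, 0) + (0, η, 0) + ζ • (0, 0, 1) := by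
    ext <;> simp
  rw [this, map_add, map_add, map_smul, smul_eq_mul, mul_comm]

end Diff

/-- The gradient of `g_x`-type maps as a continuous linear image of the full derivative. -/
theorem gxF_eq_toDual {g : Trip n → ℝ} {t : Trip n} (h : DifferentiableAt ℝ g t) :
    gxF g t = (InnerProductSpace.toDual ℝ (Vec n)).symm
      ((fderiv ℝ g t).comp (ContinuousLinearMap.inl ℝ (Vec n) (Vec n × ℝ))) := by
  refine ext_inner_right ℝ fun ξ => ?_
  rw [inner_gxF h, InnerProductSpace.toDual_symm_apply]; simp [Prod.mk_zero_zero]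

theorem gyF_eq_toDual {g : Trip n → ℝ} {t : Trip n} (h : DifferentiableAt ℝ g t) :
    gyF g t = (InnerProductSpace.toDual ℝ (Vec n)).symm
      ((fderiv ℝ g t).comp ((ContinuousLinearMap.inr ℝ (Vec n) (Vec n × ℝ)).comp
        (ContinuousLinearMap.inl ℝ (Vec n) ℝ))) := by
  refine ext_inner_right ℝ fun ξ => ?_
  rw [inner_gyF h, InnerProductSpace.toDual_symm_apply]; simp

namespace IsGeneratingFunction

variable {Γ : Set (Trip n)} {g : Trip n → ℝ}

theorem contDiffAt (hg : IsGeneratingFunction Γ g) {t : Trip n} (ht : t ∈ Γ) :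
    ContDiffAt ℝ 2 g t :=
  hg.contDiffOn.contDiffAt (hg.isOpen.mem_nhds ht)

theorem differentiableAt (hg : IsGeneratingFunction Γ g) {t : Trip n} (ht : t ∈ Γ) :
    DifferentiableAt ℝ g t :=
  (hg.contDiffAt ht).differentiableAt (by norm_num)

theorem contDiffAt_fderiv (hg : IsGeneratingFunction Γ g) {t : Trip n} (ht : t ∈ Γ) :
    ContDiffAt ℝ 1 (fderiv ℝ g) t :=
  (hg.contDiffAt ht).fderiv_right (by norm_num)

theorem gzF_neg (hg : IsGeneratingFunction Γ g) {t : Trip n} (ht : t ∈ Γ) : gzF g t < 0 :=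
  hg.gz_neg t.1 t.2.1 t.2.2 ht

theorem contDiffAt_gxF (hg : IsGeneratingFunction Γ g) {t : Trip n} (ht : t ∈ Γ) :
    ContDiffAt ℝ 1 (gxF g) t := by
  have h1 : ContDiffAt ℝ 1 (fun t => (InnerProductSpace.toDual ℝ (Vec n)).symm
      ((fderiv ℝ g t).comp (ContinuousLinearMap.inl ℝ (Vec n) (Vec n × ℝ)))) t :=
    ((InnerProductSpace.toDual ℝ (Vec n)).symm.toContinuousLinearEquiv.contDiff.contDiffAt).comp t
      ((hg.contDiffAt_fderiv ht).clm_comp contDiffAt_const)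
  refine h1.congr_of_eventuallyEq ?_
  filter_upwards [hg.isOpen.mem_nhds ht] with s hs
  exact gxF_eq_toDual (hg.differentiableAt hs)

theorem contDiffAt_gyF (hg : IsGeneratingFunction Γ g) {t : Trip n} (ht : t ∈ Γ) :
    ContDiffAt ℝ 1 (gyF g) t := by
  have h1 : ContDiffAt ℝ 1 (fun t => (InnerProductSpace.toDual ℝ (Vec n)).symm
      ((fderiv ℝ g t).comp ((ContinuousLinearMap.inr ℝ (Vec n) (Vec n × ℝ)).comp
        (ContinuousLinearMap.inl ℝ (Vec n) ℝ)))) t :=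
    ((InnerProductSpace.toDual ℝ (Vec n)).symm.toContinuousLinearEquiv.contDiff.contDiffAt).comp t
      ((hg.contDiffAt_fderiv ht).clm_comp contDiffAt_const)
  refine h1.congr_of_eventuallyEq ?_
  filter_upwards [hg.isOpen.mem_nhds ht] with s hs
  exact gyF_eq_toDual (hg.differentiableAt hs)

theorem contDiffAt_gzF (hg : IsGeneratingFunction Γ g) {t : Trip n} (ht : t ∈ Γ) :
    ContDiffAt ℝ 1 (gzF g) t := by
  have h1 : ContDiffAt ℝ 1 (fun t => fderiv ℝ g t ((0, 0, 1) : Trip n)) t :=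
    (hg.contDiffAt_fderiv ht).clm_apply contDiffAt_const
  refine h1.congr_of_eventuallyEq ?_
  filter_upwards [hg.isOpen.mem_nhds ht] with s hs
  exact gzF_eq (hg.differentiableAt hs)

theorem contDiffAt_mapQF (hg : IsGeneratingFunction Γ g) {t : Trip n} (ht : t ∈ Γ) :
    ContDiffAt ℝ 1 (mapQF g) t :=
  (((hg.contDiffAt_gzF ht).inv (hg.gzF_neg ht).ne).smul (hg.contDiffAt_gyF ht)).neg

theorem hasFDerivAt_gxF (hg : IsGeneratingFunction Γ g) {t : Trip n} (ht : t ∈ Γ) :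
    HasFDerivAt (gxF g) (fderiv ℝ (gxF g) t) t :=
  ((hg.contDiffAt_gxF ht).differentiableAt (by norm_num)).hasFDerivAt

theorem continuousAt_fderiv_gxF (hg : IsGeneratingFunction Γ g) {t : Trip n} (ht : t ∈ Γ) :
    ContinuousAt (fderiv ℝ (gxF g)) t :=
  (hg.contDiffAt_gxF ht).continuousAt_fderiv (by norm_num)

theorem gxx_apply (hg : IsGeneratingFunction Γ g) {x y : Vec n} {z : ℝ} (ht : (x, y, z) ∈ Γ)
    (ξ : Vec n) : gxx g x y z ξ = fderiv ℝ (gxF g) (x, y, z) (ξ, 0, 0) := by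
  have := (HasFDerivAt.partial_fst (hg.hasFDerivAt_gxF ht)).fderiv
  change fderiv ℝ (fun x' => gxF g (x', y, z)) x ξ = _
  rw [this]; simp [Prod.mk_zero_zero]

theorem hasFDerivAt_gx (hg : IsGeneratingFunction Γ g) {x y : Vec n} {z : ℝ}
    (ht : (x, y, z) ∈ Γ) : HasFDerivAt (fun x' => gx g x' y z) (gxx g x y z) x :=
  (HasFDerivAt.partial_fst (hg.hasFDerivAt_gxF ht)).differentiableAt.hasFDerivAt

theorem continuousAt_gxx (hg : IsGeneratingFunction Γ g) {t : Trip n} (ht : t ∈ Γ) :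
    ContinuousAt (fun t : Trip n => gxx g t.1 t.2.1 t.2.2) t := by
  have h1 : ContinuousAt (fun t => (fderiv ℝ (gxF g) t).comp
      (ContinuousLinearMap.inl ℝ (Vec n) (Vec n × ℝ))) t :=
    (hg.continuousAt_fderiv_gxF ht).clm_comp continuousAt_const
  refine h1.congr ?_
  filter_upwards [hg.isOpen.mem_nhds ht] with s hs
  obtain ⟨x, y, z⟩ := s
  ext1 ξ
  rw [hg.gxx_apply hs]; simp [Prod.mk_zero_zero]

theorem linE_coord (hg : IsGeneratingFunction Γ g) {x y : Vec n} {z : ℝ} (ht : (x, y, z) ∈ Γ)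
    (η : Vec n) (i : Fin n) :
    linE g (x, y, z) η i = (matE g x y z).mulVec (η.ofLp) i := by
  have h1 := (HasFDerivAt.partial_snd (hg.hasFDerivAt_gxF ht)).fderiv
  have h2 := (HasFDerivAt.partial_thd (hg.hasFDerivAt_gxF ht)).deriv
  change fderiv ℝ (fun y' => gx g x y' z) y = _ at h1
  change deriv (fun t => gx g x y t) z = _ at h2
  have hq : ⟪mapQF g (x, y, z), η⟫_ℝ = -((gz g x y z)⁻¹ * ∑ j, gy g x y z j * η j) := by
    rw [show mapQF g (x, y, z) = -((gz g x y z)⁻¹ • gy g x y z) from rfl, inner_neg_left,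
      inner_smul_left]
    simp [PiLp.inner_apply, mul_comm]
  have h3 : fderiv ℝ (gxF g) (x, y, z) (0, η, 0) i
      = ∑ j, (fderiv ℝ (fun y' => gx g x y' z) y (EuclideanSpace.single j 1)) i * η j := by
    have hη : η = ∑ j, η j • EuclideanSpace.single j (1 : ℝ) := by
      ext k
      simp [Pi.single_apply]
    have h4 : fderiv ℝ (gxF g) (x, y, z) (0, η, 0) = fderiv ℝ (fun y' => gx g x y' z) y η := by
      rw [h1]; simp
    rw [h4]
    conv_lhs => rw [hη]
    simp [map_sum, mul_comm]
  have hsplit : ((0, η, ⟪mapQF g (x, y, z), η⟫_ℝ) : Trip n)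
      = (0, η, 0) + ⟪mapQF g (x, y, z), η⟫_ℝ • (0, 0, 1) := by ext <;> simp
  rw [linE_apply, hsplit, map_add, map_smul, PiLp.add_apply, PiLp.smul_apply, h3, ← h2, hq]
  simp only [Matrix.mulVec, dotProduct, matE, Matrix.of_apply, smul_eq_mul, sub_mul,
    Finset.sum_sub_distrib]
  rw [sub_eq_add_neg, Finset.mul_sum, ← Finset.sum_neg_distrib, ← Finset.sum_neg_distrib,
    Finset.sum_mul]
  congr 1
  refine Finset.sum_congr rfl fun j _ => ?_
  ring

theorem linE_injective (hg : IsGeneratingFunction Γ g) (h2 : A2 Γ g) {t : Trip n} (ht : t ∈ Γ)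
    {η : Vec n} (h : linE g t η = 0) : η = 0 := by
  obtain ⟨x, y, z⟩ := t
  have h3 : (matE g x y z).mulVec η.ofLp = 0 := by
    funext i
    rw [← hg.linE_coord ht, h]; rfl
  have h4 := Matrix.eq_zero_of_mulVec_eq_zero (h2 x y z ht) h3
  ext i
  exact congrFun h4 i

theorem A2_of_linE_injective (hg : IsGeneratingFunction Γ g)
    (h : ∀ t ∈ Γ, ∀ η, linE g t η = 0 → η = 0) : A2 Γ g := by
  intro x y z ht hdet
  obtain ⟨v, hv, hv0⟩ := Matrix.exists_mulVec_eq_zero_iff.2 hdet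
  refine hv ?_
  have h3 : linE g (x, y, z) (WithLp.toLp 2 v) = 0 := by
    ext i
    rw [hg.linE_coord ht]
    exact congrFun hv0 i
  have h4 := h _ ht _ h3
  funext i
  exact congrFun (congrArg WithLp.ofLp h4) i

/-- `E` as a continuous linear equivalence. -/
theorem exists_linE_equiv (hg : IsGeneratingFunction Γ g) (h2 : A2 Γ g) {t : Trip n}
    (ht : t ∈ Γ) : ∃ L : Vec n ≃L[ℝ] Vec n, ∀ η, L η = linE g t η :=
  ⟨(LinearEquiv.ofInjectiveEndo (linE g t : Vec n →ₗ[ℝ] Vec n)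
    ((injective_iff_map_eq_zero _).2 fun _ h =>
      hg.linE_injective h2 ht h)).toContinuousLinearEquiv, fun _ => rfl⟩

theorem inner_fderiv_gxF (hg : IsGeneratingFunction Γ g) {t : Trip n} (ht : t ∈ Γ) (v : Trip n)
    (ξ : Vec n) :
    ⟪fderiv ℝ (gxF g) t v, ξ⟫_ℝ = fderiv ℝ (fderiv ℝ g) t v (ξ, 0, 0) := by
  have h1 : HasFDerivAt (fun s => ⟪gxF g s, ξ⟫_ℝ) _ t :=
    (hg.hasFDerivAt_gxF ht).inner ℝ (hasFDerivAt_const ξ t)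
  have h2 : HasFDerivAt (fun s => fderiv ℝ g s (ξ, 0, 0)) _ t :=
    ((hg.contDiffAt_fderiv ht).differentiableAt (by norm_num)).hasFDerivAt.clm_apply
      (hasFDerivAt_const ((ξ, 0, 0) : Trip n) t)
  have h3 := h1.congr_of_eventuallyEq (f₁ := fun s => fderiv ℝ g s (ξ, 0, 0)) (by
    filter_upwards [hg.isOpen.mem_nhds ht] with s hs
    exact (inner_gxF (hg.differentiableAt hs) ξ).symm)
  have h4 := congrArg (fun L => L v) (h3.unique h2)
  simpa [real_inner_comm] using h4

/-- In the quotient rule for -g_y/g_z the term from the denominator recombines with the numerator: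
only the second derivative of g against (0, e, ⟨Q,e⟩) remains, the same direction that defines E.
Symmetry of D²g then identifies Q_x with a transpose of E. -/
theorem inner_fderiv_mapQF (hg : IsGeneratingFunction Γ g) {t : Trip n} (ht : t ∈ Γ) (v : Trip n)
    (e : Vec n) :
    ⟪fderiv ℝ (mapQF g) t v, e⟫_ℝ
      = -(gzF g t)⁻¹ * fderiv ℝ (fderiv ℝ g) t v (0, e, ⟪mapQF g t, e⟫_ℝ) := by
  have hz := (hg.gzF_neg ht).ne
  have hD := ((hg.contDiffAt_fderiv ht).differentiableAt (by norm_num)).hasFDerivAt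
  have h1 : HasFDerivAt (fun s => ⟪mapQF g s, e⟫_ℝ) _ t :=
    (((hg.contDiffAt_mapQF ht).differentiableAt (by norm_num)).hasFDerivAt).inner ℝ
      (hasFDerivAt_const e t)
  have h2 : HasFDerivAt (fun s => fderiv ℝ g s (0, e, 0)) _ t :=
    hD.clm_apply (hasFDerivAt_const ((0, e, 0) : Trip n) t)
  have h3 : HasFDerivAt (fun s => fderiv ℝ g s (0, 0, 1)) _ t :=
    hD.clm_apply (hasFDerivAt_const ((0, 0, 1) : Trip n) t)
  have h4 : (fun s => ⟪mapQF g s, e⟫_ℝ) =ᶠ[𝓝 t]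
      fun s => -((fderiv ℝ g s (0, 0, 1))⁻¹ * fderiv ℝ g s (0, e, 0)) := by
    filter_upwards [hg.isOpen.mem_nhds ht] with s hs
    rw [← gzF_eq (hg.differentiableAt hs), ← inner_gyF (hg.differentiableAt hs),
      show mapQF g s = -((gzF g s)⁻¹ • gyF g s) from rfl, inner_neg_left, inner_smul_left]
    simp
  have hz' : fderiv ℝ g t (0, 0, 1) ≠ 0 := by rw [← gzF_eq (hg.differentiableAt ht)]; exact hz
  have h5 : HasFDerivAt (fun s => -((fderiv ℝ g s (0, 0, 1))⁻¹ * fderiv ℝ g s (0, e, 0))) _ t :=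
    (((hasDerivAt_inv hz').comp_hasFDerivAt t h3).mul h2).neg
  have h6 := congrArg (fun L => L v) ((h1.congr_of_eventuallyEq h4.symm).unique h5)
  have h7 : ⟪mapQF g t, e⟫_ℝ = -((fderiv ℝ g t (0, 0, 1))⁻¹ * fderiv ℝ g t (0, e, 0)) :=
    h4.self_of_nhds
  have hsplit : ((0, e, ⟪mapQF g t, e⟫_ℝ) : Trip n)
      = (0, e, 0) + ⟪mapQF g t, e⟫_ℝ • (0, 0, 1) := by ext <;> simp
  rw [hsplit, map_add, map_smul, h7, gzF_eq (hg.differentiableAt ht)]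
  simp [-map_add, real_inner_comm, fderivInnerCLM_apply] at h6
  rw [← real_inner_comm, h6, smul_eq_mul]
  field_simp
  ring

/-- The derivative of `Q` in `x` is the transpose of `-E / g_z`. -/
theorem inner_fderiv_mapQF_fst (hg : IsGeneratingFunction Γ g) {t : Trip n} (ht : t ∈ Γ)
    (ξ e : Vec n) :
    ⟪fderiv ℝ (mapQF g) t (ξ, 0, 0), e⟫_ℝ = -(gzF g t)⁻¹ * ⟪linE g t e, ξ⟫_ℝ := by
  have hs : IsSymmSndFDerivAt ℝ g t := (hg.contDiffAt ht).isSymmSndFDerivAt (by simp)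
  rw [hg.inner_fderiv_mapQF ht, linE_apply, hg.inner_fderiv_gxF ht, hs.eq]

end IsGeneratingFunction
end GenFun

/-! ### The dual generating function and its conditions A1, A2, A1*. -/

namespace GenFun

variable {n : ℕ}

namespace IsGeneratingFunction

variable {Γ : Set (Trip n)} {g : Trip n → ℝ}

/-- Here the fibres must be intervals: the sign of g_z integrates to monotonicity, which makes g*
single valued. -/
theorem strictAntiOn_fibre (hg : IsGeneratingFunction Γ g) (x y : Vec n) :
    StrictAntiOn (fun z => g (x, y, z)) {z : ℝ | (x, y, z) ∈ Γ} := by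
  have hd : ∀ z ∈ {z : ℝ | (x, y, z) ∈ Γ}, HasDerivAt (fun z => g (x, y, z)) (gz g x y z) z :=
    fun z hz =>
      (HasFDerivAt.partial_thd (hg.differentiableAt hz).hasFDerivAt).differentiableAt.hasDerivAt
  refine strictAntiOn_of_deriv_neg (hg.interval x y).convex
    (fun z hz => (hd z hz).continuousAt.continuousWithinAt) fun z hz => ?_
  have hz' := interior_subset hz
  rw [(hd z hz').deriv]
  exact hg.gz_neg x y z hz'

theorem fibre_injective (hg : IsGeneratingFunction Γ g) {x y : Vec n} {z z' : ℝ}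
    (h : (x, y, z) ∈ Γ) (h' : (x, y, z') ∈ Γ) (he : g (x, y, z) = g (x, y, z')) : z = z' :=
  (hg.strictAntiOn_fibre x y).injOn h h' he

theorem mem_dualDomain {x y : Vec n} {z : ℝ} (h : (x, y, z) ∈ Γ) :
    (y, x, g (x, y, z)) ∈ dualDomain Γ g := ⟨x, y, z, h, rfl⟩

theorem dualFun_spec {x y : Vec n} {u : ℝ} (h : (y, x, u) ∈ dualDomain Γ g) :
    (x, y, dualFun Γ g (y, x, u)) ∈ Γ ∧ g (x, y, dualFun Γ g (y, x, u)) = u := by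
  obtain ⟨x', y', z, hz, he⟩ := h
  simp only [Prod.mk.injEq] at he
  obtain ⟨rfl, rfl, rfl⟩ := he
  exact Classical.epsilon_spec (p := fun z' : ℝ => (x, y, z') ∈ Γ ∧ g (x, y, z') = g (x, y, z))
    ⟨z, hz, rfl⟩

theorem dualFun_eq (hg : IsGeneratingFunction Γ g) {x y : Vec n} {z : ℝ} (h : (x, y, z) ∈ Γ) :
    dualFun Γ g (y, x, g (x, y, z)) = z := by
  obtain ⟨h1, h2⟩ := dualFun_spec (mem_dualDomain (g := g) h)
  exact hg.fibre_injective h1 h h2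

theorem dualFun_eq_of_eq (hg : IsGeneratingFunction Γ g) {x y : Vec n} {z u : ℝ}
    (h : (x, y, z) ∈ Γ) (hu : g (x, y, z) = u) : dualFun Γ g (y, x, u) = z := by
  rw [← hu, hg.dualFun_eq h]

/-- The exchange map `(x, y, z) ↦ (y, x, g (x, y, z))` has a local `C²` inverse whose last
component is the dual function. -/
theorem dual_aux (hg : IsGeneratingFunction Γ g) {t : Trip n} (ht : t ∈ Γ) :
    dualDomain Γ g ∈ 𝓝 (t.2.1, t.1, g t) ∧ ContDiffAt ℝ 2 (dualFun Γ g) (t.2.1, t.1, g t) := by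
  set κ : Trip n → Trip n := fun s => (s.2.1, s.1, g s) with hκ
  have hC : ContDiffAt ℝ 2 κ t :=
    (contDiff_fst.comp contDiff_snd).contDiffAt.prodMk
      (contDiff_fst.contDiffAt.prodMk (hg.contDiffAt ht))
  set L : Trip n →L[ℝ] Trip n :=
    ((ContinuousLinearMap.fst ℝ (Vec n) ℝ).comp (ContinuousLinearMap.snd ℝ (Vec n) (Vec n × ℝ))).prod
      ((ContinuousLinearMap.fst ℝ (Vec n) (Vec n × ℝ)).prod (fderiv ℝ g t)) with hL
  have hD : HasFDerivAt κ L t :=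
    ((hasFDerivAt_fst.comp t hasFDerivAt_snd)).prodMk
      (hasFDerivAt_fst.prodMk (hg.differentiableAt ht).hasFDerivAt)
  have hinj : Function.Injective L := by
    refine (injective_iff_map_eq_zero _).2 fun v hv => ?_
    obtain ⟨ξ, η, ζ⟩ := v
    simp only [hL, ContinuousLinearMap.prod_apply, ContinuousLinearMap.comp_apply,
      ContinuousLinearMap.coe_fst', ContinuousLinearMap.coe_snd', Prod.mk_eq_zero] at hv
    obtain ⟨rfl, rfl, h3⟩ := hv
    rw [fderiv_apply (hg.differentiableAt ht)] at h3
    have := (hg.gzF_neg ht).ne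
    simp_all
  let Le : Trip n ≃L[ℝ] Trip n :=
    (LinearEquiv.ofInjectiveEndo (L : Trip n →ₗ[ℝ] Trip n) hinj).toContinuousLinearEquiv
  have hD' : HasFDerivAt κ (Le : Trip n →L[ℝ] Trip n) t := by
    convert hD
    exact ContinuousLinearMap.ext fun _ => rfl
  have hinv := hC.to_localInverse hD' (by norm_num)
  have hcont : ContinuousAt (hC.localInverse hD' (by norm_num)) (κ t) := hinv.continuousAt
  have h0 : hC.localInverse hD' (by norm_num) (κ t) = t := hC.localInverse_apply_image hD' _
  have hev : ∀ᶠ w in 𝓝 (κ t), hC.localInverse hD' (by norm_num) w ∈ Γ ∧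
      κ (hC.localInverse hD' (by norm_num) w) = w := by
    refine (hcont.eventually ?_).and ?_
    · rw [h0]; exact hg.isOpen.mem_nhds ht
    · exact (hC.hasStrictFDerivAt' hD' (by norm_num)).eventually_right_inverse
  have hev2 : ∀ᶠ w in 𝓝 (κ t), w ∈ dualDomain Γ g ∧
      dualFun Γ g w = (hC.localInverse hD' (by norm_num) w).2.2 := by
    filter_upwards [hev] with w hw
    obtain ⟨h1, h2⟩ := hw
    set s := hC.localInverse hD' (by norm_num) w
    rw [← h2]
    exact ⟨mem_dualDomain (x := s.1) (y := s.2.1) (z := s.2.2) h1,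
      hg.dualFun_eq (x := s.1) (y := s.2.1) (z := s.2.2) h1⟩
  refine ⟨hev2.mono fun w hw => hw.1, ?_⟩
  refine ContDiffAt.congr_of_eventuallyEq ?_ (hev2.mono fun w hw => hw.2)
  exact (contDiff_snd.comp contDiff_snd).contDiffAt.comp _ hinv

theorem isOpen_dualDomain (hg : IsGeneratingFunction Γ g) : IsOpen (dualDomain Γ g) := by
  rw [isOpen_iff_mem_nhds]
  rintro _ ⟨x, y, z, h, rfl⟩
  exact (hg.dual_aux h).1

theorem contDiffAt_dualFun (hg : IsGeneratingFunction Γ g) {w : Trip n}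
    (hw : w ∈ dualDomain Γ g) : ContDiffAt ℝ 2 (dualFun Γ g) w := by
  obtain ⟨x, y, z, h, rfl⟩ := hw
  exact (hg.dual_aux h).2

theorem fderiv_dualFun (hg : IsGeneratingFunction Γ g) {x y : Vec n} {z : ℝ}
    (h : (x, y, z) ∈ Γ) (η ξ : Vec n) (μ : ℝ) :
    fderiv ℝ (dualFun Γ g) (y, x, g (x, y, z)) (η, ξ, μ)
      = (gzF g (x, y, z))⁻¹ * (μ - ⟪gxF g (x, y, z), ξ⟫_ℝ - ⟪gyF g (x, y, z), η⟫_ℝ) := by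
  have hw := mem_dualDomain (g := g) h
  have hz := (hg.gzF_neg h).ne
  have hD := ((hg.contDiffAt_dualFun hw).differentiableAt (by norm_num)).hasFDerivAt
  set w : Trip n := (y, x, g (x, y, z)) with hwdef
  have h1 : HasFDerivAt (fun w : Trip n => ((w.2.1, w.1, dualFun Γ g w) : Trip n)) _ w :=
    (hasFDerivAt_fst.comp w hasFDerivAt_snd).prodMk (hasFDerivAt_fst.prodMk hD)
  have hval : ((w.2.1, w.1, dualFun Γ g w) : Trip n) = (x, y, z) := by
    simp [hwdef, hg.dualFun_eq h]
  have h2 : HasFDerivAt g (fderiv ℝ g (x, y, z)) (w.2.1, w.1, dualFun Γ g w) := by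
    rw [hval]; exact (hg.differentiableAt h).hasFDerivAt
  have h3 := HasFDerivAt.comp (g := g) w h2 h1
  have h4 : HasFDerivAt (fun w : Trip n => w.2.2) ((ContinuousLinearMap.snd ℝ (Vec n) ℝ).comp
      (ContinuousLinearMap.snd ℝ (Vec n) (Vec n × ℝ))) w :=
    (hasFDerivAt_snd (p := w.2)).comp w hasFDerivAt_snd
  have h5 : (fun w : Trip n => w.2.2) =ᶠ[𝓝 w] g ∘ fun w : Trip n => (w.2.1, w.1, dualFun Γ g w) := by
    filter_upwards [hg.isOpen_dualDomain.mem_nhds hw] with s hs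
    exact (dualFun_spec (x := s.2.1) (y := s.1) (u := s.2.2) hs).2.symm
  have h6 := congrArg (fun L => L (η, ξ, μ)) ((h3.congr_of_eventuallyEq h5).unique h4)
  simp only [ContinuousLinearMap.comp_apply, ContinuousLinearMap.prod_apply,
    ContinuousLinearMap.coe_fst', ContinuousLinearMap.coe_snd'] at h6
  rw [fderiv_apply (hg.differentiableAt h)] at h6
  rw [eq_inv_mul_iff_mul_eq₀ hz]
  linarith

/-- Implicit differentiation of g(x,y,g*) = u. Together with `mapQF_dualFun` it shows that duality
exchanges p = g_x and Q, so that A1 and A1* are exchanged as well. -/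
theorem gxF_dualFun (hg : IsGeneratingFunction Γ g) {x y : Vec n} {z : ℝ}
    (h : (x, y, z) ∈ Γ) :
    gxF (dualFun Γ g) (y, x, g (x, y, z)) = mapQF g (x, y, z) := by
  refine ext_inner_right ℝ fun η => ?_
  rw [inner_gxF ((hg.contDiffAt_dualFun (mem_dualDomain h)).differentiableAt (by norm_num)),
    hg.fderiv_dualFun h, show mapQF g (x, y, z)
      = -((gzF g (x, y, z))⁻¹ • gyF g (x, y, z)) from rfl, inner_neg_left, inner_smul_left]
  simp

theorem gyF_dualFun (hg : IsGeneratingFunction Γ g) {x y : Vec n} {z : ℝ}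
    (h : (x, y, z) ∈ Γ) :
    gyF (dualFun Γ g) (y, x, g (x, y, z)) = -((gzF g (x, y, z))⁻¹ • gxF g (x, y, z)) := by
  refine ext_inner_right ℝ fun η => ?_
  rw [inner_gyF ((hg.contDiffAt_dualFun (mem_dualDomain h)).differentiableAt (by norm_num)),
    hg.fderiv_dualFun h, inner_neg_left, inner_smul_left]
  simp

theorem gzF_dualFun (hg : IsGeneratingFunction Γ g) {x y : Vec n} {z : ℝ}
    (h : (x, y, z) ∈ Γ) :
    gzF (dualFun Γ g) (y, x, g (x, y, z)) = (gzF g (x, y, z))⁻¹ := by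
  rw [gzF_eq ((hg.contDiffAt_dualFun (mem_dualDomain h)).differentiableAt (by norm_num)),
    hg.fderiv_dualFun h]
  simp

theorem mapQF_dualFun (hg : IsGeneratingFunction Γ g) {x y : Vec n} {z : ℝ}
    (h : (x, y, z) ∈ Γ) :
    mapQF (dualFun Γ g) (y, x, g (x, y, z)) = gxF g (x, y, z) := by
  rw [show ∀ w, mapQF (dualFun Γ g) w
      = -((gzF (dualFun Γ g) w)⁻¹ • gyF (dualFun Γ g) w) from fun _ => rfl,
    hg.gzF_dualFun h, hg.gyF_dualFun h]
  simp [smul_smul, (hg.gzF_neg h).ne]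

/-- The dual of a generating function is a generating function. -/
theorem dual (hg : IsGeneratingFunction Γ g) :
    IsGeneratingFunction (dualDomain Γ g) (dualFun Γ g) where
  isOpen := hg.isOpen_dualDomain
  contDiffOn := fun w hw => (hg.contDiffAt_dualFun hw).contDiffWithinAt
  gz_neg := by
    rintro _ _ _ ⟨x, y, z, h, he⟩
    simp only [Prod.mk.injEq] at he
    obtain ⟨rfl, rfl, rfl⟩ := he
    exact (hg.gzF_dualFun h).trans_lt (inv_lt_zero.2 (hg.gzF_neg h))
  interval := by
    intro y x
    have : {u : ℝ | (y, x, u) ∈ dualDomain Γ g}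
        = (fun z => g (x, y, z)) '' {z | (x, y, z) ∈ Γ} := by
      ext u
      constructor
      · intro hu
        obtain ⟨h1, h2⟩ := dualFun_spec hu
        exact ⟨_, h1, h2⟩
      · rintro ⟨z, hz, rfl⟩
        exact mem_dualDomain hz
    rw [this]
    refine IsPreconnected.ordConnected ?_
    refine IsPreconnected.image (hg.interval x y).isPreconnected _ fun z hz => ?_
    exact (HasFDerivAt.partial_thd
      (hg.differentiableAt hz).hasFDerivAt).continuousAt.continuousWithinAt

theorem dual_A1 (hg : IsGeneratingFunction Γ g) (h1s : A1star Γ g) :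
    A1 (dualDomain Γ g) (dualFun Γ g) := by
  rintro y z q ⟨y', x, u, hm, he⟩
  simp only [Prod.mk.injEq] at he
  obtain ⟨rfl, rfl, rfl⟩ := he
  refine ⟨(x, u), ⟨hm, rfl, rfl⟩, ?_⟩
  rintro ⟨x2, u2⟩ ⟨hm', hz, hq⟩
  obtain ⟨h1, hu⟩ := dualFun_spec hm
  obtain ⟨h1', hu'⟩ := dualFun_spec hm'
  simp only at hm' hz hq h1' hu'
  rw [hz] at h1' hu'
  have hx : x2 = x := by
    refine h1s y _ h1' h1 ?_
    have e1 := hg.gxF_dualFun h1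
    have e2 := hg.gxF_dualFun h1'
    rw [hu] at e1
    rw [hu'] at e2
    exact e2.symm.trans (hq.trans e1)
  subst hx
  rw [← hu, ← hu']

theorem dual_A1star (hg : IsGeneratingFunction Γ g) (h1 : A1 Γ g) :
    A1star (dualDomain Γ g) (dualFun Γ g) := by
  intro x u y hy y' hy' he
  obtain ⟨hm, hu⟩ := dualFun_spec hy
  obtain ⟨hm', hu'⟩ := dualFun_spec hy'
  set z := dualFun Γ g (y, x, u)
  set z' := dualFun Γ g (y', x, u)
  have e1 : mapQ (dualFun Γ g) y x u = gxF g (x, y, z) := by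
    rw [← hg.mapQF_dualFun hm, hu]; rfl
  have e2 : mapQ (dualFun Γ g) y' x u = gxF g (x, y', z') := by
    rw [← hg.mapQF_dualFun hm', hu']; rfl
  have he' : gxF g (x, y, z) = gxF g (x, y', z') := by rw [← e1, ← e2]; exact he
  have := (h1 x u (gxF g (x, y, z)) ⟨x, y, z, hm, by rw [hu]; rfl⟩).unique
    (y₁ := (y, z)) (y₂ := (y', z')) ⟨hm, hu, rfl⟩ ⟨hm', hu', he'.symm⟩
  exact congrArg Prod.fst this

/-- Near a dual point, Q of g* is g_x composed with the exchange map. Differentiating in the first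
slot moves the triple along (0, η, ⟨Q,η⟩), which produces E; thus E of the dual is, up to a nonzero
factor, the transpose of E, and A2 passes to the dual. -/
theorem inner_linE_dualFun (hg : IsGeneratingFunction Γ g) {x y : Vec n} {z : ℝ}
    (h : (x, y, z) ∈ Γ) (ξ η : Vec n) :
    ⟪linE (dualFun Γ g) (y, x, g (x, y, z)) ξ, η⟫_ℝ
      = -(gzF g (x, y, z))⁻¹ * ⟪linE g (x, y, z) η, ξ⟫_ℝ := by
  have hw := mem_dualDomain (g := g) h
  have hz := (hg.gzF_neg h).ne
  set w : Trip n := (y, x, g (x, y, z)) with hwdef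
  have h1 := hg.dual.inner_fderiv_mapQF_fst hw η ξ
  rw [hg.gzF_dualFun h, inv_inv] at h1
  have hD := ((hg.contDiffAt_dualFun hw).differentiableAt (by norm_num)).hasFDerivAt
  have h2 : HasFDerivAt (fun w : Trip n => ((w.2.1, w.1, dualFun Γ g w) : Trip n)) _ w :=
    (hasFDerivAt_fst.comp w hasFDerivAt_snd).prodMk (hasFDerivAt_fst.prodMk hD)
  have hval : ((w.2.1, w.1, dualFun Γ g w) : Trip n) = (x, y, z) := by
    simp [hwdef, hg.dualFun_eq h]
  have h3 : HasFDerivAt (gxF g) (fderiv ℝ (gxF g) (x, y, z)) (w.2.1, w.1, dualFun Γ g w) := by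
    rw [hval]; exact hg.hasFDerivAt_gxF h
  have h4 := HasFDerivAt.comp (g := gxF g) w h3 h2
  have h5 : mapQF (dualFun Γ g) =ᶠ[𝓝 w]
      gxF g ∘ fun w : Trip n => (w.2.1, w.1, dualFun Γ g w) := by
    filter_upwards [hg.isOpen_dualDomain.mem_nhds hw] with s hs
    obtain ⟨b, a, u⟩ := s
    obtain ⟨hs1, hs2⟩ := dualFun_spec hs
    have := hg.mapQF_dualFun hs1
    rwa [hs2] at this
  have h6 := congrArg (fun L => ⟪L ((η, 0, 0) : Trip n), ξ⟫_ℝ)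
    (h4.congr_of_eventuallyEq h5).fderiv
  simp only [ContinuousLinearMap.comp_apply, ContinuousLinearMap.prod_apply,
    ContinuousLinearMap.coe_fst', ContinuousLinearMap.coe_snd'] at h6
  have h7 : fderiv ℝ (dualFun Γ g) w (η, 0, 0) = ⟪mapQF g (x, y, z), η⟫_ℝ := by
    rw [← hg.gxF_dualFun h, inner_gxF hD.differentiableAt]
  rw [h1, h7, ← linE_apply] at h6
  rw [← h6]
  field_simp

theorem dual_A2 (hg : IsGeneratingFunction Γ g) (h2 : A2 Γ g) :
    A2 (dualDomain Γ g) (dualFun Γ g) := by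
  refine hg.dual.A2_of_linE_injective ?_
  rintro _ ⟨x, y, z, h, rfl⟩ ξ h0
  obtain ⟨L, hL⟩ := hg.exists_linE_equiv h2 h
  have h3 := hg.inner_linE_dualFun h ξ (L.symm ξ)
  rw [h0, inner_zero_left, ← hL, L.apply_symm_apply] at h3
  have hz := (hg.gzF_neg h).ne
  simpa [hz] using h3.symm

theorem dualDomain_dual (hg : IsGeneratingFunction Γ g) :
    dualDomain (dualDomain Γ g) (dualFun Γ g) = Γ := by
  ext ⟨x, y, z⟩
  constructor
  · rintro ⟨b, a, u, hm, he⟩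
    simp only [Prod.mk.injEq] at he
    obtain ⟨rfl, rfl, rfl⟩ := he
    exact (dualFun_spec hm).1
  · intro h
    exact ⟨y, x, g (x, y, z), mem_dualDomain h, by rw [hg.dualFun_eq h]⟩

theorem dualFun_dual (hg : IsGeneratingFunction Γ g) {t : Trip n} (ht : t ∈ Γ) :
    dualFun (dualDomain Γ g) (dualFun Γ g) t = g t := by
  obtain ⟨x, y, z⟩ := t
  have := hg.dual.dualFun_eq (mem_dualDomain (g := g) ht)
  rwa [hg.dualFun_eq ht] at this

end IsGeneratingFunction

/-- Condition A3s depends only on the values of the generating function in its domain. -/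
theorem A3s_congr {Γ : Set (Trip n)} {g g' : Trip n → ℝ} (hΓ : IsOpen Γ)
    (h : ∀ t ∈ Γ, g t = g' t) : A3s Γ g ↔ A3s Γ g' := by
  have hev : ∀ t ∈ Γ, g =ᶠ[𝓝 t] g' := fun t ht => by
    filter_upwards [hΓ.mem_nhds ht] with s hs using h s hs
  have hsec : ∀ x y z, (x, y, z) ∈ Γ →
      (fun x' => g (x', y, z)) =ᶠ[𝓝 x] fun x' => g' (x', y, z) := fun x y z ht =>
    ((Continuous.prodMk_left ((y, z) : Vec n × ℝ)).continuousAt (x := x)).eventually (hev _ ht)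
  have hgx : ∀ x y z, (x, y, z) ∈ Γ → gx g x y z = gx g' x y z := fun x y z ht => by
    simp only [gx, gradient, (hsec x y z ht).fderiv_eq]
  have hgxx : ∀ x y z, (x, y, z) ∈ Γ → gxx g x y z = gxx g' x y z := fun x y z ht => by
    have hx : (fun x' => gx g x' y z) =ᶠ[𝓝 x] fun x' => gx g' x' y z := by
      have : ∀ᶠ x' in 𝓝 x, (x', y, z) ∈ Γ :=
        ((Continuous.prodMk_left ((y, z) : Vec n × ℝ)).continuousAt (x := x)).eventually
          (hΓ.mem_nhds ht)
      filter_upwards [this] with x' hx' using hgx x' y z hx'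
    simp only [gxx, hx.fderiv_eq]
  have hj : jets Γ g = jets Γ g' := by
    ext j
    constructor <;> rintro ⟨x, y, z, ht, rfl⟩ <;> refine ⟨x, y, z, ht, ?_⟩
    · rw [h _ ht, hgx _ _ _ ht]
    · rw [h _ ht, hgx _ _ _ ht]
  have hYZ : ∀ x u p, mapYZ Γ g x u p = mapYZ Γ g' x u p := fun x u p => by
    unfold mapYZ
    congr 1
    funext w
    refine propext (and_congr_right fun hw => ?_)
    rw [h _ hw, hgx _ _ _ hw]
  have hA : ∀ x u p, (x, u, p) ∈ jets Γ g → matA Γ g x u p = matA Γ g' x u p := by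
    rintro x u p ⟨a, y, z, ht, he⟩
    simp only [Prod.mk.injEq] at he
    obtain ⟨rfl, rfl, rfl⟩ := he
    have := Classical.epsilon_spec (p := fun w : Vec n × ℝ =>
      (x, w.1, w.2) ∈ Γ ∧ g (x, w.1, w.2) = g (x, y, z) ∧ gx g x w.1 w.2 = gx g x y z)
      ⟨(y, z), ht, rfl, rfl⟩
    unfold matA mapY mapZ
    rw [← hYZ]
    exact hgxx _ _ _ this.1
  unfold A3s
  rw [← hj]
  refine forall_congr' fun U' => forall_congr' fun hU => exists_congr fun δ =>
    and_congr_right fun _ => forall_congr' fun x₀ => forall_congr' fun u₀ =>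
    forall_congr' fun p₀ => forall_congr' fun p₁ => forall_congr' fun hs =>
    forall_congr' fun ξ => forall_congr' fun _ => forall_congr' fun θ =>
    forall_congr' fun hθ => ?_
  have hin : ∀ p ∈ segment ℝ p₀ p₁, (x₀, u₀, p) ∈ jets Γ g := fun p hp =>
    hU.2 (subset_closure (hs p hp))
  rw [hA _ _ _ (hin p₀ (left_mem_segment ..)), hA _ _ _ (hin p₁ (right_mem_segment ..)),
    hA _ _ (pt p₀ p₁ θ) (hin _ ⟨1 - θ, θ, by linarith [hθ.2], hθ.1, by ring, rfl⟩)]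

end GenFun

/-! ### Second order comparison, continuity of A, and A3s from a midpoint gap. -/

namespace GenFun

variable {n : ℕ}

section Taylor

variable {E : Type*} [NormedAddCommGroup E] [InnerProductSpace ℝ E]

/-- Second order Taylor expansion of a function with a differentiable gradient. -/
theorem isLittleO_taylor_two {P : E → ℝ} {G : E → E} {H : E →L[ℝ] E} {x₀ : E}
    (hP : ∀ᶠ x in 𝓝 x₀, HasFDerivAt P (innerSL ℝ (G x)) x) (hG : HasFDerivAt G H x₀) :
    (fun v => P (x₀ + v) - P x₀ - ⟪G x₀, v⟫_ℝ - 1 / 2 * ⟪H v, v⟫_ℝ)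
      =o[𝓝 (0 : E)] fun v => ‖v‖ ^ 2 := by
  rw [Asymptotics.isLittleO_iff]
  intro ε hε
  have h1 := (hasFDerivAt_iff_isLittleO.1 hG).def hε
  obtain ⟨r, hr, hball⟩ := Metric.eventually_nhds_iff.1 (hP.and h1)
  filter_upwards [Metric.ball_mem_nhds (0 : E) hr] with v hv
  rw [mem_ball_zero_iff] at hv
  have hx : ∀ t ∈ Icc (0 : ℝ) 1, dist (x₀ + t • v) x₀ < r := fun t ht => by
    rw [dist_eq_norm, add_sub_cancel_left, norm_smul, Real.norm_of_nonneg ht.1]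
    exact (mul_le_of_le_one_left (norm_nonneg _) ht.2).trans_lt hv
  have hd : ∀ t ∈ Icc (0 : ℝ) 1, HasDerivWithinAt
      (fun t : ℝ => P (x₀ + t • v) - t * ⟪G x₀, v⟫_ℝ - t ^ 2 * (1 / 2 * ⟪H v, v⟫_ℝ))
      (⟪G (x₀ + t • v) - G x₀ - H (t • v), v⟫_ℝ) (Icc 0 1) t := by
    intro t ht
    have hl : HasDerivAt (fun t : ℝ => x₀ + t • v) v t := by
      simpa using ((hasDerivAt_id t).smul_const v).const_add x₀
    have h2 := ((hball (hx t ht)).1.comp_hasDerivAt t hl)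
    have h3 := (h2.sub ((hasDerivAt_id t).mul_const ⟪G x₀, v⟫_ℝ)).sub
      ((hasDerivAt_pow 2 t).mul_const (1 / 2 * ⟪H v, v⟫_ℝ))
    refine (h3.congr_deriv ?_).hasDerivWithinAt
    simp only [innerSL_apply_apply, inner_sub_left, map_smul, inner_smul_left]
    simp
    ring
  have hb : ∀ t ∈ Ico (0 : ℝ) 1,
      ‖⟪G (x₀ + t • v) - G x₀ - H (t • v), v⟫_ℝ‖ ≤ ε * ‖v‖ ^ 2 := by
    intro t ht
    have ht' : t ∈ Icc (0 : ℝ) 1 := ⟨ht.1, ht.2.le⟩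
    have h4 := (hball (hx t ht')).2
    rw [add_sub_cancel_left, norm_smul, Real.norm_of_nonneg ht.1] at h4
    calc _ ≤ ‖G (x₀ + t • v) - G x₀ - H (t • v)‖ * ‖v‖ := norm_inner_le_norm _ _
      _ ≤ (ε * (t * ‖v‖)) * ‖v‖ := by gcongr
      _ ≤ (ε * (1 * ‖v‖)) * ‖v‖ := by gcongr; exact ht'.2
      _ = _ := by ring
  have := norm_image_sub_le_of_norm_deriv_le_segment_01' hd hb
  simp only [one_smul, zero_smul, add_zero] at this
  rw [Real.norm_of_nonneg (by positivity : (0 : ℝ) ≤ ‖v‖ ^ 2)]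
  refine le_of_eq_of_le (congrArg _ ?_) this
  ring

/-- The linear term is subtracted at v itself and not at its leading part s ξ, so curves with a
second order bend are allowed; only their direction survives in the limit. -/
theorem tendsto_taylor_two {P : E → ℝ} {G : E → E} {H : E →L[ℝ] E} {x₀ : E}
    (hP : ∀ᶠ x in 𝓝 x₀, HasFDerivAt P (innerSL ℝ (G x)) x) (hG : HasFDerivAt G H x₀)
    {ι : Type*} {l : Filter ι} {v : ι → E} {s : ι → ℝ} {ξ : E} (hv : Tendsto v l (𝓝 0))
    (hs : ∀ᶠ i in l, s i ≠ 0) (hξ : Tendsto (fun i => (s i)⁻¹ • v i) l (𝓝 ξ)) :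
    Tendsto (fun i => (P (x₀ + v i) - P x₀ - ⟪G x₀, v i⟫_ℝ) / s i ^ 2) l
      (𝓝 (1 / 2 * ⟪H ξ, ξ⟫_ℝ)) := by
  have h1 := (isLittleO_taylor_two hP hG).comp_tendsto hv
  have h2 : (fun i => ‖v i‖ ^ 2) =O[l] fun i => s i ^ 2 := by
    have h3 : v =O[l] s := by
      have h4 : (fun i => (s i)⁻¹ • v i) =O[l] fun _ => (1 : ℝ) := hξ.isBigO_one ℝ
      have h5 := (Asymptotics.isBigO_refl s l).smul h4
      refine (h5.congr' ?_ ?_)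
      · filter_upwards [hs] with i hi
        rw [smul_smul, mul_inv_cancel₀ hi, one_smul]
      · exact Eventually.of_forall fun i => by simp
    exact h3.norm_left.pow 2
  have h6 := (h1.trans_isBigO h2).tendsto_div_nhds_zero
  have h7 : Tendsto (fun i => 1 / 2 * ⟪H ((s i)⁻¹ • v i), (s i)⁻¹ • v i⟫_ℝ) l
      (𝓝 (1 / 2 * ⟪H ξ, ξ⟫_ℝ)) :=
    (((H.continuous.tendsto ξ).comp hξ).inner hξ).const_mul _
  have h8 := h6.add h7
  rw [zero_add] at h8
  refine h8.congr' ?_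
  filter_upwards [hs] with i hi
  simp only [Function.comp_apply, map_smul, inner_smul_left, inner_smul_right]
  simp
  field_simp
  ring

/-- A maximum of two functions that lies above a third one quadratically, when the gradients are
arranged on a segment, gives an inequality between the Hessians orthogonally to the segment. -/
theorem hessian_le_of_le_max {f fa fb : E → ℝ} {G Ga Gb : E → E} {H Ha Hb : E →L[ℝ] E} {x₀ : E}
    (hf : ∀ᶠ x in 𝓝 x₀, HasFDerivAt f (innerSL ℝ (G x)) x) (hG : HasFDerivAt G H x₀)
    (hfa : ∀ᶠ x in 𝓝 x₀, HasFDerivAt fa (innerSL ℝ (Ga x)) x) (hGa : HasFDerivAt Ga Ha x₀)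
    (hfb : ∀ᶠ x in 𝓝 x₀, HasFDerivAt fb (innerSL ℝ (Gb x)) x) (hGb : HasFDerivAt Gb Hb x₀)
    (ha : fa x₀ = f x₀) (hb : fb x₀ = f x₀) {q : E} (hq : q ≠ 0)
    (hqa : Ga x₀ = G x₀ - (1 / 2 : ℝ) • q) (hqb : Gb x₀ = G x₀ + (1 / 2 : ℝ) • q) {C : ℝ}
    (hmax : ∀ᶠ x in 𝓝 x₀, f x ≤ max (fa x) (fb x) - C * ‖x - x₀‖ ^ 2) {ξ : E}
    (hξ : ⟪ξ, q⟫_ℝ = 0) :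
    ⟪H ξ, ξ⟫_ℝ ≤ 1 / 2 * (⟪Ha ξ, ξ⟫_ℝ + ⟪Hb ξ, ξ⟫_ℝ) - 2 * C * ‖ξ‖ ^ 2 := by
  -- Bending the curve by s² τ q moves the limits of (fa - f)/s² and (fb - f)/s² by opposite
  -- amounts. This τ makes both equal to their mean, so it does not matter which function attains
  -- the maximum.
  set τ : ℝ := (⟪Ha ξ, ξ⟫_ℝ - ⟪Hb ξ, ξ⟫_ℝ) / (2 * ‖q‖ ^ 2) with hτ
  have hq' : ‖q‖ ≠ 0 := norm_ne_zero_iff.2 hq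
  set v : ℝ → E := fun s => s • ξ + s ^ 2 • τ • q with hv
  have hv0 : Tendsto v (𝓝[>] 0) (𝓝 0) := by
    have : Continuous v := by fun_prop
    have h := this.tendsto 0
    simp only [hv, zero_smul, ne_eq, OfNat.ofNat_ne_zero, not_false_eq_true, zero_pow,
      add_zero] at h
    exact h.mono_left nhdsWithin_le_nhds
  have hs : ∀ᶠ s : ℝ in 𝓝[>] 0, s ≠ 0 := by
    filter_upwards [self_mem_nhdsWithin] with s hs using (ne_of_gt hs)
  have hvξ : Tendsto (fun s : ℝ => s⁻¹ • v s) (𝓝[>] 0) (𝓝 ξ) := by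
    have : Continuous fun s : ℝ => ξ + s • τ • q := by fun_prop
    have h := this.tendsto 0
    simp only [zero_smul, add_zero] at h
    refine (h.mono_left nhdsWithin_le_nhds).congr' ?_
    filter_upwards [hs] with s hs
    simp only [hv, smul_add, smul_smul]
    congr 1
    · rw [inv_mul_cancel₀ hs, one_smul]
    · congr 1; field_simp
  have t0 := tendsto_taylor_two hf hG hv0 hs hvξ
  have ta := tendsto_taylor_two hfa hGa hv0 hs hvξ
  have tb := tendsto_taylor_two hfb hGb hv0 hs hvξ
  have key : ∀ᶠ s : ℝ in 𝓝[>] 0, C * ‖s⁻¹ • v s‖ ^ 2 ≤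
      max ((fa (x₀ + v s) - fa x₀ - ⟪Ga x₀, v s⟫_ℝ) / s ^ 2
          - (f (x₀ + v s) - f x₀ - ⟪G x₀, v s⟫_ℝ) / s ^ 2 - 1 / 2 * τ * ‖q‖ ^ 2)
        ((fb (x₀ + v s) - fb x₀ - ⟪Gb x₀, v s⟫_ℝ) / s ^ 2
          - (f (x₀ + v s) - f x₀ - ⟪G x₀, v s⟫_ℝ) / s ^ 2 + 1 / 2 * τ * ‖q‖ ^ 2) := by
    have hx : Tendsto (fun s => x₀ + v s) (𝓝[>] 0) (𝓝 x₀) := by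
      simpa using hv0.const_add x₀
    filter_upwards [hx.eventually hmax, self_mem_nhdsWithin] with s h1 hs
    have hs0 : (0 : ℝ) < s := hs
    have hqv : ⟪q, v s⟫_ℝ = s ^ 2 * (τ * ‖q‖ ^ 2) := by
      simp only [hv, inner_add_right, inner_smul_right, real_inner_self_eq_norm_sq]
      rw [real_inner_comm, hξ]; ring
    have e1 : (fa (x₀ + v s) - fa x₀ - ⟪Ga x₀, v s⟫_ℝ) / s ^ 2
          - (f (x₀ + v s) - f x₀ - ⟪G x₀, v s⟫_ℝ) / s ^ 2 - 1 / 2 * τ * ‖q‖ ^ 2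
        = (fa (x₀ + v s) - f (x₀ + v s)) / s ^ 2 := by
      rw [hqa, ha, inner_sub_left, inner_smul_left, hqv]
      simp; field_simp; ring
    have e2 : (fb (x₀ + v s) - fb x₀ - ⟪Gb x₀, v s⟫_ℝ) / s ^ 2
          - (f (x₀ + v s) - f x₀ - ⟪G x₀, v s⟫_ℝ) / s ^ 2 + 1 / 2 * τ * ‖q‖ ^ 2
        = (fb (x₀ + v s) - f (x₀ + v s)) / s ^ 2 := by
      rw [hqb, hb, inner_add_left, inner_smul_left, hqv]
      simp; field_simp; ring
    rw [e1, e2]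
    rw [add_sub_cancel_left] at h1
    have e3 : C * ‖s⁻¹ • v s‖ ^ 2 * s ^ 2 = C * ‖v s‖ ^ 2 := by
      rw [norm_smul, norm_inv, Real.norm_of_nonneg hs0.le]; field_simp
    rcases le_max_iff.1 (le_sub_iff_add_le.1 h1) with h | h
    · refine le_max_of_le_left ?_
      rw [le_div_iff₀ (by positivity)]; linarith
    · refine le_max_of_le_right ?_
      rw [le_div_iff₀ (by positivity)]; linarith
  have hlim := le_of_tendsto_of_tendsto ((hvξ.norm.pow 2).const_mul C)
    (((ta.sub t0).sub_const (1 / 2 * τ * ‖q‖ ^ 2)).max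
      ((tb.sub t0).add_const (1 / 2 * τ * ‖q‖ ^ 2))) key
  have e3 : τ * ‖q‖ ^ 2 = (⟪Ha ξ, ξ⟫_ℝ - ⟪Hb ξ, ξ⟫_ℝ) / 2 := by
    rw [hτ]; field_simp
  rcases le_max_iff.1 hlim with h | h <;> linarith [e3]

end Taylor

/-- A continuous function satisfying a strong midpoint inequality at small distances is strongly
convex. -/
theorem strongly_convex_of_midpoint {ψ : ℝ → ℝ} {m ℓ : ℝ} (hc : ContinuousOn ψ (Icc 0 1))
    (hℓ : 0 < ℓ) (h : ∀ a ∈ Icc (0 : ℝ) 1, ∀ b ∈ Icc (0 : ℝ) 1, |b - a| ≤ ℓ →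
      ψ ((a + b) / 2) ≤ (ψ a + ψ b) / 2 - m / 4 * (b - a) ^ 2) {θ : ℝ} (hθ : θ ∈ Icc (0 : ℝ) 1) :
    ψ θ ≤ (1 - θ) * ψ 0 + θ * ψ 1 - m * θ * (1 - θ) := by
  set φ : ℝ → ℝ := fun t => ψ t - (1 - t) * ψ 0 - t * ψ 1 + m * t * (1 - t) with hφ
  have hφc : ContinuousOn φ (Icc 0 1) := by
    refine ((hc.sub ?_).sub ?_).add ?_ <;> exact Continuous.continuousOn (by fun_prop)
  have hmid : ∀ a ∈ Icc (0 : ℝ) 1, ∀ b ∈ Icc (0 : ℝ) 1, |b - a| ≤ ℓ →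
      φ ((a + b) / 2) ≤ (φ a + φ b) / 2 := by
    intro a ha b hb hab
    have := h a ha b hb hab
    simp only [hφ]
    nlinarith
  suffices φ θ ≤ 0 by simp only [hφ] at this; linarith
  by_contra! hpos
  obtain ⟨t₀, ht₀, hmax⟩ := isCompact_Icc.exists_isMaxOn (nonempty_of_mem hθ) hφc
  have hM : 0 < φ t₀ := hpos.trans_le (hmax hθ)
  have hK : IsCompact (Icc (0 : ℝ) 1 ∩ φ ⁻¹' {φ t₀}) :=
    isCompact_Icc.of_isClosed_subset
      (hφc.preimage_isClosed_of_isClosed isClosed_Icc isClosed_singleton) inter_subset_left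
  -- At the largest maximiser the value a little to the right is strictly smaller, which the
  -- midpoint inequality forbids.
  obtain ⟨t, ⟨ht, hφt⟩, hgr⟩ := hK.exists_isGreatest ⟨t₀, ht₀, rfl⟩
  have hφt' : φ t = φ t₀ := hφt
  have h0 : φ 0 = 0 := by simp [hφ]
  have h1 : φ 1 = 0 := by simp [hφ]
  have ht0 : 0 < t := lt_of_le_of_ne ht.1 fun e => by rw [← e, h0] at hφt'; linarith
  have ht1 : t < 1 := lt_of_le_of_ne ht.2 fun e => by rw [e, h1] at hφt'; linarith
  set s := min (ℓ / 2) (min t (1 - t)) with hs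
  have hs0 : 0 < s := lt_min (by linarith) (lt_min ht0 (by linarith))
  have hs1 : s ≤ ℓ / 2 := min_le_left _ _
  have hs2 : s ≤ t := (min_le_right _ _).trans (min_le_left _ _)
  have hs3 : s ≤ 1 - t := (min_le_right _ _).trans (min_le_right _ _)
  have ha : t - s ∈ Icc (0 : ℝ) 1 := ⟨by linarith, by linarith [ht.2]⟩
  have hb : t + s ∈ Icc (0 : ℝ) 1 := ⟨by linarith [ht.1], by linarith⟩
  have h2 := hmid _ ha _ hb (by rw [abs_of_nonneg] <;> linarith)
  rw [show (t - s + (t + s)) / 2 = t by ring] at h2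
  have h3 : φ (t - s) ≤ φ t₀ := hmax ha
  have h4 : φ (t + s) < φ t₀ := lt_of_le_of_ne (hmax hb) fun e => by
    have := hgr ⟨hb, e⟩
    linarith
  linarith

namespace IsGeneratingFunction

variable {Γ : Set (Trip n)} {g : Trip n → ℝ}

theorem hasFDerivAt_fst (hg : IsGeneratingFunction Γ g) {x y : Vec n} {z : ℝ}
    (h : (x, y, z) ∈ Γ) :
    HasFDerivAt (fun x' => g (x', y, z)) (innerSL ℝ (gx g x y z)) x := by
  refine (HasFDerivAt.partial_fst (hg.differentiableAt h).hasFDerivAt).congr_fderiv ?_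
  ext1 ξ
  have := inner_gxF (hg.differentiableAt h) ξ
  simpa [Prod.mk_zero_zero, gxF] using this.symm

theorem eventually_mem_fst (hg : IsGeneratingFunction Γ g) {x y : Vec n} {z : ℝ}
    (h : (x, y, z) ∈ Γ) : ∀ᶠ x' in 𝓝 x, (x', y, z) ∈ Γ :=
  ((Continuous.prodMk_left ((y, z) : Vec n × ℝ)).continuousAt (x := x)).eventually
    (hg.isOpen.mem_nhds h)

theorem eventually_hasFDerivAt_fst (hg : IsGeneratingFunction Γ g) {x y : Vec n} {z : ℝ}
    (h : (x, y, z) ∈ Γ) :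
    ∀ᶠ x' in 𝓝 x, HasFDerivAt (fun x' => g (x', y, z)) (innerSL ℝ (gx g x' y z)) x' :=
  (hg.eventually_mem_fst h).mono fun _ h' => hg.hasFDerivAt_fst h'

end IsGeneratingFunction

theorem mem_jets {Γ : Set (Trip n)} {g : Trip n → ℝ} {x y : Vec n} {z : ℝ}
    (h : (x, y, z) ∈ Γ) : (x, g (x, y, z), gx g x y z) ∈ jets Γ g := ⟨x, y, z, h, rfl⟩

/-- The triple `(x, Y(x,u,p), Z(x,u,p))`. -/
noncomputable def tripOf (Γ : Set (Trip n)) (g : Trip n → ℝ) (j : Jet n) : Trip n :=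
  (j.1, mapY Γ g j.1 j.2.1 j.2.2, mapZ Γ g j.1 j.2.1 j.2.2)

theorem mapYZ_spec {Γ : Set (Trip n)} {g : Trip n → ℝ} {x : Vec n} {u : ℝ} {p : Vec n}
    (h : (x, u, p) ∈ jets Γ g) :
    (x, mapY Γ g x u p, mapZ Γ g x u p) ∈ Γ ∧ g (x, mapY Γ g x u p, mapZ Γ g x u p) = u ∧
      gx g x (mapY Γ g x u p) (mapZ Γ g x u p) = p := by
  obtain ⟨x', y, z, ht, he⟩ := h
  simp only [Prod.mk.injEq] at he
  obtain ⟨rfl, rfl, rfl⟩ := he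
  exact Classical.epsilon_spec (p := fun w : Vec n × ℝ =>
      (x, w.1, w.2) ∈ Γ ∧ g (x, w.1, w.2) = g (x, y, z) ∧ gx g x w.1 w.2 = gx g x y z)
      ⟨(y, z), ht, rfl, rfl⟩

theorem A1.mapYZ_eq {Γ : Set (Trip n)} {g : Trip n → ℝ} (h1 : A1 Γ g) {x y : Vec n} {z u : ℝ}
    {p : Vec n} (h : (x, y, z) ∈ Γ) (hu : g (x, y, z) = u) (hp : gx g x y z = p) :
    mapY Γ g x u p = y ∧ mapZ Γ g x u p = z := by
  subst hu hp
  have := (h1 _ _ _ (mem_jets h)).unique (y₁ := mapYZ Γ g x (g (x, y, z)) (gx g x y z))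
    (y₂ := (y, z)) (mapYZ_spec (mem_jets h)) ⟨h, rfl, rfl⟩
  exact ⟨congrArg Prod.fst this, congrArg Prod.snd this⟩

theorem A1.tripOf_eq {Γ : Set (Trip n)} {g : Trip n → ℝ} (h1 : A1 Γ g) {x y : Vec n} {z : ℝ}
    (h : (x, y, z) ∈ Γ) : tripOf Γ g (x, g (x, y, z), gx g x y z) = (x, y, z) := by
  obtain ⟨hy, hz⟩ := h1.mapYZ_eq h rfl rfl
  simp only [tripOf, hy, hz]

namespace IsGeneratingFunction

variable {Γ : Set (Trip n)} {g : Trip n → ℝ}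

/-- The map `(x, y, z) ↦ (x, g, g_x)` is a local homeomorphism, with inverse `tripOf`. -/
theorem jet_aux (hg : IsGeneratingFunction Γ g) (h1 : A1 Γ g) (h2 : A2 Γ g) {t : Trip n}
    (ht : t ∈ Γ) :
    jets Γ g ∈ 𝓝 (t.1, g t, gxF g t) ∧ ContinuousAt (tripOf Γ g) (t.1, g t, gxF g t) := by
  -- The components are ordered so that source and target are the same space, where an injective
  -- linear map is invertible; `hsw` restores the order of jets.
  set κ : Trip n → Trip n := fun s => (s.1, gxF g s, g s) with hκ
  have hC : ContDiffAt ℝ 1 κ t :=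
    contDiff_fst.contDiffAt.prodMk
      ((hg.contDiffAt_gxF ht).prodMk ((hg.contDiffAt ht).of_le (by norm_num)))
  set L : Trip n →L[ℝ] Trip n :=
    (ContinuousLinearMap.fst ℝ (Vec n) (Vec n × ℝ)).prod
      ((fderiv ℝ (gxF g) t).prod (fderiv ℝ g t)) with hL
  have hD : HasFDerivAt κ L t :=
    _root_.hasFDerivAt_fst.prodMk
      ((hg.hasFDerivAt_gxF ht).prodMk (hg.differentiableAt ht).hasFDerivAt)
  have hinj : Function.Injective L := by
    refine (injective_iff_map_eq_zero _).2 fun v hv => ?_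
    obtain ⟨ξ, η, ζ⟩ := v
    simp only [hL, ContinuousLinearMap.prod_apply,
      ContinuousLinearMap.coe_fst', Prod.mk_eq_zero] at hv
    obtain ⟨rfl, hgx, h3⟩ := hv
    rw [fderiv_apply (hg.differentiableAt ht), inner_zero_right, zero_add] at h3
    have hz := (hg.gzF_neg ht).ne
    -- A kernel vector is tangent to the level set of g(x,·,·), so E is what acts on its
    -- y-component, and A2 applies.
    have hζ : ζ = ⟪mapQF g t, η⟫_ℝ := by
      rw [show mapQF g t = -((gzF g t)⁻¹ • gyF g t) from rfl, inner_neg_left, inner_smul_left]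
      simp only [conj_trivial]
      field_simp
      linarith
    have hη : η = 0 := hg.linE_injective h2 ht (by rw [linE_apply, ← hζ, hgx])
    subst hη
    simp [hζ]
  let Le : Trip n ≃L[ℝ] Trip n :=
    (LinearEquiv.ofInjectiveEndo (L : Trip n →ₗ[ℝ] Trip n) hinj).toContinuousLinearEquiv
  have hD' : HasFDerivAt κ (Le : Trip n →L[ℝ] Trip n) t := by
    convert hD
    exact ContinuousLinearMap.ext fun _ => rfl
  have hcont : ContinuousAt (hC.localInverse hD' (by norm_num)) (κ t) :=
    (hC.to_localInverse hD' (by norm_num)).continuousAt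
  have h0 : hC.localInverse hD' (by norm_num) (κ t) = t := hC.localInverse_apply_image hD' _
  have hev : ∀ᶠ w in 𝓝 (κ t), hC.localInverse hD' (by norm_num) w ∈ Γ ∧
      κ (hC.localInverse hD' (by norm_num) w) = w := by
    refine (hcont.eventually ?_).and ?_
    · rw [h0]; exact hg.isOpen.mem_nhds ht
    · exact (hC.hasStrictFDerivAt' hD' (by norm_num)).eventually_right_inverse
  have hsw : ContinuousAt (fun j : Jet n => ((j.1, j.2.2, j.2.1) : Trip n)) (t.1, g t, gxF g t) :=
    Continuous.continuousAt (by fun_prop)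
  have hev2 : ∀ᶠ j : Jet n in 𝓝 (t.1, g t, gxF g t), j ∈ jets Γ g ∧
      hC.localInverse hD' (by norm_num) (j.1, j.2.2, j.2.1) = tripOf Γ g j := by
    filter_upwards [hsw.eventually hev] with j hj
    obtain ⟨hj1, hj2⟩ := hj
    set s := hC.localInverse hD' (by norm_num) (j.1, j.2.2, j.2.1)
    simp only [hκ, Prod.mk.injEq] at hj2
    have hj' : j = (s.1, g (s.1, s.2.1, s.2.2), gx g s.1 s.2.1 s.2.2) := by
      ext1
      · exact hj2.1.symm
      · ext1
        · exact hj2.2.2.symm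
        · exact hj2.2.1.symm
    have hs : (s.1, s.2.1, s.2.2) ∈ Γ := hj1
    exact ⟨hj' ▸ mem_jets hs, by rw [hj', h1.tripOf_eq hs]⟩
  refine ⟨hev2.mono fun j hj => hj.1, ?_⟩
  refine (ContinuousAt.comp (f := fun j : Jet n => ((j.1, j.2.2, j.2.1) : Trip n))
    (g := hC.localInverse hD' (by norm_num)) hcont hsw).congr ?_
  exact hev2.mono fun j hj => hj.2

theorem isOpen_jets (hg : IsGeneratingFunction Γ g) (h1 : A1 Γ g) (h2 : A2 Γ g) :
    IsOpen (jets Γ g) := by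
  rw [isOpen_iff_mem_nhds]
  rintro _ ⟨x, y, z, h, rfl⟩
  exact (hg.jet_aux h1 h2 h).1

theorem continuousAt_tripOf (hg : IsGeneratingFunction Γ g) (h1 : A1 Γ g) (h2 : A2 Γ g)
    {j : Jet n} (hj : j ∈ jets Γ g) : ContinuousAt (tripOf Γ g) j := by
  obtain ⟨x, y, z, h, rfl⟩ := hj
  exact (hg.jet_aux h1 h2 h).2

theorem continuousAt_matA (hg : IsGeneratingFunction Γ g) (h1 : A1 Γ g) (h2 : A2 Γ g)
    {j : Jet n} (hj : j ∈ jets Γ g) :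
    ContinuousAt (fun j : Jet n => matA Γ g j.1 j.2.1 j.2.2) j := by
  have h3 : tripOf Γ g j ∈ Γ := (mapYZ_spec (x := j.1) (u := j.2.1) (p := j.2.2) hj).1
  exact ContinuousAt.comp (f := tripOf Γ g) (hg.continuousAt_gxx h3)
    (hg.continuousAt_tripOf h1 h2 hj)

end IsGeneratingFunction

theorem pt_mem_segment (p₀ p₁ : Vec n) {θ : ℝ} (hθ : θ ∈ Icc (0 : ℝ) 1) :
    pt p₀ p₁ θ ∈ segment ℝ p₀ p₁ :=
  ⟨1 - θ, θ, by linarith [hθ.2], hθ.1, by ring, rfl⟩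

theorem SegIn.sub {U : Set (Jet n)} {x₀ : Vec n} {u₀ : ℝ} {p₀ p₁ : Vec n}
    (h : SegIn U x₀ u₀ p₀ p₁) {a b : Vec n} (ha : a ∈ segment ℝ p₀ p₁)
    (hb : b ∈ segment ℝ p₀ p₁) : SegIn U x₀ u₀ a b := fun p hp =>
  h p ((convex_segment p₀ p₁).segment_subset ha hb hp)

/-- Along a segment of jets, the middle function lies quadratically below the maximum of the
extreme ones, near the base point. -/
def MidpointGap (Γ : Set (Trip n)) (g : Trip n → ℝ) : Prop :=
  ∀ U' : Set (Jet n), CompactlyIn U' (jets Γ g) → ∃ c : ℝ, 0 < c ∧ ∃ ℓ : ℝ, 0 < ℓ ∧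
    ∀ (x₀ : Vec n) (u₀ : ℝ) (p₀ p₁ : Vec n), SegIn U' x₀ u₀ p₀ p₁ → ‖p₁ - p₀‖ ≤ ℓ →
      ∀ᶠ x in 𝓝 x₀,
        g (x, mapY Γ g x₀ u₀ (pt p₀ p₁ (1 / 2)), mapZ Γ g x₀ u₀ (pt p₀ p₁ (1 / 2)))
          ≤ max (g (x, mapY Γ g x₀ u₀ p₀, mapZ Γ g x₀ u₀ p₀))
                (g (x, mapY Γ g x₀ u₀ p₁, mapZ Γ g x₀ u₀ p₁))
            - c * ‖p₁ - p₀‖ ^ 2 * ‖x - x₀‖ ^ 2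

/-- At x₀ the three functions share the value u₀ and their gradients are equally spaced on a
segment, so `hessian_le_of_le_max` turns the gap into a midpoint inequality for (Aξ,ξ) with ξ
orthogonal to the segment. Continuity of A and `strongly_convex_of_midpoint` then give all θ. -/
theorem A3s_of_midpointGap {Γ : Set (Trip n)} {g : Trip n → ℝ} (hg : IsGeneratingFunction Γ g)
    (h1 : A1 Γ g) (h2 : A2 Γ g) (h : MidpointGap Γ g) : A3s Γ g := by
  intro U' hU
  obtain ⟨c, hc, ℓ, hℓ, H⟩ := h U' hU
  -- The Hessian comparison doubles c and strong convexity with modulus m loses m/4 at midpoints, so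
  -- m = 8c.
  refine ⟨8 * c, by positivity, fun x₀ u₀ p₀ p₁ hseg ξ hξ θ hθ => ?_⟩
  have hin : ∀ p ∈ segment ℝ p₀ p₁, (x₀, u₀, p) ∈ jets Γ g := fun p hp =>
    hU.2 (subset_closure (hseg p hp))
  set ψ : ℝ → ℝ := fun t => ⟪matA Γ g x₀ u₀ (pt p₀ p₁ t) ξ, ξ⟫_ℝ with hψ
  have hψc : ContinuousOn ψ (Icc 0 1) := by
    intro t ht
    have hA := hg.continuousAt_matA h1 h2 (hin _ (pt_mem_segment p₀ p₁ ht))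
    have hp : ContinuousAt (fun t : ℝ => ((x₀, u₀, pt p₀ p₁ t) : Jet n)) t := by
      unfold pt
      exact Continuous.continuousAt (by fun_prop)
    have := ContinuousAt.comp (f := fun t : ℝ => ((x₀, u₀, pt p₀ p₁ t) : Jet n)) hA hp
    exact ((this.clm_apply continuousAt_const).inner continuousAt_const).continuousWithinAt
  have hmid : ∀ a ∈ Icc (0 : ℝ) 1, ∀ b ∈ Icc (0 : ℝ) 1, |b - a| ≤ ℓ / (‖p₁ - p₀‖ + 1) →
      ψ ((a + b) / 2) ≤ (ψ a + ψ b) / 2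
        - (8 * c * ‖p₁ - p₀‖ ^ 2 * ‖ξ‖ ^ 2) / 4 * (b - a) ^ 2 := by
    intro a ha b hb hab
    have hdiff : pt p₀ p₁ b - pt p₀ p₁ a = (b - a) • (p₁ - p₀) := by
      unfold pt; module
    have hm : pt (pt p₀ p₁ a) (pt p₀ p₁ b) (1 / 2) = pt p₀ p₁ ((a + b) / 2) := by
      unfold pt; module
    rcases eq_or_ne ((b - a) • (p₁ - p₀)) 0 with h0 | h0
    · rcases smul_eq_zero.1 h0 with h0 | h0
      · have hab' : b = a := sub_eq_zero.1 h0
        subst hab'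
        simp
      · have : p₁ = p₀ := sub_eq_zero.1 h0
        subst this
        have hpt : ∀ t, pt p₁ p₁ t = p₁ := fun t => by unfold pt; module
        simp [hψ, hpt]
    have hsm := pt_mem_segment p₀ p₁ ha
    have hsb := pt_mem_segment p₀ p₁ hb
    have hab2 : (a + b) / 2 ∈ Icc (0 : ℝ) 1 :=
      ⟨by linarith [ha.1, hb.1], by linarith [ha.2, hb.2]⟩
    have hsc := pt_mem_segment p₀ p₁ hab2
    have hlen : ‖pt p₀ p₁ b - pt p₀ p₁ a‖ ≤ ℓ := by
      rw [hdiff, norm_smul, Real.norm_eq_abs]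
      rw [le_div_iff₀ (by positivity)] at hab
      nlinarith [norm_nonneg (p₁ - p₀), abs_nonneg (b - a)]
    have hgap := H x₀ u₀ _ _ (hseg.sub hsm hsb) hlen
    rw [hm] at hgap
    obtain ⟨ma, ua, ga⟩ := mapYZ_spec (hin _ hsm)
    obtain ⟨mb, ub, gb⟩ := mapYZ_spec (hin _ hsb)
    obtain ⟨mc, uc, gc⟩ := mapYZ_spec (hin _ hsc)
    have := hessian_le_of_le_max (hg.eventually_hasFDerivAt_fst mc) (hg.hasFDerivAt_gx mc)
      (hg.eventually_hasFDerivAt_fst ma) (hg.hasFDerivAt_gx ma)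
      (hg.eventually_hasFDerivAt_fst mb) (hg.hasFDerivAt_gx mb)
      (by rw [ua, uc]) (by rw [ub, uc]) h0
      (by simp only [ga, gc]; unfold pt; module) (by simp only [gb, gc]; unfold pt; module)
      hgap (ξ := ξ) (by rw [inner_smul_right, hξ, mul_zero])
    rw [hdiff, norm_smul, mul_pow, Real.norm_eq_abs, sq_abs] at this
    simp only [hψ, matA]
    linarith
  have := strongly_convex_of_midpoint hψc (by positivity) hmid hθ
  have e0 : pt p₀ p₁ 0 = p₀ := by simp [pt]
  have e1 : pt p₀ p₁ 1 = p₁ := by simp [pt]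
  simp only [hψ, e0, e1] at this
  linarith

end GenFun

/-! ### Charts of controlled size, their coordinate curves, and a first-zero argument. -/

namespace GenFun

variable {n : ℕ}

section Curve

theorem norm_sum_inner_smul_sub_le (b : OrthonormalBasis (Fin n) ℝ (Vec n)) {μ : Fin n → Vec n}
    {σ : ℝ} (hσ : ∀ i, ‖μ i - b i‖ ≤ σ) (u : Vec n) :
    ‖∑ i, ⟪μ i, u⟫_ℝ • b i - u‖ ≤ n * σ * ‖u‖ := by
  have h : ∑ i, ⟪μ i, u⟫_ℝ • b i - u = ∑ i, ⟪μ i - b i, u⟫_ℝ • b i := by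
    conv_lhs => rw [← b.sum_repr' u]
    rw [← Finset.sum_sub_distrib]
    refine Finset.sum_congr rfl fun i _ => ?_
    rw [b.sum_repr' u, inner_sub_left, sub_smul]
  rw [h]
  refine (norm_sum_le _ _).trans ?_
  calc ∑ i, ‖⟪μ i - b i, u⟫_ℝ • b i‖ ≤ ∑ _i : Fin n, σ * ‖u‖ := by
        refine Finset.sum_le_sum fun i _ => ?_
        rw [norm_smul, b.orthonormal.1 i, mul_one]
        exact (norm_inner_le_norm _ _).trans (by gcongr; exact hσ i)
    _ = n * σ * ‖u‖ := by simp [mul_assoc]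

theorem norm_sum_smul_sub_le (b : OrthonormalBasis (Fin n) ℝ (Vec n)) {μ : Fin n → Vec n}
    {σ : ℝ} (hσ : ∀ i, ‖μ i - b i‖ ≤ σ) (u : Vec n) :
    ‖∑ i, ⟪b i, u⟫_ℝ • μ i - u‖ ≤ n * σ * ‖u‖ := by
  have h : ∑ i, ⟪b i, u⟫_ℝ • μ i - u = ∑ i, ⟪b i, u⟫_ℝ • (μ i - b i) := by
    conv_lhs => rw [← b.sum_repr' u]
    rw [← Finset.sum_sub_distrib]
    refine Finset.sum_congr rfl fun i _ => ?_
    rw [b.sum_repr' u, smul_sub]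
  rw [h]
  refine (norm_sum_le _ _).trans ?_
  calc ∑ i, ‖⟪b i, u⟫_ℝ • (μ i - b i)‖ ≤ ∑ _i : Fin n, σ * ‖u‖ := by
        refine Finset.sum_le_sum fun i _ => ?_
        rw [norm_smul, mul_comm]
        refine mul_le_mul (hσ i) ((norm_inner_le_norm _ _).trans ?_) (norm_nonneg _)
          ((norm_nonneg _).trans (hσ i))
        rw [b.orthonormal.1 i, one_mul]
    _ = n * σ * ‖u‖ := by simp [mul_assoc]

/-- Vectors close to an orthonormal basis generate the space, with coefficients close to those in
the orthonormal basis. -/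
theorem exists_coeff_of_near_basis (b : OrthonormalBasis (Fin n) ℝ (Vec n)) {μ : Fin n → Vec n}
    {σ : ℝ} (hσ : ∀ i, ‖μ i - b i‖ ≤ σ) (hn : n * σ ≤ 1 / 2) (M : Vec n) :
    ∃ u : Vec n, ∑ i, ⟪b i, u⟫_ℝ • μ i = M ∧ ‖u‖ ≤ 2 * ‖M‖ ∧ ‖M - u‖ ≤ n * σ * ‖u‖ := by
  let T : Vec n →ₗ[ℝ] Vec n := ∑ i, ((innerSL ℝ (b i) : Vec n →ₗ[ℝ] ℝ).smulRight (μ i))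
  have hT : ∀ u, T u = ∑ i, ⟪b i, u⟫_ℝ • μ i := fun u => by simp [T]
  have hinj : Function.Injective T := by
    refine (injective_iff_map_eq_zero _).2 fun u hu => ?_
    have h := norm_sum_smul_sub_le b hσ u
    rw [← hT, hu, zero_sub, norm_neg] at h
    have := norm_nonneg u
    exact norm_eq_zero.1 (by nlinarith)
  obtain ⟨u, hu⟩ := LinearMap.surjective_of_injective hinj M
  rw [hT] at hu
  have h := norm_sum_smul_sub_le b hσ u
  rw [hu] at h
  refine ⟨u, hu, ?_, h⟩
  have h3 : ‖u‖ ≤ ‖M‖ + ‖M - u‖ := by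
    have := norm_sub_le M (M - u)
    rwa [sub_sub_cancel] at this
  nlinarith [norm_nonneg u]

/-- Functions with gradients close to an orthonormal basis form a chart of controlled size; the
coordinate lines of this chart are `C²` curves. -/
theorem exists_curve (b : OrthonormalBasis (Fin n) ℝ (Vec n)) (i₁ : Fin n) {l : Fin n → Vec n → ℝ}
    {μ : Fin n → Vec n → Vec n} {a : Vec n} {R σ : ℝ}
    (hl : ∀ i, ContDiffOn ℝ 2 (l i) (ball a R))
    (hμ : ∀ i, ∀ x ∈ ball a R, HasFDerivAt (l i) (innerSL ℝ (μ i x)) x)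
    (hσ : ∀ i, ∀ x ∈ ball a R, ‖μ i x - b i‖ ≤ σ) (hn : n * σ ≤ 1 / 2)
    (h0 : ∀ i, l i a = 0) :
    ∃ γ : ℝ → Vec n, ∀ s : ℝ, |s| < R / 2 → γ s ∈ ball a R ∧ ContDiffAt ℝ 2 γ s ∧
      (∀ i, l i (γ s) = if i = i₁ then s else 0) ∧
      ∀ x ∈ ball a R, ‖x - γ s‖ ≤ 2 * ‖∑ i, l i x • b i - s • b i₁‖ := by
  set Ψ : Vec n → Vec n := fun x => ∑ i, l i x • b i with hΨ
  set D : Vec n → Vec n →L[ℝ] Vec n := fun x => ∑ i, (innerSL ℝ (μ i x)).smulRight (b i) with hD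
  have hDv : ∀ x ∈ ball a R, ∀ v, ‖D x v - v‖ ≤ 1 / 2 * ‖v‖ := fun x hx v => by
    have h := norm_sum_inner_smul_sub_le b (fun i => hσ i x hx) v
    have : D x v = ∑ i, ⟪μ i x, v⟫_ℝ • b i := by simp [hD]
    rw [this]
    exact h.trans (by gcongr)
  have hder : ∀ x ∈ ball a R, HasFDerivAt Ψ (D x) x := fun x hx =>
    HasFDerivAt.fun_sum fun i _ => (hμ i x hx).smul_const (b i)
  have hΨC : ContDiffOn ℝ 2 Ψ (ball a R) :=
    ContDiffOn.sum fun i _ => (hl i).smul contDiffOn_const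
  -- The derivative stays within 1/2 of the identity on the whole ball. This gives an inverse whose
  -- domain has a size independent of the functions, as needed when ρ → 0, and the Lipschitz
  -- constant 2.
  have happ : ApproximatesLinearOn Ψ (ContinuousLinearEquiv.refl ℝ (Vec n) : Vec n →L[ℝ] Vec n)
      (ball a R) (1 / 2) := by
    intro x hx y hy
    refine (convex_ball a R).norm_image_sub_le_of_norm_hasFDerivWithin_le'
      (f' := D) (fun z hz => (hder z hz).hasFDerivWithinAt) (fun z hz => ?_) hy hx
    refine ContinuousLinearMap.opNorm_le_bound _ (by positivity) fun v => ?_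
    simpa using hDv z hz v
  have hne : Nontrivial (Vec n) := ⟨b i₁, 0, fun h => by
    have := b.orthonormal.1 i₁
    rw [h, norm_zero] at this; norm_num at this⟩
  have hN : ‖((ContinuousLinearEquiv.refl ℝ (Vec n)).symm : Vec n →L[ℝ] Vec n)‖₊ = 1 := by
    change ‖ContinuousLinearMap.id ℝ (Vec n)‖₊ = 1
    exact ContinuousLinearMap.nnnorm_id
  have hc : Subsingleton (Vec n) ∨ (1 / 2 : NNReal) <
      ‖((ContinuousLinearEquiv.refl ℝ (Vec n)).symm : Vec n →L[ℝ] Vec n)‖₊⁻¹ := by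
    right
    rw [hN, inv_one]
    exact NNReal.half_lt_self one_ne_zero
  set Φ := happ.toOpenPartialHomeomorph Ψ (ball a R) hc isOpen_ball with hΦ
  have hΨa : Ψ a = 0 := by simp [hΨ, h0]
  refine ⟨fun s => Φ.symm (s • b i₁), fun s hs => ?_⟩
  have htar : s • b i₁ ∈ Φ.target := by
    -- The image of the ball of radius 2|s| contains the ball of radius (1 - 1/2)·2|s| = |s|; hence
    -- the restriction |s| < R/2.
    have h1 := happ.closedBall_subset_target hc isOpen_ball (b := a) (ε := 2 * |s|) (by positivity)
      (closedBall_subset_ball (by linarith))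
    refine h1 ?_
    rw [hΨa, mem_closedBall_zero_iff, norm_smul, b.orthonormal.1 i₁, hN]
    simp
    norm_num
    rw [← mul_assoc]
    norm_num
  have hmem : Φ.symm (s • b i₁) ∈ ball a R := Φ.map_target htar
  have hval : Ψ (Φ.symm (s • b i₁)) = s • b i₁ := Φ.right_inv htar
  refine ⟨hmem, ?_, fun i => ?_, fun x hx => ?_⟩
  · have hinj : Function.Injective (D (Φ.symm (s • b i₁))) := by
      refine (injective_iff_map_eq_zero _).2 fun v hv => ?_
      have := hDv _ hmem v
      rw [hv, zero_sub, norm_neg] at this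
      exact norm_eq_zero.1 (by linarith [norm_nonneg v])
    let Le : Vec n ≃L[ℝ] Vec n := (LinearEquiv.ofInjectiveEndo
      (D (Φ.symm (s • b i₁)) : Vec n →ₗ[ℝ] Vec n) hinj).toContinuousLinearEquiv
    have hLe : HasFDerivAt Φ (Le : Vec n →L[ℝ] Vec n) (Φ.symm (s • b i₁)) := by
      have hLD : (Le : Vec n →L[ℝ] Vec n) = D (Φ.symm (s • b i₁)) :=
        ContinuousLinearMap.ext fun _ => rfl
      rw [hLD]
      exact hder _ hmem
    have h1 := Φ.contDiffAt_symm htar hLe (hΨC.contDiffAt (isOpen_ball.mem_nhds hmem))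
    have h2 : ContDiff ℝ 2 fun s : ℝ => s • b i₁ := contDiff_id.smul contDiff_const
    exact ContDiffAt.comp (g := Φ.symm) (f := fun s : ℝ => s • b i₁) s h1 h2.contDiffAt
  · have h1 := congrArg (fun y => ⟪b i, y⟫_ℝ) hval
    simp only [hΨ, inner_sum, inner_smul_right, b.inner_eq_ite] at h1
    simpa using h1
  · have h1 : ‖Ψ x - Ψ (Φ.symm (s • b i₁)) - (x - Φ.symm (s • b i₁))‖
        ≤ 1 / 2 * ‖x - Φ.symm (s • b i₁)‖ := by
      have := happ x hx _ hmem
      simpa using this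
    rw [hval] at h1
    have h2 := norm_sub_le (Ψ x - s • b i₁) (Ψ x - s • b i₁ - (x - Φ.symm (s • b i₁)))
    rw [sub_sub_cancel] at h2
    linarith

/-- A function that starts negative and has negative derivative at its zeros stays nonpositive. -/
theorem nonpos_of_deriv_neg_at_zeros {φ : ℝ → ℝ} {S : ℝ} (hc : ContinuousOn φ (Icc 0 S))
    (h0 : φ 0 < 0) (hz : ∀ s ∈ Icc 0 S, φ s = 0 → ∃ D < 0, HasDerivAt φ D s) :
    ∀ s ∈ Icc 0 S, φ s ≤ 0 := by
  intro s hs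
  by_contra! hpos
  have hcs : ContinuousOn φ (Icc 0 s) := hc.mono (Icc_subset_Icc_right hs.2)
  have hK : IsCompact (Icc (0 : ℝ) s ∩ φ ⁻¹' {0}) :=
    isCompact_Icc.of_isClosed_subset
      (hcs.preimage_isClosed_of_isClosed isClosed_Icc isClosed_singleton) inter_subset_left
  have hne : (Icc (0 : ℝ) s ∩ φ ⁻¹' {0}).Nonempty := by
    obtain ⟨t, ht, hφ⟩ := intermediate_value_Icc hs.1 hcs ⟨h0.le, hpos.le⟩
    exact ⟨t, ht, hφ⟩
  obtain ⟨t, ⟨ht, hφt⟩, hleast⟩ := hK.exists_isLeast hne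
  have hφt : φ t = 0 := hφt
  have ht0 : 0 < t := lt_of_le_of_ne ht.1 fun e => by rw [← e] at hφt; linarith
  obtain ⟨D, hD, hder⟩ := hz t ⟨ht.1, ht.2.trans hs.2⟩ hφt
  have hneg : ∀ r ∈ Ico 0 t, φ r < 0 := by
    intro r hr
    by_contra! hr0
    obtain ⟨q, hq, hφq⟩ := intermediate_value_Icc hr.1
      (hcs.mono (Icc_subset_Icc_right (hr.2.le.trans ht.2))) ⟨h0.le, hr0⟩
    have := hleast ⟨⟨hq.1, hq.2.trans (hr.2.le.trans ht.2)⟩, hφq⟩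
    linarith [hq.2, hr.2]
  have h1 : ∀ᶠ r in 𝓝[<] t, 0 ≤ slope φ t r := by
    filter_upwards [Ico_mem_nhdsLT ht0] with r hr
    rw [slope_def_field, hφt, sub_zero]
    exact div_nonneg_of_nonpos (hneg r hr).le (by linarith [hr.2])
  have h2 : Tendsto (slope φ t) (𝓝[<] t) (𝓝 D) :=
    (hasDerivAt_iff_tendsto_slope.1 hder).mono_left
      (nhdsWithin_mono _ fun r hr => ne_of_lt hr)
  linarith [ge_of_tendsto h2 h1]

end Curve

end GenFun

/-! ### The local model and the frame of gradients used along a slice. -/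

namespace GenFun

variable {n : ℕ}

/-- A function `w (x, y)` with `x`-gradient `m`, normalised so that `w (·, 0)` is constant and
`∂m/∂y` is close to the identity, whose Hessians in `x` satisfy a convexity inequality with respect
to their gradients, in directions orthogonal to the gradients. -/
structure LocalModel (w : Vec n → Vec n → ℝ) (m : Vec n × Vec n → Vec n) (Q : Vec n → Vec n)
    (a : Vec n) (R r τ c₀ C₀ : ℝ) : Prop where
  tau_nonneg : 0 ≤ τ
  smooth : ∀ y ∈ ball (0 : Vec n) r, ContDiffOn ℝ 2 (fun x => w x y) (ball a R)
  grad : ∀ x ∈ ball a R, ∀ y ∈ ball (0 : Vec n) r,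
    HasFDerivAt (fun x => w x y) (innerSL ℝ (m (x, y))) x
  smooth_grad : ∀ x ∈ ball a R, ∀ y ∈ ball (0 : Vec n) r, ContDiffAt ℝ 1 m (x, y)
  grad_zero : ∀ x ∈ ball a R, m (x, 0) = 0
  const_zero : ∀ x ∈ ball a R, ∀ x' ∈ ball a R, w x 0 = w x' 0
  near : ∀ x ∈ ball a R, ∀ y ∈ ball (0 : Vec n) r, ∀ η,
    ‖fderiv ℝ m (x, y) (0, η) - η‖ ≤ τ * ‖η‖
  deriv_zero : ∀ x ∈ ball a R, HasFDerivAt (w x) (innerSL ℝ (Q x)) 0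
  hess_le : ∀ x ∈ ball a R, ∀ y ∈ ball (0 : Vec n) r, ∀ ys : Fin n → Vec n,
    (∀ i, ys i ∈ ball (0 : Vec n) r) → ∀ c : Fin n → ℝ, (∀ i, 0 ≤ c i) → ∑ i, c i ≤ 1 / 2 →
    m (x, y) = ∑ i, c i • m (x, ys i) → ∀ ξ, (∀ i, ⟪m (x, ys i), ξ⟫_ℝ = 0) →
    ⟪fderiv ℝ m (x, y) (ξ, 0), ξ⟫_ℝ ≤ ∑ i, c i * ⟪fderiv ℝ m (x, ys i) (ξ, 0), ξ⟫_ℝ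
      - (c₀ * ∑ i, c i * ‖ys i‖ ^ 2 - C₀ * ‖y‖ ^ 2) * ‖ξ‖ ^ 2

/-- The points `y` used in the frame. -/
noncomputable def frameY (b : OrthonormalBasis (Fin n) ℝ (Vec n)) (i₀ i₁ : Fin n) (y₁ : Vec n)
    (ρ : ℝ) (i : Fin n) : Vec n :=
  if i = i₁ then 0 else if i = i₀ then y₁ else ρ • b i

/-- The scales of the frame. -/
noncomputable def frameT (i₀ : Fin n) (t ρ : ℝ) (i : Fin n) : ℝ := if i = i₀ then t else ρ

/-- The coefficients of the test direction. -/
noncomputable def frameC (i₀ i₁ : Fin n) (i : Fin n) : ℝ :=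
  if i = i₁ then 0 else if i = i₀ then 1 else 1 / (4 * n)

/-- The test direction. -/
noncomputable def frameV (b : OrthonormalBasis (Fin n) ℝ (Vec n)) (i₀ i₁ : Fin n) : Vec n :=
  ∑ i, frameC i₀ i₁ i • b i

theorem sum_const_div_le (hn : 0 < n) (c : ℝ) : ∑ _i : Fin n, c / n = c := by
  have : (n : ℝ) ≠ 0 := by positivity
  simp; field_simp

theorem norm_frameV_le (b : OrthonormalBasis (Fin n) ℝ (Vec n)) (i₀ i₁ : Fin n) :
    ‖frameV b i₀ i₁‖ ≤ 5 / 4 := by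
  have hn : 0 < n := i₀.pos
  have hn' : (0 : ℝ) < n := by positivity
  refine (norm_sum_le _ _).trans ?_
  calc ∑ i, ‖frameC i₀ i₁ i • b i‖ ≤ ∑ i, ((if i = i₀ then (1 : ℝ) else 0) + (1 / 4) / n) := by
        refine Finset.sum_le_sum fun i _ => ?_
        rw [norm_smul, b.orthonormal.1 i, mul_one, frameC]
        have : (0 : ℝ) ≤ (1 / 4) / n := by positivity
        split_ifs <;> simp <;> first | positivity | (apply le_of_eq; field_simp)
    _ = 5 / 4 := by
        rw [Finset.sum_add_distrib, sum_const_div_le hn]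
        simp; norm_num

theorem norm_sub_le_of_fderiv_snd_near {m : Vec n × Vec n → Vec n} {x : Vec n} {r τ : ℝ}
    (hτ : 0 ≤ τ) (hm : ∀ z ∈ ball (0 : Vec n) r, DifferentiableAt ℝ m (x, z))
    (hnear : ∀ z ∈ ball (0 : Vec n) r, ∀ η, ‖fderiv ℝ m (x, z) (0, η) - η‖ ≤ τ * ‖η‖)
    {y y' : Vec n} (hy : y ∈ ball 0 r) (hy' : y' ∈ ball 0 r) :
    ‖m (x, y) - m (x, y') - (y - y')‖ ≤ τ * ‖y - y'‖ := by
  refine (convex_ball (0 : Vec n) r).norm_image_sub_le_of_norm_hasFDerivWithin_le'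
    (f := fun y => m (x, y)) (φ := ContinuousLinearMap.id ℝ (Vec n))
    (f' := fun y => (fderiv ℝ m (x, y)).comp (ContinuousLinearMap.inr ℝ (Vec n) (Vec n)))
    (fun z hz => ?_) (fun z hz => ?_) hy' hy
  · exact (HasFDerivAt.comp (g := m) z (hm z hz).hasFDerivAt
      (hasFDerivAt_prodMk_right x z)).hasFDerivWithinAt
  · refine ContinuousLinearMap.opNorm_le_bound _ hτ fun η => ?_
    simpa using hnear z hz η

theorem mul_le_and_le_of_mul_sq_le {τ c N : ℝ} (hτ0 : 0 ≤ τ) (hτ : τ * N ^ 2 ≤ c) (hN : 1 ≤ N) :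
    τ * N ≤ c ∧ τ ≤ c := by
  have h1 : τ ≤ τ * N := le_mul_of_one_le_right hτ0 hN
  have h2 : τ * N ≤ τ * N * N := le_mul_of_one_le_right (hτ0.trans h1) hN
  have h3 : τ * N * N = τ * N ^ 2 := by ring
  exact ⟨by linarith, by linarith⟩

namespace LocalModel

variable {w : Vec n → Vec n → ℝ} {m : Vec n × Vec n → Vec n} {Q : Vec n → Vec n} {a : Vec n}
  {R r τ c₀ C₀ : ℝ}

theorem differentiableAt_grad (h : LocalModel w m Q a R r τ c₀ C₀) {x y : Vec n}
    (hx : x ∈ ball a R) (hy : y ∈ ball 0 r) : DifferentiableAt ℝ m (x, y) :=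
  (h.smooth_grad x hx y hy).differentiableAt (by norm_num)

theorem grad_near (h : LocalModel w m Q a R r τ c₀ C₀) {x y y' : Vec n} (hx : x ∈ ball a R)
    (hy : y ∈ ball 0 r) (hy' : y' ∈ ball 0 r) :
    ‖m (x, y) - m (x, y') - (y - y')‖ ≤ τ * ‖y - y'‖ :=
  norm_sub_le_of_fderiv_snd_near h.tau_nonneg (fun _ hz => h.differentiableAt_grad hx hz)
    (h.near x hx) hy hy'

theorem grad_near_zero (h : LocalModel w m Q a R r τ c₀ C₀) (hr : 0 < r) {x y : Vec n}
    (hx : x ∈ ball a R) (hy : y ∈ ball 0 r) : ‖m (x, y) - y‖ ≤ τ * ‖y‖ := by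
  have := h.grad_near hx hy (mem_ball_self hr)
  rwa [h.grad_zero x hx, sub_zero, sub_zero] at this

/-- Coefficients of the gradient at the test point in the frame. -/
theorem exists_frame_coeff (h : LocalModel w m Q a R r τ c₀ C₀) (hr : 0 < r) (hτ : τ * n ^ 2 ≤ 1 / 400) {x y₁ e : Vec n} (hx : x ∈ ball a R)
    (he : e ≠ 0)
    (b : OrthonormalBasis (Fin n) ℝ (Vec n)) {i₀ i₁ : Fin n} (h01 : i₀ ≠ i₁) {ρ : ℝ} (hρ : 0 < ρ)
    (hρr : 2 * ρ < r) (hρe : 16 * ρ ≤ ‖e‖)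
    (hμ : ∀ i, i ≠ i₁ →
      ‖(frameT i₀ ‖e‖ ρ i)⁻¹ • m (x, frameY b i₀ i₁ y₁ ρ i) - b i‖ ≤ 8 * τ)
    {ξ : Vec n} (hξ : ∀ i, ⟪m (x, frameY b i₀ i₁ y₁ ρ i), ξ⟫_ℝ = 0) (hξ1 : ⟪b i₁, ξ⟫_ℝ = 1)
    {β : ℝ} (hβ : |β| ≤ 1 / 2)
    (hzero : ⟪m (x, ρ • (frameV b i₀ i₁ + β • b i₁)), ξ⟫_ℝ = 0) :
    ∃ c : Fin n → ℝ, (∀ i, 0 ≤ c i) ∧ ∑ i, c i ≤ 1 / 2 ∧ ρ / 2 / ‖e‖ ≤ c i₀ ∧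
      m (x, ρ • (frameV b i₀ i₁ + β • b i₁)) = ∑ i, c i • m (x, frameY b i₀ i₁ y₁ ρ i) := by
  have hτ0 := h.tau_nonneg
  have hn : 0 < n := i₀.pos
  have hn' : (1 : ℝ) ≤ n := by exact_mod_cast hn
  obtain ⟨hτn, hτ1⟩ := mul_le_and_le_of_mul_sq_le hτ0 hτ hn'
  have he0 : 0 < ‖e‖ := norm_pos_iff.2 he
  set v := frameV b i₀ i₁ + β • b i₁ with hv
  have hvn : ‖v‖ ≤ 2 := by
    refine (norm_add_le _ _).trans ?_
    have := norm_frameV_le b i₀ i₁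
    rw [norm_smul, b.orthonormal.1 i₁, mul_one, Real.norm_eq_abs]
    linarith
  have hyn : ‖ρ • v‖ ≤ 2 * ρ := by
    rw [norm_smul, Real.norm_of_nonneg hρ.le]; nlinarith
  have hy : ρ • v ∈ ball (0 : Vec n) r := by
    rw [mem_ball_zero_iff]; linarith
  have hT : ∀ i, 0 < frameT i₀ ‖e‖ ρ i := by
    intro i; unfold frameT; split_ifs <;> assumption
  -- The frame point in slot i₁ is 0 and has zero gradient; `b i₁` fills the slot so that the
  -- vectors are close to an orthonormal basis.
  set μ : Fin n → Vec n := fun i => if i = i₁ then b i₁ else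
    (frameT i₀ ‖e‖ ρ i)⁻¹ • m (x, frameY b i₀ i₁ y₁ ρ i) with hμdef
  have hμ' : ∀ i, ‖μ i - b i‖ ≤ 8 * τ := by
    intro i
    by_cases hi : i = i₁
    · simp only [hμdef, hi, if_true, sub_self, norm_zero]; positivity
    · simp only [hμdef, if_neg hi]; exact hμ i hi
  have hσ : (n : ℝ) * (8 * τ) ≤ 1 / 2 := by linarith
  obtain ⟨u, hu1, hu2, hu3⟩ := exists_coeff_of_near_basis b hμ' hσ (ρ⁻¹ • m (x, ρ • v))
  have hM : ‖ρ⁻¹ • m (x, ρ • v) - v‖ ≤ 2 * τ := by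
    have h1 := h.grad_near_zero hr hx hy
    have h2 : ρ⁻¹ • m (x, ρ • v) - v = ρ⁻¹ • (m (x, ρ • v) - ρ • v) := by
      rw [smul_sub, smul_smul, inv_mul_cancel₀ hρ.ne', one_smul]
    rw [h2, norm_smul, norm_inv, Real.norm_of_nonneg hρ.le, inv_mul_le_iff₀ hρ]
    nlinarith
  have hMn : ‖ρ⁻¹ • m (x, ρ • v)‖ ≤ 9 / 4 := by
    have := norm_le_norm_sub_add (ρ⁻¹ • m (x, ρ • v)) v
    linarith
  have hun : ‖u‖ ≤ 5 := by linarith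
  -- The error is half of the coefficients 1/(4n) in `frameV`, so the coefficients outside the slot
  -- i₁ remain nonnegative. This is why the test direction has positive components along all frame
  -- vectors other than `b i₁`.
  have huv : ‖u - v‖ ≤ 1 / (8 * n) := by
    have h1 : ‖u - v‖ ≤ ‖ρ⁻¹ • m (x, ρ • v) - u‖ + ‖ρ⁻¹ • m (x, ρ • v) - v‖ := by
      rw [norm_sub_rev (ρ⁻¹ • m (x, ρ • v)) u]
      exact norm_sub_le_norm_sub_add_norm_sub _ _ _
    have h2 : (n : ℝ) * (8 * τ) * ‖u‖ ≤ n * (8 * τ) * 5 := by gcongr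
    have h3 : n * (8 * τ) * 5 + 2 * τ ≤ 1 / (8 * n) := by
      rw [le_div_iff₀ (by positivity)]
      nlinarith
    linarith
  have hcoef : ∀ i, i ≠ i₁ → |⟪b i, u⟫_ℝ - frameC i₀ i₁ i| ≤ 1 / (8 * n) := by
    intro i hi
    have h1 : ⟪b i, v⟫_ℝ = frameC i₀ i₁ i := by
      rw [hv, frameV, inner_add_right, inner_sum]
      simp [inner_smul_right, b.inner_eq_ite, hi]
    rw [← h1, ← inner_sub_right]
    refine (abs_real_inner_le_norm _ _).trans ?_
    rw [b.orthonormal.1 i, one_mul]; exact huv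
  -- Pairing with ξ kills the test gradient and every frame gradient, while ⟨b i₁,ξ⟩ = 1; so the
  -- substitute vector is not used.
  have ha1 : ⟪b i₁, u⟫_ℝ = 0 := by
    have h1 := congrArg (fun z => ⟪z, ξ⟫_ℝ) hu1
    simp only [sum_inner, inner_smul_left, conj_trivial, hzero, mul_zero] at h1
    rw [Finset.sum_eq_single i₁] at h1
    · simpa [hμdef, hξ1] using h1
    · intro i _ hi
      simp only [hμdef, if_neg hi, inner_smul_left, hξ i, mul_zero]
    · simp
  set c : Fin n → ℝ := fun i => if i = i₁ then 0 else ρ * ⟪b i, u⟫_ℝ / frameT i₀ ‖e‖ ρ i with hc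
  have hn8 : (1 : ℝ) / (8 * n) ≤ 1 / 8 := by
    rw [div_le_div_iff₀ (by positivity) (by positivity)]; linarith
  have hn4 : (1 : ℝ) / (4 * n) = 2 * (1 / (8 * n)) := by field_simp; norm_num
  have hn8' : (0 : ℝ) < 1 / (8 * n) := by positivity
  have hcnn : ∀ i, 0 ≤ c i := by
    intro i
    simp only [hc]
    split_ifs with hi
    · exact le_rfl
    · have h1 := abs_le.1 (hcoef i hi)
      have h2 : 0 ≤ ⟪b i, u⟫_ℝ := by
        simp only [frameC, if_neg hi] at h1
        split_ifs at h1 <;> linarith [h1.1]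
      have := hT i
      positivity
  -- The coefficient of the gradient at y₁ is of order ρ/|e|. It is small but carries |y₁|², which
  -- is much larger than ρ², and all of the gain comes from it.
  have hci0 : ρ / 2 / ‖e‖ ≤ c i₀ ∧ c i₀ ≤ 1 / 8 := by
    have h1 := abs_le.1 (hcoef i₀ h01)
    simp only [frameC, if_neg h01, if_true] at h1
    simp only [hc, if_neg h01, frameT, if_true]
    constructor
    · gcongr; nlinarith
    · rw [div_le_iff₀ he0]; nlinarith
  have hsum : ∑ i, c i ≤ 1 / 2 := by
    calc ∑ i, c i ≤ ∑ i, ((if i = i₀ then (1 / 8 : ℝ) else 0) + (3 / 8) / n) := by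
          refine Finset.sum_le_sum fun i _ => ?_
          have hp : (0 : ℝ) ≤ (3 / 8) / n := by positivity
          by_cases hi : i = i₁
          · simp only [hc, if_pos hi]; split_ifs <;> linarith
          by_cases hi0 : i = i₀
          · rw [if_pos hi0, hi0]; linarith [hci0.2]
          · have h1 := abs_le.1 (hcoef i hi)
            simp only [frameC, if_neg hi, if_neg hi0] at h1
            simp only [hc, frameT, if_neg hi, if_neg hi0]
            rw [mul_div_assoc, mul_div_cancel₀ _ hρ.ne']
            have : (3 / 8 : ℝ) / n = 3 * (1 / (8 * n)) := by field_simp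
            linarith [h1.2]
      _ = 1 / 2 := by
          rw [Finset.sum_add_distrib, sum_const_div_le hn]
          simp; norm_num
  have hrep : m (x, ρ • v) = ∑ i, c i • m (x, frameY b i₀ i₁ y₁ ρ i) := by
    have h1 : m (x, ρ • v) = ρ • ∑ i, ⟪b i, u⟫_ℝ • μ i := by
      rw [hu1, smul_smul, mul_inv_cancel₀ hρ.ne', one_smul]
    rw [h1, Finset.smul_sum]
    refine Finset.sum_congr rfl fun i _ => ?_
    by_cases hi : i = i₁
    · simp [hi, ha1, hc]
    · simp only [hμdef, hc, if_neg hi, smul_smul]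
      congr 1
      field_simp
  exact ⟨c, hcnn, hsum, hci0.1, hrep⟩

/-- The gain is of order c₀ρE and the loss C₀P² of order ρ², hence at most half of the gain for
small ρ. The drift of the test point, of speed c₀E/64 in units of ρ, uses up only part of the
remainder; X ≥ 1 absorbs the linear power of X. -/
theorem bracket_neg {H K N A P X ρ E c₀ C₀ : ℝ} (hρ : 0 < ρ) (hE : 0 < E) (hc₀ : 0 < c₀)
    (hC₀ : 0 ≤ C₀) (hρC : 64 * C₀ * ρ ≤ c₀ * E) (hX : 1 ≤ X) (hA : ρ * E / 8 ≤ A)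
    (hP0 : 0 ≤ P) (hP : P ≤ 2 * ρ) (hN : N ≤ 2 * X)
    (hH : H ≤ K - (c₀ * A - C₀ * P ^ 2) * X ^ 2) :
    H - K + ρ * (c₀ * E / 64) * N < 0 := by
  have hP2 : P ^ 2 ≤ 4 * ρ ^ 2 := by nlinarith
  have h1 : c₀ * (ρ * E / 8) ≤ c₀ * A := by gcongr
  have h2 : C₀ * P ^ 2 ≤ C₀ * (4 * ρ ^ 2) := by gcongr
  have hg2 : c₀ * ρ * E / 16 ≤ c₀ * A - C₀ * P ^ 2 := by nlinarith
  have h5 : c₀ * ρ * E / 16 * X ^ 2 ≤ (c₀ * A - C₀ * P ^ 2) * X ^ 2 := by gcongr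
  have h6 : ρ * (c₀ * E / 64) * N ≤ ρ * (c₀ * E / 64) * (2 * X) := by gcongr
  have h8 : 0 < c₀ * ρ * E := by positivity
  have h9 : c₀ * ρ * E * X ≤ c₀ * ρ * E * X ^ 2 := by
    gcongr
    nlinarith
  have h10 : 0 < c₀ * ρ * E * X := by positivity
  have h11 : ρ * (c₀ * E / 64) * (2 * X) = c₀ * ρ * E * X / 32 := by ring
  have h12 : c₀ * ρ * E / 16 * X ^ 2 = c₀ * ρ * E * X ^ 2 / 16 := by ring
  linarith

/-- The pointwise inequality behind the slice estimate. -/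
theorem frame_hess_neg (h : LocalModel w m Q a R r τ c₀ C₀) (hr : 0 < r) (hc₀ : 0 < c₀)
    (hC₀ : 0 ≤ C₀) (hτ : τ * n ^ 2 ≤ 1 / 400) {x y₁ e : Vec n} (hx : x ∈ ball a R)
    (hy₁ : y₁ ∈ ball 0 r) (he : e ≠ 0) (hey : ‖e‖ ≤ 2 * ‖y₁‖)
    (b : OrthonormalBasis (Fin n) ℝ (Vec n)) {i₀ i₁ : Fin n} (h01 : i₀ ≠ i₁) {ρ : ℝ} (hρ : 0 < ρ)
    (hρr : 2 * ρ < r) (hρe : 16 * ρ ≤ ‖e‖) (hρC : 64 * C₀ * ρ ≤ c₀ * ‖e‖)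
    (hμ : ∀ i, i ≠ i₁ →
      ‖(frameT i₀ ‖e‖ ρ i)⁻¹ • m (x, frameY b i₀ i₁ y₁ ρ i) - b i‖ ≤ 8 * τ)
    {ξ : Vec n} (hξ : ∀ i, ⟪m (x, frameY b i₀ i₁ y₁ ρ i), ξ⟫_ℝ = 0) (hξ1 : ⟪b i₁, ξ⟫_ℝ = 1)
    {β : ℝ} (hβ : |β| ≤ 1 / 2)
    (hzero : ⟪m (x, ρ • (frameV b i₀ i₁ + β • b i₁)), ξ⟫_ℝ = 0) :
    ∃ c : Fin n → ℝ,
      m (x, ρ • (frameV b i₀ i₁ + β • b i₁)) = ∑ i, c i • m (x, frameY b i₀ i₁ y₁ ρ i) ∧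
      ⟪fderiv ℝ m (x, ρ • (frameV b i₀ i₁ + β • b i₁)) (ξ, 0), ξ⟫_ℝ
        - ∑ i, c i * ⟪fderiv ℝ m (x, frameY b i₀ i₁ y₁ ρ i) (ξ, 0), ξ⟫_ℝ
        + ρ * (c₀ * ‖e‖ / 64) *
          ⟪fderiv ℝ m (x, ρ • (frameV b i₀ i₁ + β • b i₁)) (0, b i₁), ξ⟫_ℝ < 0 := by
  have hτ0 := h.tau_nonneg
  have hn : 0 < n := i₀.pos
  have hn' : (1 : ℝ) ≤ n := by exact_mod_cast hn
  obtain ⟨hτn, hτ1⟩ := mul_le_and_le_of_mul_sq_le hτ0 hτ hn'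
  have he0 : 0 < ‖e‖ := norm_pos_iff.2 he
  obtain ⟨c, hcnn, hsum, hc0, hrep⟩ :=
    h.exists_frame_coeff hr hτ hx he b h01 hρ hρr hρe hμ hξ hξ1 hβ hzero
  have hyn : ‖ρ • (frameV b i₀ i₁ + β • b i₁)‖ ≤ 2 * ρ := by
    rw [norm_smul, Real.norm_of_nonneg hρ.le, mul_comm]
    refine mul_le_mul_of_nonneg_right ?_ hρ.le
    refine (norm_add_le _ _).trans ?_
    have := norm_frameV_le b i₀ i₁
    rw [norm_smul, b.orthonormal.1 i₁, mul_one, Real.norm_eq_abs]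
    linarith
  have hy : ρ • (frameV b i₀ i₁ + β • b i₁) ∈ ball (0 : Vec n) r := by
    rw [mem_ball_zero_iff]; linarith
  have hys : ∀ i, frameY b i₀ i₁ y₁ ρ i ∈ ball (0 : Vec n) r := by
    intro i
    unfold frameY
    split_ifs
    · exact mem_ball_self hr
    · exact hy₁
    · rw [mem_ball_zero_iff, norm_smul, b.orthonormal.1 i, Real.norm_of_nonneg hρ.le]; linarith
  refine ⟨c, hrep, ?_⟩
  have hH := h.hess_le x hx _ hy _ hys c hcnn hsum hrep ξ hξ
  have hξn : 1 ≤ ‖ξ‖ := by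
    have := abs_real_inner_le_norm (b i₁) ξ
    rw [hξ1, b.orthonormal.1 i₁] at this
    simpa using this
  have hgain : ρ * ‖e‖ / 8 ≤ ∑ i, c i * ‖frameY b i₀ i₁ y₁ ρ i‖ ^ 2 := by
    have h1 : c i₀ * ‖frameY b i₀ i₁ y₁ ρ i₀‖ ^ 2
        ≤ ∑ i, c i * ‖frameY b i₀ i₁ y₁ ρ i‖ ^ 2 :=
      Finset.single_le_sum (f := fun i => c i * ‖frameY b i₀ i₁ y₁ ρ i‖ ^ 2)
        (fun i _ => mul_nonneg (hcnn i) (by positivity)) (Finset.mem_univ i₀)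
    refine le_trans ?_ h1
    have h2 : frameY b i₀ i₁ y₁ ρ i₀ = y₁ := by simp [frameY, h01]
    rw [h2]
    calc ρ * ‖e‖ / 8 = (ρ / 2 / ‖e‖) * (‖e‖ / 2) ^ 2 := by field_simp; norm_num
      _ ≤ c i₀ * ‖y₁‖ ^ 2 := by
        gcongr
        · exact hcnn i₀
        · linarith
  have hN : ⟪fderiv ℝ m (x, ρ • (frameV b i₀ i₁ + β • b i₁)) (0, b i₁), ξ⟫_ℝ ≤ 2 * ‖ξ‖ := by
    have h1 := h.near x hx _ hy (b i₁)
    have h2 := norm_le_norm_sub_add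
      (fderiv ℝ m (x, ρ • (frameV b i₀ i₁ + β • b i₁)) (0, b i₁)) (b i₁)
    rw [b.orthonormal.1 i₁] at h1 h2
    refine (real_inner_le_norm _ _).trans ?_
    gcongr
    linarith
  exact bracket_neg hρ he0 hc₀ hC₀ hρC hξn hgain (norm_nonneg _) hyn hN hH

end LocalModel

end GenFun

/-! ### The slice estimate. -/

namespace GenFun

variable {n : ℕ}

theorem hasDerivAt_inner_deriv {m : Vec n × Vec n → Vec n} {γ Y : ℝ → Vec n} {Y' : Vec n} {s : ℝ}
    (hγ : ContDiffAt ℝ 2 γ s) (hY : HasDerivAt Y Y' s) (hm : DifferentiableAt ℝ m (γ s, Y s)) :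
    HasDerivAt (fun s => ⟪m (γ s, Y s), deriv γ s⟫_ℝ)
      (⟪m (γ s, Y s), deriv (deriv γ) s⟫_ℝ
        + (⟪fderiv ℝ m (γ s, Y s) (deriv γ s, 0), deriv γ s⟫_ℝ
          + ⟪fderiv ℝ m (γ s, Y s) (0, Y'), deriv γ s⟫_ℝ)) s := by
  have h1 : HasDerivAt γ (deriv γ s) s := (hγ.differentiableAt (by norm_num)).hasDerivAt
  have h2 : HasDerivAt (deriv γ) (deriv (deriv γ) s) s := by
    have h : ContDiffAt ℝ 1 (fun q => fderiv ℝ γ q 1) s :=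
      (hγ.fderiv_right (m := 1) (by norm_num)).clm_apply contDiffAt_const
    simp only [fderiv_apply_one_eq_deriv] at h
    exact (h.differentiableAt (by norm_num)).hasDerivAt
  have h3 : HasDerivAt (fun s => m (γ s, Y s)) (fderiv ℝ m (γ s, Y s) (deriv γ s, Y')) s :=
    hm.hasFDerivAt.comp_hasDerivAt (f := fun s => (γ s, Y s)) s (h1.prodMk hY)
  have h4 := h3.inner ℝ h2
  rwa [show (deriv γ s, Y') = (deriv γ s, (0 : Vec n)) + ((0 : Vec n), Y') by simp, map_add,
    inner_add_left] at h4

namespace LocalModel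

variable {w : Vec n → Vec n → ℝ} {m : Vec n × Vec n → Vec n} {Q : Vec n → Vec n} {a : Vec n}
  {R r τ c₀ C₀ : ℝ}

theorem scaled_grad_near (h : LocalModel w m Q a R r τ c₀ C₀) (hr : 0 < r) {x η : Vec n} {ρ : ℝ}
    (hρ : 0 < ρ) (hx : x ∈ ball a R) (hη : ρ * ‖η‖ < r) :
    ‖ρ⁻¹ • m (x, ρ • η) - η‖ ≤ τ * ‖η‖ := by
  have h1 := h.grad_near_zero hr hx (y := ρ • η)
    (by rwa [mem_ball_zero_iff, norm_smul, Real.norm_of_nonneg hρ.le])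
  have h2 : ρ⁻¹ • m (x, ρ • η) - η = ρ⁻¹ • (m (x, ρ • η) - ρ • η) := by
    rw [smul_sub, smul_smul, inv_mul_cancel₀ hρ.ne', one_smul]
  rw [h2, norm_smul, norm_inv, Real.norm_of_nonneg hρ.le, inv_mul_le_iff₀ hρ]
  rw [norm_smul, Real.norm_of_nonneg hρ.le] at h1
  linarith

/-- The vector e represents the gradient at y₁ in the linearisation at y = 0. It is comparable to y₁
and close to m(x,y₁) for all x in the ball, so e/|e| can serve as a basis vector of the frame. -/
theorem covector_near (h : LocalModel w m Q a R r τ c₀ C₀) (hR : 0 < R) (hr : 0 < r)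
    (hτ : τ ≤ 1 / 400) {y₁ e : Vec n} (hy₁ : y₁ ∈ ball 0 r)
    (he : fderiv ℝ m (a, 0) (0, e) = m (a, y₁)) :
    ‖e‖ ≤ 2 * ‖y₁‖ ∧ ‖y₁‖ ≤ 2 * ‖e‖ ∧ ∀ x ∈ ball a R, ‖m (x, y₁) - e‖ ≤ 5 * τ * ‖e‖ := by
  have ha : a ∈ ball a R := mem_ball_self hR
  have h0 := h.tau_nonneg
  have h1 := h.near a ha 0 (mem_ball_self hr) e
  rw [he] at h1
  have h2 := h.grad_near_zero hr ha hy₁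
  have h3 : ‖e - y₁‖ ≤ ‖m (a, y₁) - e‖ + ‖m (a, y₁) - y₁‖ := by
    rw [norm_sub_rev (m (a, y₁)) e]
    exact norm_sub_le_norm_sub_add_norm_sub _ _ _
  have h4 := norm_le_norm_sub_add e y₁
  have h5 := norm_le_norm_sub_add y₁ e
  rw [norm_sub_rev] at h5
  have hE := norm_nonneg e
  have hY := norm_nonneg y₁
  have hτE := mul_le_mul_of_nonneg_right hτ hE
  have hτY := mul_le_mul_of_nonneg_right hτ hY
  have hA : ‖e‖ ≤ 2 * ‖y₁‖ := by linarith
  have hB : ‖y₁‖ ≤ 2 * ‖e‖ := by linarith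
  refine ⟨hA, hB, fun x hx => ?_⟩
  have h6 := h.grad_near_zero hr hx hy₁
  have h7 := norm_sub_le_norm_sub_add_norm_sub (m (x, y₁)) y₁ e
  rw [norm_sub_rev y₁ e] at h7
  have := mul_le_mul_of_nonneg_left hB h0
  linarith

-- This is the integrated form of A3s. After division by ρ and passage to the limit, the left side
-- becomes the increment of ⟨Q, `frameV b i₀ i₁`⟩ from a to x', and the negative quadratic term is
-- the bending of the level set of w(·,y₁). The parameter ε only makes the initial inequality
-- strict, and the sum measures how far x' is from the slice.
set_option maxHeartbeats 800000 in
theorem slice_estimate (h : LocalModel w m Q a R r τ c₀ C₀) (hR : 0 < R) (hr : 0 < r)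
    (hc₀ : 0 < c₀) (hC₀ : 0 ≤ C₀) (hτ : τ * n ^ 2 ≤ 1 / 400) (hcR : c₀ * r * R ≤ 1)
    {x' y₁ e : Vec n} (hx' : x' ∈ ball a R) (hy₁ : y₁ ∈ ball 0 r) (he0 : e ≠ 0)
    (he : fderiv ℝ m (a, 0) (0, e) = m (a, y₁)) (hlev : w x' y₁ = w a y₁)
    (b : OrthonormalBasis (Fin n) ℝ (Vec n)) {i₀ i₁ : Fin n} (h01 : i₀ ≠ i₁)
    (hb : b i₀ = ‖e‖⁻¹ • e) (hS0 : 0 ≤ ⟪b i₁, x' - a⟫_ℝ) (hSR : ⟪b i₁, x' - a⟫_ℝ < R / 2)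
    {ε ρ : ℝ} (hε : 0 < ε) (hε' : ε ≤ 1 / 2) (hρ : 0 < ρ)
    (hρr : 2 * ρ < r) (hρe : 16 * ρ ≤ ‖e‖) (hρC : 64 * C₀ * ρ ≤ c₀ * ‖e‖)
    (hlim : ∀ i, ‖ρ⁻¹ • m (a, ρ • b i) - fderiv ℝ m (a, 0) (0, b i)‖ ≤ ε / 16)
    (hlim' : ‖ρ⁻¹ • m (a, ρ • (frameV b i₀ i₁ - ε • b i₁))
      - fderiv ℝ m (a, 0) (0, frameV b i₀ i₁ - ε • b i₁)‖ ≤ ε / 16) :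
    w x' (ρ • frameV b i₀ i₁) - w a (ρ • frameV b i₀ i₁)
      ≤ ρ * (2 * ε * ⟪b i₁, x' - a⟫_ℝ - c₀ * ‖e‖ / 256 * ⟪b i₁, x' - a⟫_ℝ ^ 2)
        + 4 * ρ * ∑ i, (if i = i₀ ∨ i = i₁ then 0 else |(w x' (ρ • b i) - w a (ρ • b i)) / ρ|) := by
  have hτ0 := h.tau_nonneg
  have hn : 0 < n := i₀.pos
  have hn' : (1 : ℝ) ≤ n := by exact_mod_cast hn
  obtain ⟨hτn, hτ1⟩ := mul_le_and_le_of_mul_sq_le hτ0 hτ hn'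
  have hE : 0 < ‖e‖ := norm_pos_iff.2 he0
  have ha : a ∈ ball a R := mem_ball_self hR
  obtain ⟨hey, hye, hme⟩ := h.covector_near hR hr hτ1 hy₁ he
  have hσ : (n : ℝ) * (8 * τ) ≤ 1 / 2 := by linarith
  have hbn : ∀ i, ‖b i‖ = 1 := b.orthonormal.1
  set V := frameV b i₀ i₁ with hV
  have hVn : ‖V‖ ≤ 5 / 4 := norm_frameV_le b i₀ i₁
  set Ys := frameY b i₀ i₁ y₁ ρ with hYs
  set T := frameT i₀ ‖e‖ ρ with hTdef
  have hT : ∀ i, 0 < T i := by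
    intro i; simp only [hTdef, frameT]; split_ifs <;> assumption
  have hYsr : ∀ i, Ys i ∈ ball (0 : Vec n) r := by
    intro i
    simp only [hYs, frameY]
    split_ifs
    · exact mem_ball_self hr
    · exact hy₁
    · rw [mem_ball_zero_iff, norm_smul, hbn, Real.norm_of_nonneg hρ.le]; linarith
  have hμ : ∀ x ∈ ball a R, ∀ i, i ≠ i₁ → ‖(T i)⁻¹ • m (x, Ys i) - b i‖ ≤ 8 * τ := by
    intro x hx i hi
    simp only [hTdef, hYs, frameT, frameY, if_neg hi]
    by_cases hi0 : i = i₀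
    · rw [if_pos hi0, if_pos hi0, hi0, hb, ← smul_sub, norm_smul, norm_inv, norm_norm,
        inv_mul_le_iff₀ hE]
      have := mul_nonneg hτ0 hE.le
      linarith [hme x hx]
    · rw [if_neg hi0, if_neg hi0]
      have := h.scaled_grad_near hr (η := b i) hρ hx (by rw [hbn]; linarith)
      rw [hbn] at this
      linarith
  set l : Fin n → Vec n → ℝ := fun i x => if i = i₁ then ⟪b i₁, x - a⟫_ℝ else
    (w x (Ys i) - w a (Ys i)) / T i with hl
  set μ : Fin n → Vec n → Vec n := fun i x => if i = i₁ then b i₁ else (T i)⁻¹ • m (x, Ys i)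
    with hμd
  have hlder : ∀ i, ∀ x ∈ ball a R, HasFDerivAt (l i) (innerSL ℝ (μ i x)) x := by
    intro i x hx
    simp only [hl, hμd]
    by_cases hi : i = i₁
    · simp only [if_pos hi]
      exact (innerSL ℝ (b i₁)).hasFDerivAt.comp x ((hasFDerivAt_id x).sub_const a)
    · simp only [if_neg hi]
      have h1 := ((h.grad x hx _ (hYsr i)).sub_const (w a (Ys i))).const_smul (T i)⁻¹
      have h2 : innerSL ℝ ((T i)⁻¹ • m (x, Ys i)) = (T i)⁻¹ • innerSL ℝ (m (x, Ys i)) := by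
        ext v; simp
      rw [h2]
      refine h1.congr_of_eventuallyEq (Eventually.of_forall fun y => ?_)
      simp [div_eq_inv_mul]
  have hlC : ∀ i, ContDiffOn ℝ 2 (l i) (ball a R) := by
    intro i
    simp only [hl]
    by_cases hi : i = i₁
    · simp only [if_pos hi]
      exact ((innerSL ℝ (b i₁)).contDiff.comp (contDiff_id.sub contDiff_const)).contDiffOn
    · simp only [if_neg hi]
      exact ((h.smooth _ (hYsr i)).sub contDiffOn_const).div_const _
  have hμb : ∀ i, ∀ x ∈ ball a R, ‖μ i x - b i‖ ≤ 8 * τ := by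
    intro i x hx
    by_cases hi : i = i₁
    · have h1 : μ i x = b i := by simp [hμd, hi]
      rw [h1, sub_self, norm_zero]; linarith
    · simp only [hμd, if_neg hi]; exact hμ x hx i hi
  have hla : ∀ i, l i a = 0 := by
    intro i; simp only [hl]; split_ifs <;> simp
  -- Along γ the functions w(·,y₁) and w(·,ρ bᵢ), i ≠ i₀, i₁, are constant, and the parameter is the
  -- displacement in the direction `b i₁`.
  obtain ⟨γ, hγ⟩ := exists_curve b i₁ hlC hlder hμb hσ hla
  have hγ0 : γ 0 = a := by
    have h1 := (hγ 0 (by simpa using hR)).2.2.2 a ha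
    simp only [hla, zero_smul, Finset.sum_const_zero, sub_self, norm_zero, mul_zero] at h1
    exact (sub_eq_zero.1 (norm_le_zero_iff.1 h1)).symm
  have hμγ : ∀ s, |s| < R / 2 → ∀ i, ⟪μ i (γ s), deriv γ s⟫_ℝ = if i = i₁ then 1 else 0 := by
    intro s hs i
    have h1 : HasDerivAt γ (deriv γ s) s :=
      ((hγ s hs).2.1.differentiableAt (by norm_num)).hasDerivAt
    have h2 := (hlder i _ (hγ s hs).1).comp_hasDerivAt s h1
    have h3 : l i ∘ γ =ᶠ[𝓝 s] fun s => if i = i₁ then s else 0 := by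
      have : {s : ℝ | |s| < R / 2} ∈ 𝓝 s :=
        (isOpen_lt continuous_abs continuous_const).mem_nhds hs
      filter_upwards [this] with q hq using (hγ q hq).2.2.1 i
    have h4 := h2.congr_of_eventuallyEq h3.symm
    have h5 : HasDerivAt (fun s : ℝ => if i = i₁ then s else 0) (if i = i₁ then 1 else 0) s := by
      split_ifs
      · exact hasDerivAt_id s
      · exact hasDerivAt_const s _
    exact h4.unique h5
  have hmγ : ∀ s, |s| < R / 2 → ∀ i, ⟪m (γ s, Ys i), deriv γ s⟫_ℝ = 0 := by
    intro s hs i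
    by_cases hi : i = i₁
    · have : Ys i = 0 := by simp [hYs, frameY, hi]
      rw [this, h.grad_zero _ (hγ s hs).1, inner_zero_left]
    · have h1 := hμγ s hs i
      simp only [hμd, if_neg hi, inner_smul_left, conj_trivial] at h1
      exact (mul_eq_zero.1 h1).resolve_left (inv_ne_zero (hT i).ne')
  have hbγ : ∀ s, |s| < R / 2 → ⟪b i₁, deriv γ s⟫_ℝ = 1 := by
    intro s hs
    have h1 := hμγ s hs i₁
    simpa only [hμd, if_true] using h1
  have hγn : ∀ s, |s| < R / 2 → ‖deriv γ s‖ ≤ 2 := by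
    intro s hs
    have h1 := norm_sum_inner_smul_sub_le b (fun i => hμb i _ (hγ s hs).1) (deriv γ s)
    have h2 : ∑ i, ⟪μ i (γ s), deriv γ s⟫_ℝ • b i = b i₁ := by simp [hμγ s hs]
    rw [h2] at h1
    have h3 := norm_le_norm_sub_add (deriv γ s) (b i₁)
    rw [norm_sub_rev, hbn] at h3
    have := mul_le_mul_of_nonneg_right hσ (norm_nonneg (deriv γ s))
    linarith
  -- The speed at which the test point may turn towards `b i₁`, matched to `bracket_neg`. The bound
  -- c₀ r R ≤ 1 keeps the turn below 1/2 over the whole slice.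
  set κ := c₀ * ‖e‖ / 64 with hκ
  have hκ0 : 0 < κ := by positivity
  have hκR : κ * (R / 2) ≤ 1 / 2 := by
    have : ‖y₁‖ < r := by simpa using hy₁
    have h1 : ‖e‖ ≤ 2 * r := by linarith
    have h2 : c₀ * ‖e‖ * R ≤ c₀ * (2 * r) * R := by gcongr
    rw [hκ]; linarith
  have hβ : ∀ s, 0 ≤ s → s < R / 2 → |κ * s - ε| ≤ 1 / 2 := by
    intro s hs hs'
    have h1 : κ * s ≤ κ * (R / 2) := by gcongr
    have h2 : 0 ≤ κ * s := by positivity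
    rw [abs_le]; constructor <;> linarith
  set Y : ℝ → Vec n := fun s => ρ • (V + (κ * s - ε) • b i₁) with hY
  have hYd : ∀ s, HasDerivAt Y ((ρ * κ) • b i₁) s := by
    intro s
    have h1 : HasDerivAt (fun s : ℝ => κ * s - ε) κ s := by
      simpa using ((hasDerivAt_id s).const_mul κ).sub_const ε
    have h2 := ((h1.smul_const (b i₁)).const_add V).const_smul ρ
    rwa [smul_smul] at h2
  have hYr : ∀ s, 0 ≤ s → s < R / 2 → Y s ∈ ball (0 : Vec n) r := by
    intro s hs hs'
    rw [mem_ball_zero_iff]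
    simp only [hY]
    rw [norm_smul, Real.norm_of_nonneg hρ.le]
    have h1 := norm_add_le V ((κ * s - ε) • b i₁)
    rw [norm_smul, hbn, mul_one, Real.norm_eq_abs] at h1
    have h2 : ρ * ‖V + (κ * s - ε) • b i₁‖ ≤ ρ * (5 / 4 + 1 / 2) :=
      mul_le_mul_of_nonneg_left (by linarith [hβ s hs hs']) hρ.le
    linarith
  set S := ⟪b i₁, x' - a⟫_ℝ with hS
  have habs : ∀ s ∈ Icc 0 S, |s| < R / 2 := fun s hs => by
    rw [abs_of_nonneg hs.1]; linarith [hs.2]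
  have hφd : ∀ s ∈ Icc 0 S, HasDerivAt (fun s => ⟪m (γ s, Y s), deriv γ s⟫_ℝ)
      (⟪m (γ s, Y s), deriv (deriv γ) s⟫_ℝ
        + (⟪fderiv ℝ m (γ s, Y s) (deriv γ s, 0), deriv γ s⟫_ℝ
          + ⟪fderiv ℝ m (γ s, Y s) (0, (ρ * κ) • b i₁), deriv γ s⟫_ℝ)) s := fun s hs =>
    hasDerivAt_inner_deriv (hγ s (habs s hs)).2.1 (hYd s)
      (h.differentiableAt_grad (hγ s (habs s hs)).1 (hYr s hs.1 (hs.2.trans_lt hSR)))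
  -- To first order in ρ, γ'(0) annihilates the images of all bᵢ with i ≠ i₁, up to an error of size
  -- ε. The offset -ε `b i₁` contributes at most -ε/2, which beats these errors.
  have hφ0 : ⟪m (γ 0, Y 0), deriv γ 0⟫_ℝ < 0 := by
    have h0 : |(0 : ℝ)| < R / 2 := by simpa using hR
    set ξ := deriv γ 0 with hξ
    have hξn : ‖ξ‖ ≤ 2 := hγn 0 h0
    have hb1 : ⟪b i₁, ξ⟫_ℝ = 1 := hbγ 0 h0
    have hY0 : Y 0 = ρ • (V - ε • b i₁) := by simp [hY, sub_eq_add_neg]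
    have hm0 := hmγ 0 h0
    rw [hγ0] at hm0
    rw [hγ0, hY0]
    set N : Vec n →L[ℝ] Vec n := (fderiv ℝ m (a, 0)).comp (.inr ℝ (Vec n) (Vec n)) with hN
    have hNv : ∀ v, fderiv ℝ m (a, 0) (0, v) = N v := fun v => rfl
    simp only [hNv] at hlim hlim' he
    have hNi0 : ⟪N (b i₀), ξ⟫_ℝ = 0 := by
      have h1 := hm0 i₀
      simp only [hYs, frameY, if_neg h01, if_true] at h1
      rw [hb, map_smul, he, inner_smul_left, h1, mul_zero]
    have hNi : ∀ i, i ≠ i₀ → i ≠ i₁ → ⟪N (b i), ξ⟫_ℝ ≤ ε / 8 := by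
      intro i hi0 hi1
      have h1 := hm0 i
      simp only [hYs, frameY, if_neg hi0, if_neg hi1] at h1
      have h2 := neg_le_of_abs_le (abs_real_inner_le_norm (ρ⁻¹ • m (a, ρ • b i) - N (b i)) ξ)
      rw [inner_sub_left, inner_smul_left, h1, mul_zero, zero_sub] at h2
      have h3 := hlim i
      have h4 : ‖ρ⁻¹ • m (a, ρ • b i) - N (b i)‖ * ‖ξ‖ ≤ ε / 16 * 2 := by gcongr
      linarith
    have hNV : ⟪N V, ξ⟫_ℝ ≤ ε / 32 := by
      have h1 : ⟪N V, ξ⟫_ℝ = ∑ i, frameC i₀ i₁ i * ⟪N (b i), ξ⟫_ℝ := by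
        rw [hV, frameV, map_sum, sum_inner]
        refine Finset.sum_congr rfl fun i _ => ?_
        rw [map_smul, inner_smul_left, conj_trivial]
      rw [h1, ← sum_const_div_le hn (ε / 32)]
      refine Finset.sum_le_sum fun i _ => ?_
      have hp : 0 ≤ ε / 32 / n := by positivity
      unfold frameC
      by_cases hi1 : i = i₁
      · simpa [hi1] using hp
      by_cases hi0 : i = i₀
      · simpa [hi0, h01, hNi0] using hp
      · rw [if_neg hi1, if_neg hi0]
        calc 1 / (4 * (n : ℝ)) * ⟪N (b i), ξ⟫_ℝ ≤ 1 / (4 * (n : ℝ)) * (ε / 8) := by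
              gcongr; exact hNi i hi0 hi1
          _ = ε / 32 / n := by field_simp; norm_num
    have hNb : 1 / 2 ≤ ⟪N (b i₁), ξ⟫_ℝ := by
      have h1 := h.near a ha 0 (mem_ball_self hr) (b i₁)
      rw [hNv, hbn] at h1
      have h2 := neg_le_of_abs_le (abs_real_inner_le_norm (N (b i₁) - b i₁) ξ)
      rw [inner_sub_left, hb1] at h2
      have h4 : ‖N (b i₁) - b i₁‖ * ‖ξ‖ ≤ τ * 1 * 2 := by gcongr
      linarith
    have hlast : ⟪ρ⁻¹ • m (a, ρ • (V - ε • b i₁)), ξ⟫_ℝ < 0 := by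
      have h2 := le_of_abs_le (abs_real_inner_le_norm
        (ρ⁻¹ • m (a, ρ • (V - ε • b i₁)) - N (V - ε • b i₁)) ξ)
      have h4 : ‖ρ⁻¹ • m (a, ρ • (V - ε • b i₁)) - N (V - ε • b i₁)‖ * ‖ξ‖ ≤ ε / 16 * 2 := by
        gcongr
      rw [inner_sub_left, map_sub, map_smul, inner_sub_left, real_inner_smul_left (N (b i₁))] at h2
      rw [map_sub, map_smul] at h4
      have h5 : ε * (1 / 2) ≤ ε * ⟪N (b i₁), ξ⟫_ℝ := by gcongr
      linarith
    rw [real_inner_smul_left] at hlast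
    by_contra! hcon
    have : 0 ≤ ρ⁻¹ * ⟪m (a, ρ • (V - ε • b i₁)), ξ⟫_ℝ := by positivity
    linarith
  have hφ : ∀ s ∈ Icc 0 S, ⟪m (γ s, Y s), deriv γ s⟫_ℝ ≤ 0 := by
    refine nonpos_of_deriv_neg_at_zeros (φ := fun s => ⟪m (γ s, Y s), deriv γ s⟫_ℝ)
      (fun s hs => (hφd s hs).continuousAt.continuousWithinAt) hφ0 fun s hs hz => ?_
    refine ⟨_, ?_, hφd s hs⟩
    have hs' := habs s hs
    obtain ⟨c, hc, hneg⟩ := h.frame_hess_neg hr hc₀ hC₀ hτ (hγ s hs').1 hy₁ he0 hey b h01 hρ hρr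
      hρe hρC (hμ _ (hγ s hs').1) (hmγ s hs') (hbγ s hs') (hβ s hs.1 (hs.2.trans_lt hSR)) hz
    -- Differentiating ⟨m(γ,Ysᵢ),γ'⟩ = 0 trades the uncontrolled γ'' for Hessians. Since m(γ,Y) is a
    -- combination of these gradients at a zero, the same can be done for it.
    have hi : ∀ i, ⟪m (γ s, Ys i), deriv (deriv γ) s⟫_ℝ
        = - ⟪fderiv ℝ m (γ s, Ys i) (deriv γ s, 0), deriv γ s⟫_ℝ := by
      intro i
      have h1 := hasDerivAt_inner_deriv (Y := fun _ => Ys i) (hγ s hs').2.1 (hasDerivAt_const s _)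
        (h.differentiableAt_grad (hγ s hs').1 (hYsr i))
      have h2 : (fun q => ⟪m (γ q, Ys i), deriv γ q⟫_ℝ) =ᶠ[𝓝 s] fun _ => 0 := by
        have : {s : ℝ | |s| < R / 2} ∈ 𝓝 s :=
          (isOpen_lt continuous_abs continuous_const).mem_nhds hs'
        filter_upwards [this] with q hq using hmγ q hq i
      have h3 := (h1.congr_of_eventuallyEq h2.symm).unique (hasDerivAt_const s _)
      have h4 : fderiv ℝ m (γ s, Ys i) ((0 : Vec n), (0 : Vec n)) = 0 := map_zero _
      rw [h4, inner_zero_left] at h3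
      linarith
    have h1 : ⟪m (γ s, Y s), deriv (deriv γ) s⟫_ℝ
        = - ∑ i, c i * ⟪fderiv ℝ m (γ s, Ys i) (deriv γ s, 0), deriv γ s⟫_ℝ := by
      have hc' : m (γ s, Y s) = ∑ i, c i • m (γ s, Ys i) := hc
      rw [hc', sum_inner, ← Finset.sum_neg_distrib]
      refine Finset.sum_congr rfl fun i _ => ?_
      rw [inner_smul_left, conj_trivial, hi]; ring
    have h2 : ⟪fderiv ℝ m (γ s, Y s) (0, (ρ * κ) • b i₁), deriv γ s⟫_ℝ
        = ρ * κ * ⟪fderiv ℝ m (γ s, Y s) (0, b i₁), deriv γ s⟫_ℝ := by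
      have : ((0 : Vec n), (ρ * κ) • b i₁) = (ρ * κ) • ((0 : Vec n), b i₁) := by simp
      rw [this, map_smul, inner_smul_left, conj_trivial]
    change ⟪fderiv ℝ m (γ s, Y s) (deriv γ s, 0), deriv γ s⟫_ℝ
      - ∑ i, c i * ⟪fderiv ℝ m (γ s, Ys i) (deriv γ s, 0), deriv γ s⟫_ℝ
      + ρ * κ * ⟪fderiv ℝ m (γ s, Y s) (0, b i₁), deriv γ s⟫_ℝ < 0 at hneg
    rw [h1, h2]
    linarith
  have hρV : ρ • V ∈ ball (0 : Vec n) r := by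
    rw [mem_ball_zero_iff, norm_smul, Real.norm_of_nonneg hρ.le]
    have := mul_le_mul_of_nonneg_left hVn hρ.le
    linarith
  -- Replacing Y(s) by the fixed point ρV changes the derivative by about -ρ(κs - ε), which turns
  -- the sign information into quadratic decrease; κ/4 = c₀|e|/256.
  have hint : w (γ S) (ρ • V) - w a (ρ • V) ≤ ρ * (2 * ε * S - c₀ * ‖e‖ / 256 * S ^ 2) := by
    have hder : ∀ s ∈ Icc 0 S, HasDerivAt
        (fun s => w (γ s) (ρ • V) - ρ * (2 * ε * s - c₀ * ‖e‖ / 256 * s ^ 2))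
        (⟪m (γ s, ρ • V), deriv γ s⟫_ℝ - ρ * (2 * ε - κ * s / 2)) s := by
      intro s hs
      have h1 : HasDerivAt γ (deriv γ s) s :=
        ((hγ s (habs s hs)).2.1.differentiableAt (by norm_num)).hasDerivAt
      have h2 : HasDerivAt (fun s => w (γ s) (ρ • V)) ⟪m (γ s, ρ • V), deriv γ s⟫_ℝ s :=
        (h.grad _ (hγ s (habs s hs)).1 _ hρV).comp_hasDerivAt (f := γ) s h1
      have h3 : HasDerivAt (fun s : ℝ => ρ * (2 * ε * s - c₀ * ‖e‖ / 256 * s ^ 2))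
          (ρ * (2 * ε - κ * s / 2)) s := by
        have h4 := (((hasDerivAt_id s).const_mul (2 * ε)).sub
          (((hasDerivAt_id s).pow 2).const_mul (c₀ * ‖e‖ / 256))).const_mul ρ
        refine h4.congr_deriv ?_
        simp only [hκ, id]; push_cast; ring
      exact h2.sub h3
    have hle : ∀ s ∈ Icc 0 S,
        ⟪m (γ s, ρ • V), deriv γ s⟫_ℝ - ρ * (2 * ε - κ * s / 2) ≤ 0 := by
      intro s hs
      have hs' := habs s hs
      have h1 := h.grad_near (hγ s hs').1 hρV (hYr s hs.1 (hs.2.trans_lt hSR))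
      have h2 : ρ • V - Y s = -((ρ * (κ * s - ε)) • b i₁) := by
        simp only [hY, smul_add, smul_smul]; abel
      rw [h2, norm_neg, norm_smul, hbn, mul_one, norm_mul, Real.norm_of_nonneg hρ.le,
        Real.norm_eq_abs, sub_neg_eq_add] at h1
      have h3 := le_of_abs_le (abs_real_inner_le_norm
        (m (γ s, ρ • V) - m (γ s, Y s) + (ρ * (κ * s - ε)) • b i₁) (deriv γ s))
      rw [inner_add_left, inner_sub_left, inner_smul_left, conj_trivial, hbγ s hs', mul_one] at h3
      have h4 : ‖m (γ s, ρ • V) - m (γ s, Y s) + (ρ * (κ * s - ε)) • b i₁‖ * ‖deriv γ s‖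
          ≤ τ * (ρ * |κ * s - ε|) * 2 := by
        gcongr
        exact hγn s hs'
      have h5 := hφ s hs
      have h6 : 0 ≤ κ * s := mul_nonneg hκ0.le hs.1
      have h7 : τ * (ρ * |κ * s - ε|) * 2 ≤ ρ * |κ * s - ε| * (1 / 2) := by
        have := mul_le_mul_of_nonneg_right hτ1 (by positivity : 0 ≤ ρ * |κ * s - ε|)
        have : 0 ≤ ρ * |κ * s - ε| := by positivity
        linarith
      have h8 : -(κ * s - ε) + |κ * s - ε| * (1 / 2) ≤ 2 * ε - κ * s / 2 := by
        rcases abs_cases (κ * s - ε) with ⟨h, _⟩ | ⟨h, _⟩ <;> rw [h] <;> linarith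
      have h9 := mul_le_mul_of_nonneg_left h8 hρ.le
      linarith
    have hanti := antitoneOn_of_hasDerivWithinAt_nonpos (convex_Icc 0 S)
      (fun s hs => (hder s hs).continuousAt.continuousWithinAt)
      (fun s hs => (hder s (interior_subset hs)).hasDerivWithinAt)
      (fun s hs => hle s (interior_subset hs))
    have h1 := hanti (left_mem_Icc.2 hS0) (right_mem_Icc.2 hS0) hS0
    simp only [hγ0] at h1
    linarith
  -- The end point of γ has the same coordinates as x' except the w(·,ρ bᵢ), so the chart estimate
  -- bounds their distance by the listed sum.
  have herr : |w x' (ρ • V) - w (γ S) (ρ • V)| ≤ 4 * ρ *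
      ∑ i, (if i = i₀ ∨ i = i₁ then 0 else |(w x' (ρ • b i) - w a (ρ • b i)) / ρ|) := by
    have hS' : |S| < R / 2 := by rwa [abs_of_nonneg hS0]
    have h1 : ‖w x' (ρ • V) - w (γ S) (ρ • V)‖ ≤ 2 * ρ * ‖x' - γ S‖ := by
      refine (convex_ball a R).norm_image_sub_le_of_norm_hasFDerivWithin_le
        (fun x hx => (h.grad x hx _ hρV).hasFDerivWithinAt) (fun x hx => ?_) (hγ S hS').1 hx'
      rw [innerSL_apply_norm]
      have h2 := h.grad_near_zero hr hx hρV
      have h3 := norm_le_norm_sub_add (m (x, ρ • V)) (ρ • V)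
      rw [norm_smul, Real.norm_of_nonneg hρ.le] at h2 h3
      have h4 : ρ * ‖V‖ ≤ ρ * (5 / 4) := by gcongr
      have := mul_le_mul_of_nonneg_right hτ1 (by positivity : 0 ≤ ρ * ‖V‖)
      linarith
    have h2 : ∑ i, l i x' • b i - S • b i₁
        = ∑ i, (if i = i₀ ∨ i = i₁ then 0 else (w x' (ρ • b i) - w a (ρ • b i)) / ρ) • b i := by
      have h3 : S • b i₁ = ∑ i, (if i = i₁ then S else 0) • b i := by simp
      rw [h3, ← Finset.sum_sub_distrib]
      refine Finset.sum_congr rfl fun i _ => ?_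
      rw [← sub_smul]
      congr 1
      by_cases hi1 : i = i₁
      · simp [hi1, hl, hS]
      by_cases hi0 : i = i₀
      · simp [hi0, h01, hl, hYs, frameY, hlev]
      · simp [hi0, hi1, hl, hYs, frameY, hTdef, frameT]
    have h4 : ‖∑ i, l i x' • b i - S • b i₁‖
        ≤ ∑ i, (if i = i₀ ∨ i = i₁ then 0 else |(w x' (ρ • b i) - w a (ρ • b i)) / ρ|) := by
      rw [h2]
      refine (norm_sum_le _ _).trans (Finset.sum_le_sum fun i _ => ?_)
      rw [norm_smul, hbn, mul_one, Real.norm_eq_abs]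
      split_ifs <;> simp
    have h5 := (hγ S hS').2.2.2 x' hx'
    rw [← Real.norm_eq_abs]
    calc _ ≤ 2 * ρ * ‖x' - γ S‖ := h1
      _ ≤ 2 * ρ * (2 * ∑ i, (if i = i₀ ∨ i = i₁ then 0
          else |(w x' (ρ • b i) - w a (ρ • b i)) / ρ|)) := by
        gcongr
        exact h5.trans (by gcongr)
      _ = _ := by ring
  linarith [abs_le.1 herr]

end LocalModel

end GenFun

/-! ### Level sets in the coordinates Q and the quadratic gap in the local model. -/

namespace GenFun

variable {n : ℕ}

theorem exists_orthonormalBasis_pair {u v : Vec n} (hu : ‖u‖ = 1) (hv : ‖v‖ = 1)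
    (huv : ⟪u, v⟫_ℝ = 0) :
    ∃ (b : OrthonormalBasis (Fin n) ℝ (Vec n)) (i j : Fin n), i ≠ j ∧ b i = u ∧ b j = v := by
  have ho : Orthonormal ℝ ![u, v] := by
    rw [orthonormal_iff_ite]
    intro i j
    fin_cases i <;> fin_cases j <;>
      simp [hu, hv, huv, real_inner_comm u v]
  have hn : 2 ≤ n := by
    have := ho.linearIndependent.fintype_card_le_finrank
    simpa using this
  obtain ⟨i, j, hij⟩ : ∃ i j : Fin n, i ≠ j := ⟨⟨0, by omega⟩, ⟨1, by omega⟩, by simp⟩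
  have hs : Orthonormal ℝ (({i, j} : Set (Fin n)).domRestrict fun k => if k = i then u else v) := by
    refine ⟨fun ⟨p, hp⟩ => ?_, fun ⟨p, hp⟩ ⟨q, hq⟩ hpq => ?_⟩
    · change ‖if p = i then u else v‖ = 1
      split_ifs <;> assumption
    · change ⟪if p = i then u else v, if q = i then u else v⟫_ℝ = 0
      have hne : p ≠ q := fun h => hpq (Subtype.ext h)
      split_ifs with h1 h2 h2
      · exact absurd (h1.trans h2.symm) hne
      · exact huv
      · rwa [real_inner_comm]
      · exact absurd ((hp.resolve_left h1).trans (hq.resolve_left h2).symm) hne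
  obtain ⟨b, hb⟩ := hs.exists_orthonormalBasis_extension_of_card_eq (by simp)
  refine ⟨b, i, j, hij, ?_, ?_⟩
  · simpa using hb i (by simp)
  · simpa [hij.symm] using hb j (by simp)

namespace LocalModel

variable {w : Vec n → Vec n → ℝ} {m : Vec n × Vec n → Vec n} {Q : Vec n → Vec n} {a : Vec n}
  {R r τ c₀ C₀ : ℝ}

/-- Because w(·,0) is constant, the constant terms cancel and only ∂w/∂y at 0, that is Q, remains.
This limit links the small test functions of the slice to Q. -/
theorem tendsto_quotient (h : LocalModel w m Q a R r τ c₀ C₀) {x x' : Vec n} (hx : x ∈ ball a R)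
    (hx' : x' ∈ ball a R) (η : Vec n) :
    Tendsto (fun ρ : ℝ => (w x (ρ • η) - w x' (ρ • η)) / ρ) (𝓝[>] 0) (𝓝 ⟪Q x - Q x', η⟫_ℝ) := by
  have hd : ∀ p ∈ ball a R, HasDerivAt (fun ρ : ℝ => w p (ρ • η)) ⟪Q p, η⟫_ℝ 0 := by
    intro p hp
    have h1 : HasDerivAt (fun ρ : ℝ => ρ • η) η 0 := by
      simpa using (hasDerivAt_id (0 : ℝ)).smul_const η
    have h2 := h.deriv_zero p hp
    rw [← zero_smul ℝ η] at h2
    exact h2.comp_hasDerivAt (f := fun ρ : ℝ => ρ • η) 0 h1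
  have h1 := hasDerivAt_iff_tendsto_slope_zero.1 ((hd x hx).sub (hd x' hx'))
  rw [← inner_sub_left] at h1
  refine (h1.mono_left (nhdsWithin_mono _ fun t ht => ne_of_gt ht)).congr fun t => ?_
  simp [h.const_zero x hx x' hx', div_eq_inv_mul]

theorem tendsto_scaled_grad (h : LocalModel w m Q a R r τ c₀ C₀) (hr : 0 < r) {x : Vec n}
    (hx : x ∈ ball a R) (η : Vec n) :
    Tendsto (fun ρ : ℝ => ρ⁻¹ • m (x, ρ • η)) (𝓝[>] 0) (𝓝 (fderiv ℝ m (x, 0) (0, η))) := by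
  have h1 : HasDerivAt (fun ρ : ℝ => (x, ρ • η)) ((0 : Vec n), η) 0 := by
    simpa using (hasDerivAt_const (0 : ℝ) x).prodMk ((hasDerivAt_id (0 : ℝ)).smul_const η)
  have h2 := (h.differentiableAt_grad hx (mem_ball_self hr)).hasFDerivAt
  have h3 : HasDerivAt (fun ρ : ℝ => m (x, ρ • η)) (fderiv ℝ m (x, 0) (0, η)) 0 := by
    have h2' : HasFDerivAt m (fderiv ℝ m (x, 0)) (x, (0 : ℝ) • η) := by rwa [zero_smul]
    exact h2'.comp_hasDerivAt (f := fun ρ : ℝ => (x, ρ • η)) 0 h1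
  have h4 := hasDerivAt_iff_tendsto_slope_zero.1 h3
  refine (h4.mono_left (nhdsWithin_mono _ fun t ht => ne_of_gt ht)).congr fun t => ?_
  simp [h.grad_zero x hx]

/-- Q has not been assumed differentiable in the model. It is the limit of w(·,ρη)/ρ up to
constants, and the gradients of these functions are uniformly close to η. -/
theorem norm_Q_sub_le (h : LocalModel w m Q a R r τ c₀ C₀) (hr : 0 < r) {x x' : Vec n}
    (hx : x ∈ ball a R) (hx' : x' ∈ ball a R) :
    ‖Q x - Q x' - (x - x')‖ ≤ τ * ‖x - x'‖ := by
  have key : ∀ η : Vec n, ⟪Q x - Q x', η⟫_ℝ - ⟪x - x', η⟫_ℝ ≤ τ * ‖η‖ * ‖x - x'‖ := by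
    intro η
    refine le_of_tendsto ((h.tendsto_quotient hx hx' η).sub_const _) ?_
    have hsm : ∀ᶠ ρ : ℝ in 𝓝[>] 0, ρ * ‖η‖ < r := by
      have : Tendsto (fun ρ : ℝ => ρ * ‖η‖) (𝓝[>] 0) (𝓝 (0 * ‖η‖)) :=
        (tendsto_id.mul_const _).mono_left nhdsWithin_le_nhds
      rw [zero_mul] at this
      exact this.eventually_lt_const hr
    filter_upwards [hsm, self_mem_nhdsWithin] with ρ h1 hρ
    have hρ : 0 < ρ := hρ
    have hη : ρ • η ∈ ball (0 : Vec n) r := by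
      rwa [mem_ball_zero_iff, norm_smul, Real.norm_of_nonneg hρ.le]
    have h2 := (convex_ball a R).norm_image_sub_le_of_norm_hasFDerivWithin_le'
      (f := fun p => ρ⁻¹ • w p (ρ • η)) (f' := fun p => innerSL ℝ (ρ⁻¹ • m (p, ρ • η)))
      (φ := innerSL ℝ η) (C := τ * ‖η‖) (fun p hp => by
        have h3 := (h.grad p hp _ hη).const_smul ρ⁻¹
        have h4 : innerSL ℝ (ρ⁻¹ • m (p, ρ • η)) = ρ⁻¹ • innerSL ℝ (m (p, ρ • η)) := by
          ext v; simp
        rw [h4]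
        exact h3.hasFDerivWithinAt) (fun p hp => by
        rw [← map_sub, innerSL_apply_norm]
        exact h.scaled_grad_near hr hρ hp h1) hx' hx
    have h5 := (le_abs_self _).trans h2
    rw [innerSL_apply_apply, real_inner_comm] at h5
    refine le_trans (le_of_eq ?_) h5
    simp only [smul_eq_mul]; ring
  have h1 := key (Q x - Q x' - (x - x'))
  rw [← inner_sub_left, real_inner_self_eq_norm_sq] at h1
  by_contra! hcon
  have : 0 < ‖Q x - Q x' - (x - x')‖ :=
    lt_of_le_of_lt (mul_nonneg h.tau_nonneg (norm_nonneg _)) hcon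
  nlinarith

theorem abs_sub_sub_inner_le (h : LocalModel w m Q a R r τ c₀ C₀) (hR : 0 < R) (hr : 0 < r)
    (hτ : τ ≤ 1 / 400) {y₁ e : Vec n} (hy₁ : y₁ ∈ ball 0 r)
    (he : fderiv ℝ m (a, 0) (0, e) = m (a, y₁)) {x x' : Vec n} (hx : x ∈ ball a R)
    (hx' : x' ∈ ball a R) : |w x' y₁ - w x y₁ - ⟪e, x' - x⟫_ℝ| ≤ 5 * τ * ‖e‖ * ‖x' - x‖ :=
  (convex_ball a R).norm_image_sub_le_of_norm_hasFDerivWithin_le'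
    (f := fun p => w p y₁) (f' := fun p => innerSL ℝ (m (p, y₁)))
    (φ := innerSL ℝ e) (C := 5 * τ * ‖e‖) (fun p hp => (h.grad p hp _ hy₁).hasFDerivWithinAt)
    (fun p hp => by
      rw [← map_sub, innerSL_apply_norm]
      exact (h.covector_near hR hr hτ hy₁ he).2.2 p hp) hx hx'

/-- On a level set of `w (·, y₁)` through the centre, `Q` lies strictly on one side. -/
theorem inner_le_of_level (h : LocalModel w m Q a R r τ c₀ C₀) (hR : 0 < R) (hr : 0 < r)
    (hc₀ : 0 < c₀) (hC₀ : 0 ≤ C₀) (hτ : τ * n ^ 2 ≤ 1 / 400) (hcR : c₀ * r * R ≤ 1)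
    {x' y₁ e : Vec n} (hx' : x' ∈ ball a (R / 2)) (hy₁ : y₁ ∈ ball 0 r)
    (he : fderiv ℝ m (a, 0) (0, e) = m (a, y₁)) (hlev : w x' y₁ = w a y₁) :
    ⟪e, Q x' - Q a⟫_ℝ ≤ -(c₀ / 4096) * ‖y₁‖ ^ 2 * ‖x' - a‖ ^ 2 := by
  have ha : a ∈ ball a R := mem_ball_self hR
  have hx'R : x' ∈ ball a R := ball_subset_ball (by linarith) hx'
  by_cases hxa : x' = a
  · simp [hxa]
  have hX : 0 < ‖x' - a‖ := norm_pos_iff.2 (sub_ne_zero.2 hxa)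
  have hn' : (1 : ℝ) ≤ n := by
    have : n ≠ 0 := by
      rintro rfl
      exact hxa (Subsingleton.elim _ _)
    exact_mod_cast Nat.one_le_iff_ne_zero.2 this
  have hτ0 := h.tau_nonneg
  obtain ⟨hτn, hτ1⟩ := mul_le_and_le_of_mul_sq_le hτ0 hτ hn'
  obtain ⟨hey, hye, hme⟩ := h.covector_near hR hr hτ1 hy₁ he
  by_cases he0 : e = 0
  · have : y₁ = 0 := by
      rw [he0, norm_zero, mul_zero] at hye
      exact norm_le_zero_iff.1 hye
    simp [he0, this]
  have hE : 0 < ‖e‖ := norm_pos_iff.2 he0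
  set d := Q x' - Q a with hd
  have hdx : ‖d - (x' - a)‖ ≤ τ * ‖x' - a‖ := h.norm_Q_sub_le hr hx'R ha
  set u := ‖e‖⁻¹ • e with hu
  have hun : ‖u‖ = 1 := by rw [hu, norm_smul, norm_inv, norm_norm, inv_mul_cancel₀ hE.ne']
  have heu : e = ‖e‖ • u := by rw [hu, smul_smul, mul_inv_cancel₀ hE.ne', one_smul]
  have hux : |⟪u, x' - a⟫_ℝ| ≤ 5 * τ * ‖x' - a‖ := by
    have h1 := h.abs_sub_sub_inner_le hR hr hτ1 hy₁ he ha hx'R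
    rw [hlev, sub_self, zero_sub, abs_neg] at h1
    rw [hu, real_inner_smul_left, abs_mul, abs_of_pos (inv_pos.2 hE), inv_mul_le_iff₀ hE]
    linarith
  have hud : |⟪u, d⟫_ℝ| ≤ 6 * τ * ‖x' - a‖ := by
    have h1 : ⟪u, d⟫_ℝ = ⟪u, x' - a⟫_ℝ + ⟪u, d - (x' - a)⟫_ℝ := by rw [← inner_add_right]; simp
    have h2 := abs_real_inner_le_norm u (d - (x' - a))
    rw [hun, one_mul] at h2
    rw [h1]
    refine (abs_add_le _ _).trans ?_
    linarith
  -- The basis is adapted to the end point: its first two vectors span e and ΔQ, so the remaining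
  -- components of ΔQ vanish and the error sum of the slice tends to 0 with ρ.
  set f := d - ⟪u, d⟫_ℝ • u with hf
  have huf : ⟪u, f⟫_ℝ = 0 := by
    rw [hf, inner_sub_right, real_inner_smul_right, real_inner_self_eq_norm_sq, hun]; ring
  have hfn : (1 / 2) * ‖x' - a‖ + τ * ‖x' - a‖ ≤ ‖f‖ := by
    have h1 : ‖f - (x' - a)‖ ≤ ‖d - (x' - a)‖ + ‖⟪u, d⟫_ℝ • u‖ := by
      rw [show f - (x' - a) = (d - (x' - a)) - ⟪u, d⟫_ℝ • u by rw [hf]; abel]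
      exact norm_sub_le _ _
    rw [norm_smul, hun, mul_one, Real.norm_eq_abs] at h1
    have h2 := norm_le_norm_sub_add (x' - a) f
    rw [norm_sub_rev (x' - a) f] at h2
    have := mul_le_mul_of_nonneg_right hτ1 (norm_nonneg (x' - a))
    linarith
  have hF : 0 < ‖f‖ := by
    have := mul_nonneg hτ0 (norm_nonneg (x' - a))
    linarith
  set v := ‖f‖⁻¹ • f with hv
  have hvn : ‖v‖ = 1 := by rw [hv, norm_smul, norm_inv, norm_norm, inv_mul_cancel₀ hF.ne']
  have huv : ⟪u, v⟫_ℝ = 0 := by rw [hv, real_inner_smul_right, huf, mul_zero]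
  obtain ⟨b, i₀, i₁, h01, hb0, hb1⟩ := exists_orthonormalBasis_pair hun hvn huv
  have hfd : f = ‖f‖ • v := by rw [hv, smul_smul, mul_inv_cancel₀ hF.ne', one_smul]
  have hdd : d = ⟪u, d⟫_ℝ • b i₀ + ‖f‖ • b i₁ := by
    rw [hb0, hb1, ← hfd, hf]; abel
  have hvd : ⟪v, d⟫_ℝ = ‖f‖ := by
    rw [hdd, inner_add_right, real_inner_smul_right, real_inner_smul_right, hb0, hb1,
      real_inner_comm u v, huv, real_inner_self_eq_norm_sq, hvn]; ring
  set S := ⟪b i₁, x' - a⟫_ℝ with hS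
  have hSlow : (1 / 2) * ‖x' - a‖ ≤ S := by
    have h1 : ⟪v, d⟫_ℝ = S + ⟪v, d - (x' - a)⟫_ℝ := by
      rw [hS, hb1, ← inner_add_right]; simp
    have h2 := (le_abs_self _).trans (abs_real_inner_le_norm v (d - (x' - a)))
    rw [hvn, one_mul] at h2
    linarith
  have hSup : S < R / 2 := by
    have h2 := (le_abs_self _).trans (abs_real_inner_le_norm (b i₁) (x' - a))
    rw [b.orthonormal.1, one_mul] at h2
    have := mem_ball_iff_norm.1 hx'
    linarith
  set V := frameV b i₀ i₁ with hV
  have hdi : ∀ i, i ≠ i₀ → i ≠ i₁ → ⟪d, b i⟫_ℝ = 0 := by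
    intro i hi0 hi1
    rw [hdd, inner_add_left, real_inner_smul_left (b i₀), real_inner_smul_left (b i₁),
      b.inner_eq_ite,
      b.inner_eq_ite, if_neg (Ne.symm hi0), if_neg (Ne.symm hi1)]; ring
  have hdV : ⟪d, V⟫_ℝ = ⟪u, d⟫_ℝ := by
    rw [hV, frameV, inner_sum, Finset.sum_eq_single i₀]
    · rw [real_inner_smul_right, frameC, if_neg h01, if_pos rfl, one_mul, hb0, real_inner_comm]
    · intro i _ hi0
      by_cases hi1 : i = i₁
      · simp [frameC, hi1]
      · rw [real_inner_smul_right, hdi i hi0 hi1, mul_zero]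
    · simp
  have main : ∀ ε : ℝ, 0 < ε → ε ≤ 1 / 2 →
      ⟪u, d⟫_ℝ ≤ 2 * ε * S - c₀ * ‖e‖ / 256 * S ^ 2 := by
    intro ε hε hε'
    have t1 := h.tendsto_quotient hx'R ha V
    rw [← hd, hdV] at t1
    have t2 : Tendsto (fun ρ : ℝ => 2 * ε * S - c₀ * ‖e‖ / 256 * S ^ 2
        + 4 * ∑ i, (if i = i₀ ∨ i = i₁ then 0 else |(w x' (ρ • b i) - w a (ρ • b i)) / ρ|))
        (𝓝[>] 0) (𝓝 (2 * ε * S - c₀ * ‖e‖ / 256 * S ^ 2 + 4 * ∑ _i : Fin n, (0 : ℝ))) := by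
      refine tendsto_const_nhds.add (Tendsto.const_mul 4 (tendsto_finsetSum _ fun i _ => ?_))
      by_cases hi : i = i₀ ∨ i = i₁
      · simp only [if_pos hi]; exact tendsto_const_nhds
      · simp only [if_neg hi]
        push Not at hi
        have t3 := (h.tendsto_quotient hx'R ha (b i)).abs
        rwa [← hd, hdi i hi.1 hi.2, abs_zero] at t3
    rw [Finset.sum_const_zero, mul_zero, add_zero] at t2
    refine le_of_tendsto_of_tendsto t1 t2 ?_
    have e1 : ∀ i, ∀ᶠ ρ : ℝ in 𝓝[>] 0,
        ‖ρ⁻¹ • m (a, ρ • b i) - fderiv ℝ m (a, 0) (0, b i)‖ ≤ ε / 16 := by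
      intro i
      have := ((h.tendsto_scaled_grad hr ha (b i)).sub_const
        (fderiv ℝ m (a, 0) (0, b i))).norm
      rw [sub_self, norm_zero] at this
      exact this.eventually_le_const (by positivity)
    have e2 : ∀ᶠ ρ : ℝ in 𝓝[>] 0, ‖ρ⁻¹ • m (a, ρ • (V - ε • b i₁))
        - fderiv ℝ m (a, 0) (0, V - ε • b i₁)‖ ≤ ε / 16 := by
      have := ((h.tendsto_scaled_grad hr ha (V - ε • b i₁)).sub_const
        (fderiv ℝ m (a, 0) (0, V - ε • b i₁))).norm
      rw [sub_self, norm_zero] at this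
      exact this.eventually_le_const (by positivity)
    have e3 : ∀ C D : ℝ, 0 < D → ∀ᶠ ρ : ℝ in 𝓝[>] 0, C * ρ < D := by
      intro C D hD
      have : Tendsto (fun ρ : ℝ => C * ρ) (𝓝[>] 0) (𝓝 (C * 0)) :=
        (tendsto_id.const_mul _).mono_left nhdsWithin_le_nhds
      rw [mul_zero] at this
      exact this.eventually_lt_const hD
    filter_upwards [eventually_all.2 e1, e2, e3 2 r hr, e3 16 _ hE,
      e3 (64 * C₀) (c₀ * ‖e‖) (by positivity), self_mem_nhdsWithin] with ρ f1 f2 f3 f4 f5 hρ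
    have hρ : 0 < ρ := hρ
    have := h.slice_estimate hR hr hc₀ hC₀ hτ hcR hx'R hy₁ he0 he hlev b h01 hb0
      (by linarith) hSup hε hε' hρ f3 f4.le f5.le f1 f2
    rw [div_le_iff₀ hρ]
    linarith
  -- The limit ε → 0 is taken after ρ → 0, since the admissible ρ depend on ε.
  have hfin : ⟪u, d⟫_ℝ ≤ - (c₀ * ‖e‖ / 256 * S ^ 2) := by
    have t : Tendsto (fun ε : ℝ => 2 * ε * S - c₀ * ‖e‖ / 256 * S ^ 2) (𝓝[>] 0)
        (𝓝 (2 * 0 * S - c₀ * ‖e‖ / 256 * S ^ 2)) := by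
      refine Tendsto.mono_left ?_ nhdsWithin_le_nhds
      exact Continuous.tendsto (by fun_prop) 0
    rw [mul_zero, zero_mul, zero_sub] at t
    refine ge_of_tendsto t ?_
    filter_upwards [Ioc_mem_nhdsGT (show (0 : ℝ) < 1 / 2 by norm_num)] with ε hε
      using main ε hε.1 hε.2
  have h0 : ⟪e, d⟫_ℝ = ‖e‖ * ⟪u, d⟫_ℝ := by
    rw [hu, real_inner_smul_left, mul_inv_cancel_left₀ hE.ne']
  have h1 : ‖e‖ * ⟪u, d⟫_ℝ ≤ ‖e‖ * - (c₀ * ‖e‖ / 256 * S ^ 2) := by gcongr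
  have h2 : (1 / 2 * ‖y₁‖) ^ 2 ≤ ‖e‖ ^ 2 := pow_le_pow_left₀ (by positivity) (by linarith) 2
  have h3 : (1 / 2 * ‖x' - a‖) ^ 2 ≤ S ^ 2 := pow_le_pow_left₀ (by positivity) hSlow 2
  have h4 : c₀ * (1 / 2 * ‖y₁‖) ^ 2 * (1 / 2 * ‖x' - a‖) ^ 2 ≤ c₀ * ‖e‖ ^ 2 * S ^ 2 := by gcongr
  rw [h0]
  linarith

/-- On the half space where `Q` is on the positive side of the centre, `w (·, y₁)` grows
quadratically. -/
theorem quadratic_gap (h : LocalModel w m Q a R r τ c₀ C₀) (hR : 0 < R) (hr : 0 < r)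
    (hc₀ : 0 < c₀) (hC₀ : 0 ≤ C₀) (hτ : τ * n ^ 2 ≤ 1 / 400) (hcR : c₀ * r * R ≤ 1)
    {x y₁ e : Vec n} (hx : x ∈ ball a (R / 8)) (hy₁ : y₁ ∈ ball 0 r)
    (he : fderiv ℝ m (a, 0) (0, e) = m (a, y₁)) (hpos : 0 ≤ ⟪e, Q x - Q a⟫_ℝ) :
    w a y₁ + c₀ / 65536 * ‖y₁‖ ^ 2 * ‖x - a‖ ^ 2 ≤ w x y₁ := by
  have ha : a ∈ ball a R := mem_ball_self hR
  by_cases hxa : x = a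
  · simp [hxa]
  have hn' : (1 : ℝ) ≤ n := by
    have : n ≠ 0 := by
      rintro rfl
      exact hxa (Subsingleton.elim _ _)
    exact_mod_cast Nat.one_le_iff_ne_zero.2 this
  have hτ0 := h.tau_nonneg
  obtain ⟨hτn, hτ1⟩ := mul_le_and_le_of_mul_sq_le hτ0 hτ hn'
  have hxR : x ∈ ball a R := ball_subset_ball (by linarith) hx
  obtain ⟨hey, hye, -⟩ := h.covector_near hR hr hτ1 hy₁ he
  by_cases he0 : e = 0
  · have : y₁ = 0 := by
      rw [he0, norm_zero, mul_zero] at hye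
      exact norm_le_zero_iff.1 hye
    rw [this, h.const_zero x hxR a ha]
    simp
  have hE : 0 < ‖e‖ := norm_pos_iff.2 he0
  set X := ‖x - a‖ with hX
  have hX0 : 0 < X := norm_pos_iff.2 (sub_ne_zero.2 hxa)
  have hX8 : X < R / 8 := mem_ball_iff_norm.1 hx
  set u := ‖e‖⁻¹ • e with hu
  have hun : ‖u‖ = 1 := by rw [hu, norm_smul, norm_inv, norm_norm, inv_mul_cancel₀ hE.ne']
  have heu : ⟪e, u⟫_ℝ = ‖e‖ := by
    rw [hu, real_inner_smul_right, real_inner_self_eq_norm_sq]; field_simp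
  have hp : ∀ t ∈ Icc (-(2 * X)) (2 * X), x + t • u ∈ ball a (R / 2) := by
    intro t ht
    rw [mem_ball_iff_norm, show x + t • u - a = (x - a) + t • u by abel]
    have h1 := norm_add_le (x - a) (t • u)
    rw [norm_smul, hun, mul_one, Real.norm_eq_abs] at h1
    have := abs_le.2 ht
    linarith
  have hpR : ∀ t ∈ Icc (-(2 * X)) (2 * X), x + t • u ∈ ball a R := fun t ht =>
    ball_subset_ball (by linarith) (hp t ht)
  have hvar : ∀ t ∈ Icc (-(2 * X)) (2 * X),
      |w (x + t • u) y₁ - w x y₁ - t * ‖e‖| ≤ 5 * τ * ‖e‖ * |t| := by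
    intro t ht
    have h1 := h.abs_sub_sub_inner_le hR hr hτ1 hy₁ he hxR (hpR t ht)
    rwa [add_sub_cancel_left, real_inner_smul_right, heu, norm_smul, hun, mul_one,
      Real.norm_eq_abs] at h1
  have hτe : ∀ t : ℝ, 5 * τ * ‖e‖ * |t| ≤ 1 / 80 * (‖e‖ * |t|) := by
    intro t
    have := mul_le_mul_of_nonneg_right hτ1 (by positivity : 0 ≤ ‖e‖ * |t|)
    linarith
  have hxa' : |w x y₁ - w a y₁| ≤ (1 + 1 / 80) * (‖e‖ * X) := by
    have h1 := h.abs_sub_sub_inner_le hR hr hτ1 hy₁ he ha hxR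
    have h2 := abs_real_inner_le_norm e (x - a)
    have h3 := hτe X
    rw [abs_of_pos hX0] at h3
    have h4 := abs_add_le (w x y₁ - w a y₁ - ⟪e, x - a⟫_ℝ) ⟪e, x - a⟫_ℝ
    rw [sub_add_cancel] at h4
    linarith
  -- Slide x along e to the level set through a: w(·,y₁) varies almost linearly at rate |e|, so a
  -- displacement of 2|x - a| suffices. The level set estimate then forces t ≤ 0.
  obtain ⟨t, ht, hlev⟩ : ∃ t ∈ Icc (-(2 * X)) (2 * X), w (x + t • u) y₁ = w a y₁ := by
    have hc : ContinuousOn (fun t : ℝ => w (x + t • u) y₁) (Icc (-(2 * X)) (2 * X)) := by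
      intro t ht
      have h1 := (h.grad _ (hpR t ht) _ hy₁).continuousAt
      have h2 : ContinuousAt (fun t : ℝ => x + t • u) t := by fun_prop
      exact (ContinuousAt.comp (f := fun t : ℝ => x + t • u) h1 h2).continuousWithinAt
    have hm : (-(2 * X)) ≤ 2 * X := by linarith
    refine intermediate_value_Icc hm hc ⟨?_, ?_⟩
    · have h1 := abs_le.1 (hvar _ (left_mem_Icc.2 hm))
      have h2 := hτe (-(2 * X))
      rw [abs_neg, abs_of_pos (by linarith : (0 : ℝ) < 2 * X)] at h1 h2
      have h3 := abs_le.1 hxa'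
      have : 0 < ‖e‖ * X := by positivity
      linarith [h1.2]
    · have h1 := abs_le.1 (hvar _ (right_mem_Icc.2 hm))
      have h2 := hτe (2 * X)
      rw [abs_of_pos (by linarith : (0 : ℝ) < 2 * X)] at h1 h2
      have h3 := abs_le.1 hxa'
      have : 0 < ‖e‖ * X := by positivity
      linarith [h1.1]
  set x' := x + t • u with hx'
  have hl := h.inner_le_of_level hR hr hc₀ hC₀ hτ hcR (hp t ht) hy₁ he hlev
  have hq : t * ‖e‖ - 1 / 80 * (‖e‖ * |t|) ≤ ⟪e, Q x' - Q x⟫_ℝ := by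
    have h1 := h.norm_Q_sub_le hr (hpR t ht) hxR
    rw [← hx', show x' - x = t • u by rw [hx']; abel, norm_smul, hun, mul_one,
      Real.norm_eq_abs] at h1
    have h2 := neg_le_of_abs_le (abs_real_inner_le_norm e (Q x' - Q x - t • u))
    rw [inner_sub_right, real_inner_smul_right, heu] at h2
    have h3 : ‖e‖ * ‖Q x' - Q x - t • u‖ ≤ ‖e‖ * (τ * |t|) := by gcongr
    have h4 := hτe t
    have : 0 ≤ τ * ‖e‖ * |t| := by positivity
    linarith
  have hsplit : ⟪e, Q x - Q a⟫_ℝ = ⟪e, Q x' - Q a⟫_ℝ - ⟪e, Q x' - Q x⟫_ℝ := by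
    rw [← inner_sub_right]; congr 1; abel
  have hKnn : 0 ≤ c₀ / 4096 * ‖y₁‖ ^ 2 * ‖x' - a‖ ^ 2 := by positivity
  have ht0 : t ≤ 0 := by
    by_contra! hcon
    rw [abs_of_pos hcon] at hq
    have : 0 < ‖e‖ * t := by positivity
    linarith
  rw [abs_of_nonpos ht0] at hq
  have hΔ := abs_le.1 (hvar t ht)
  have h2 := hτe t
  rw [hlev, abs_of_nonpos ht0] at hΔ
  rw [abs_of_nonpos ht0] at h2
  have hΔ' : (1 - 1 / 80) * (‖e‖ * -t) ≤ w x y₁ - w a y₁ := by linarith [hΔ.2]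
  have hte : c₀ / 4096 * ‖y₁‖ ^ 2 * ‖x' - a‖ ^ 2 ≤ (1 + 1 / 80) * (‖e‖ * -t) := by linarith
  -- If x' stays away from a, the bending at x' supplies the gap. Otherwise |t| ≥ |x - a|/2 and the
  -- growth along e is already linear, which dominates the quadratic term because c₀ r R ≤ 1.
  rcases le_total (X / 2) ‖x' - a‖ with hc | hc
  · have h3 : c₀ / 4096 * ‖y₁‖ ^ 2 * (X / 2) ^ 2 ≤ c₀ / 4096 * ‖y₁‖ ^ 2 * ‖x' - a‖ ^ 2 := by
      gcongr
    have h4 : 0 ≤ c₀ * ‖y₁‖ ^ 2 * X ^ 2 := by positivity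
    linarith
  · have h3 : X ≤ ‖x' - a‖ + -t := by
      have h4 := norm_sub_le (x' - a) (t • u)
      rw [norm_smul, hun, mul_one, Real.norm_eq_abs, abs_of_nonpos ht0,
        show x' - a - t • u = x - a by rw [hx']; abel] at h4
      exact h4
    have h4 : X / 2 ≤ -t := by linarith
    have h5 : (‖y₁‖ / 2) * (X / 2) ≤ ‖e‖ * -t := by
      gcongr; linarith
    have h6 : ‖y₁‖ < r := by simpa using hy₁
    have h7 : c₀ * ‖y₁‖ * X ≤ c₀ * r * R := by
      gcongr; linarith
    have h8 : c₀ * ‖y₁‖ * X * (‖y₁‖ * X) ≤ 1 * (‖y₁‖ * X) := by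
      gcongr; linarith
    have h9 : 0 ≤ ‖y₁‖ * X := by positivity
    linarith

end LocalModel

end GenFun

/-! ### The level function of a generating function and its derivatives. -/

namespace GenFun

variable {n : ℕ}

/-- The space of parameters `(x, y, ȳ, z̄)`. -/
abbrev Par (n : ℕ) : Type := Vec n × Vec n × Vec n × ℝ

/-- The base triple `(x, ȳ, z̄)`. -/
def baseTrip (s : Par n) : Trip n := (s.1, s.2.2.1, s.2.2.2)

/-- The value `z` for which `g (x, y, z) = g (x, ȳ, z̄)`. -/
noncomputable def levelZ (Γ : Set (Trip n)) (g : Trip n → ℝ) (s : Par n) : ℝ :=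
  dualFun Γ g (s.2.1, s.1, g (baseTrip s))

/-- The triple `(x, y, z)` with `g (x, y, z) = g (x, ȳ, z̄)`. -/
noncomputable def levelTrip (Γ : Set (Trip n)) (g : Trip n → ℝ) (s : Par n) : Trip n :=
  (s.1, s.2.1, levelZ Γ g s)

/-- The gradient of `levelZ` in `x`. -/
noncomputable def levelGrad (Γ : Set (Trip n)) (g : Trip n → ℝ) (s : Par n) : Vec n :=
  (-gzF g (levelTrip Γ g s))⁻¹ • (gxF g (levelTrip Γ g s) - gxF g (baseTrip s))

/-- The parameters for which the previous objects are defined. -/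
def levelDom (Γ : Set (Trip n)) (g : Trip n → ℝ) : Set (Par n) :=
  {s | baseTrip s ∈ Γ ∧ (s.2.1, s.1, g (baseTrip s)) ∈ dualDomain Γ g}

section Level

variable {Γ : Set (Trip n)} {g : Trip n → ℝ} {s : Par n}

theorem levelTrip_mem (hs : s ∈ levelDom Γ g) : levelTrip Γ g s ∈ Γ := (IsGeneratingFunction.dualFun_spec hs.2).1

theorem levelTrip_val (hs : s ∈ levelDom Γ g) : g (levelTrip Γ g s) = g (baseTrip s) :=
  (IsGeneratingFunction.dualFun_spec hs.2).2

theorem contDiff_baseTrip : ContDiff ℝ 2 (baseTrip (n := n)) := by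
  unfold baseTrip
  fun_prop

theorem fderiv_baseTrip (s v : Par n) : fderiv ℝ baseTrip s v = baseTrip v := by
  let L : Par n →L[ℝ] Trip n := (ContinuousLinearMap.fst ℝ _ _).prod
    ((ContinuousLinearMap.snd ℝ _ _).comp (ContinuousLinearMap.snd ℝ _ _))
  change fderiv ℝ L s v = _
  rw [L.fderiv]; rfl

namespace IsGeneratingFunction

theorem smul_levelGrad (hg : IsGeneratingFunction Γ g) (hs : s ∈ levelDom Γ g) :
    gxF g (levelTrip Γ g s) - gxF g (baseTrip s)
      = (-gzF g (levelTrip Γ g s)) • levelGrad Γ g s := by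
  have := hg.gzF_neg (levelTrip_mem hs)
  rw [levelGrad, smul_smul, mul_inv_cancel₀ (by linarith), one_smul]

theorem levelDom_mem_nhds (hg : IsGeneratingFunction Γ g) (hs : s ∈ levelDom Γ g) :
    levelDom Γ g ∈ 𝓝 s := by
  have h1 : ∀ᶠ s' in 𝓝 s, baseTrip s' ∈ Γ :=
    contDiff_baseTrip.continuous.continuousAt.eventually (hg.isOpen.mem_nhds hs.1)
  have h2 : ContinuousAt (fun s : Par n => ((s.2.1, s.1, g (baseTrip s)) : Trip n)) s := by
    have h3 : ContinuousAt (fun s : Par n => g (baseTrip s)) s :=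
      ContinuousAt.comp (hg.differentiableAt hs.1).continuousAt
        contDiff_baseTrip.continuous.continuousAt
    exact (Continuous.continuousAt (by fun_prop)).prodMk
      ((Continuous.continuousAt (by fun_prop)).prodMk h3)
  exact h1.and (h2.eventually (hg.isOpen_dualDomain.mem_nhds hs.2))

theorem contDiffAt_levelZ (hg : IsGeneratingFunction Γ g) (hs : s ∈ levelDom Γ g) :
    ContDiffAt ℝ 2 (levelZ Γ g) s := by
  have h1 : ContDiffAt ℝ 2 (fun s : Par n => g (baseTrip s)) s :=
    ContDiffAt.comp s (hg.contDiffAt hs.1) contDiff_baseTrip.contDiffAt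
  have h2 : ContDiffAt ℝ 2 (fun s : Par n => ((s.2.1, s.1, g (baseTrip s)) : Trip n)) s :=
    (ContDiff.contDiffAt (by fun_prop)).prodMk ((ContDiff.contDiffAt (by fun_prop)).prodMk h1)
  exact ContDiffAt.comp (f := fun s : Par n => ((s.2.1, s.1, g (baseTrip s)) : Trip n)) s
    (hg.contDiffAt_dualFun hs.2) h2

theorem contDiffAt_levelTrip (hg : IsGeneratingFunction Γ g) (hs : s ∈ levelDom Γ g) :
    ContDiffAt ℝ 2 (levelTrip Γ g) s :=
  (ContDiff.contDiffAt (by fun_prop)).prodMk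
    ((ContDiff.contDiffAt (by fun_prop)).prodMk (hg.contDiffAt_levelZ hs))

theorem fderiv_levelZ (hg : IsGeneratingFunction Γ g) (hs : s ∈ levelDom Γ g) (ξ η : Vec n) :
    fderiv ℝ (levelZ Γ g) s (ξ, η, 0, 0)
      = ⟪levelGrad Γ g s, ξ⟫_ℝ + ⟪mapQF g (levelTrip Γ g s), η⟫_ℝ := by
  have ht := levelTrip_mem hs
  have hz := (hg.gzF_neg ht).ne
  have h0 : HasFDerivAt (fun s : Par n => g (baseTrip s))
      ((fderiv ℝ g (baseTrip s)).comp (fderiv ℝ baseTrip s)) s :=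
    HasFDerivAt.comp s (hg.differentiableAt hs.1).hasFDerivAt
      (contDiff_baseTrip.differentiable (by norm_num) s).hasFDerivAt
  have h1 : HasFDerivAt (fun s : Par n => ((s.2.1, s.1, g (baseTrip s)) : Trip n))
      (((ContinuousLinearMap.fst ℝ _ _).comp (ContinuousLinearMap.snd ℝ _ _)).prod
        ((ContinuousLinearMap.fst ℝ _ _).prod
          ((fderiv ℝ g (baseTrip s)).comp (fderiv ℝ baseTrip s)))) s :=
    (hasFDerivAt_snd.fst).prodMk (_root_.hasFDerivAt_fst.prodMk h0)
  have h2 := (((hg.contDiffAt_dualFun hs.2).differentiableAt (by norm_num)).hasFDerivAt.comp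
    (f := fun s : Par n => ((s.2.1, s.1, g (baseTrip s)) : Trip n)) s h1).fderiv
  change fderiv ℝ (levelZ Γ g) s = _ at h2
  rw [h2]
  have h3 := hg.fderiv_dualFun ht η ξ (fderiv ℝ g (baseTrip s) (baseTrip (ξ, η, 0, 0)))
  change fderiv ℝ (dualFun Γ g) (s.2.1, s.1, g (levelTrip Γ g s)) _ = _ at h3
  rw [levelTrip_val hs] at h3
  simp only [ContinuousLinearMap.comp_apply, ContinuousLinearMap.prod_apply,
    ContinuousLinearMap.coe_fst', ContinuousLinearMap.coe_snd', fderiv_baseTrip]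
  refine h3.trans ?_
  have h4 : baseTrip ((ξ, η, 0, 0) : Par n) = (ξ, 0, 0) := rfl
  rw [h4, ← inner_gxF (hg.differentiableAt hs.1)]
  have h5 := hg.smul_levelGrad hs
  have h6 := congrArg (fun v => ⟪v, ξ⟫_ℝ) h5
  simp only [inner_sub_left, real_inner_smul_left] at h6
  rw [show mapQF g (levelTrip Γ g s) = -((gzF g (levelTrip Γ g s))⁻¹ • gyF g (levelTrip Γ g s))
    from rfl, inner_neg_left, real_inner_smul_left]
  have h7 : ((levelTrip Γ g s).1, (levelTrip Γ g s).2.1, levelZ Γ g s) = levelTrip Γ g s := rfl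
  change (gzF g (levelTrip Γ g s))⁻¹ * (_ - ⟪gxF g (levelTrip Γ g s), ξ⟫_ℝ
    - ⟪gyF g (levelTrip Γ g s), η⟫_ℝ) = _
  field_simp
  linarith

theorem contDiffAt_levelGrad (hg : IsGeneratingFunction Γ g) (hs : s ∈ levelDom Γ g) :
    ContDiffAt ℝ 1 (levelGrad Γ g) s := by
  have ht := levelTrip_mem hs
  have h1 : ContDiffAt ℝ 1 (levelTrip Γ g) s := (hg.contDiffAt_levelTrip hs).of_le (by norm_num)
  have h2 : ContDiffAt ℝ 1 (baseTrip (n := n)) s :=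
    contDiff_baseTrip.contDiffAt.of_le (by norm_num)
  exact ((ContDiffAt.comp s (hg.contDiffAt_gzF ht) h1).neg.inv
    (neg_ne_zero.2 (hg.gzF_neg ht).ne)).smul
    ((ContDiffAt.comp (g := gxF g) s (hg.contDiffAt_gxF ht) h1).sub
      (ContDiffAt.comp (g := gxF g) s (hg.contDiffAt_gxF hs.1) h2))

/-- The derivative of the factor (-g_z)⁻¹ only contributes a multiple of the gradient itself. Its
value is never needed, since it disappears in directions orthogonal to the gradient and where the
gradient vanishes. -/
theorem fderiv_levelGrad (hg : IsGeneratingFunction Γ g) (hs : s ∈ levelDom Γ g) (v : Par n) :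
    ∃ k : ℝ, fderiv ℝ (levelGrad Γ g) s v
      = (-gzF g (levelTrip Γ g s))⁻¹ • (fderiv ℝ (gxF g) (levelTrip Γ g s)
          (v.1, v.2.1, fderiv ℝ (levelZ Γ g) s v)
        - fderiv ℝ (gxF g) (baseTrip s) (baseTrip v)) + k • levelGrad Γ g s := by
  have ht := levelTrip_mem hs
  have hz := (hg.gzF_neg ht).ne
  have hZ := ((hg.contDiffAt_levelZ hs).differentiableAt (by norm_num)).hasFDerivAt
  have hT : HasFDerivAt (levelTrip Γ g) ((ContinuousLinearMap.fst ℝ _ _).prod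
      (((ContinuousLinearMap.fst ℝ _ _).comp (ContinuousLinearMap.snd ℝ _ _)).prod
        (fderiv ℝ (levelZ Γ g) s))) s :=
    _root_.hasFDerivAt_fst.prodMk (hasFDerivAt_snd.fst.prodMk hZ)
  have hB : DifferentiableAt ℝ (fun s => (-gzF g (levelTrip Γ g s))⁻¹) s := by
    have h1 : ContDiffAt ℝ 1 (levelTrip Γ g) s := (hg.contDiffAt_levelTrip hs).of_le (by norm_num)
    exact ((ContDiffAt.comp s (hg.contDiffAt_gzF ht) h1).neg.inv
      (neg_ne_zero.2 hz)).differentiableAt (by norm_num)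
  have hD := (HasFDerivAt.comp s (hg.hasFDerivAt_gxF ht) hT).sub
    (HasFDerivAt.comp s (hg.hasFDerivAt_gxF hs.1)
      (contDiff_baseTrip.differentiable (by norm_num) s).hasFDerivAt)
  have h1 := (hB.hasFDerivAt.smul hD).fderiv
  change fderiv ℝ (levelGrad Γ g) s = _ at h1
  refine ⟨fderiv ℝ (fun s => (-gzF g (levelTrip Γ g s))⁻¹) s v * (-gzF g (levelTrip Γ g s)), ?_⟩
  rw [h1, mul_smul, ← hg.smul_levelGrad hs]
  simp [fderiv_baseTrip]

theorem inner_fderiv_levelGrad (hg : IsGeneratingFunction Γ g) (hs : s ∈ levelDom Γ g) {ξ : Vec n}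
    (hξ : ⟪levelGrad Γ g s, ξ⟫_ℝ = 0) :
    ⟪fderiv ℝ (levelGrad Γ g) s (ξ, 0, 0, 0), ξ⟫_ℝ = (-gzF g (levelTrip Γ g s))⁻¹ *
      (⟪gxx g s.1 s.2.1 (levelZ Γ g s) ξ, ξ⟫_ℝ - ⟪gxx g s.1 s.2.2.1 s.2.2.2 ξ, ξ⟫_ℝ) := by
  obtain ⟨k, hk⟩ := hg.fderiv_levelGrad hs (ξ, 0, 0, 0)
  have h1 := hg.fderiv_levelZ hs ξ 0
  rw [hξ, inner_zero_right, add_zero] at h1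
  rw [hk, inner_add_left, real_inner_smul_left, real_inner_smul_left, hξ, mul_zero, add_zero,
    inner_sub_left, h1, hg.gxx_apply (levelTrip_mem hs), hg.gxx_apply hs.1]
  rfl

theorem fderiv_levelGrad_snd (hg : IsGeneratingFunction Γ g) {x y : Vec n} {z : ℝ}
    (h : (x, y, z) ∈ Γ) (η : Vec n) :
    (x, y, y, z) ∈ levelDom Γ g ∧ levelTrip Γ g (x, y, y, z) = (x, y, z) ∧
      levelGrad Γ g (x, y, y, z) = 0 ∧
      fderiv ℝ (levelGrad Γ g) (x, y, y, z) (0, η, 0, 0)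
        = (-gzF g (x, y, z))⁻¹ • linE g (x, y, z) η := by
  have hs : (x, y, y, z) ∈ levelDom Γ g := ⟨h, mem_dualDomain h⟩
  have hT : levelTrip Γ g (x, y, y, z) = (x, y, z) := by
    simp only [levelTrip, levelZ, baseTrip, hg.dualFun_eq h]
  have hG : levelGrad Γ g (x, y, y, z) = 0 := by
    rw [levelGrad, hT]; simp [baseTrip]
  refine ⟨hs, hT, hG, ?_⟩
  obtain ⟨k, hk⟩ := hg.fderiv_levelGrad hs (0, η, 0, 0)
  have h4 : baseTrip ((0, η, 0, 0) : Par n) = 0 := rfl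
  rw [hk, hG, smul_zero, add_zero, hg.fderiv_levelZ hs, hG, hT, inner_zero_left, zero_add, h4,
    map_zero, sub_zero, linE_apply]

end IsGeneratingFunction

end Level

end GenFun

/-! ### A3s as a Jensen inequality for the Hessians of level functions. -/

namespace GenFun

variable {n : ℕ}

/-- On the hyperplane orthogonal to ξ all differences of momenta are admissible, so A3s says exactly
that subtracting δ|ξ|²|q|² leaves a convex function. Convexity of U keeps the segments inside. -/
theorem convexOn_of_A3s_ineq {Γ : Set (Trip n)} {g : Trip n → ℝ} {U : Set (Jet n)} {δ : ℝ}
    (hU : Convex ℝ U)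
    (hA : ∀ (x₀ : Vec n) (u₀ : ℝ) (p₀ p₁ : Vec n), SegIn U x₀ u₀ p₀ p₁ →
      ∀ ξ : Vec n, ⟪ξ, p₁ - p₀⟫_ℝ = 0 → ∀ θ ∈ Icc (0 : ℝ) 1,
        ⟪matA Γ g x₀ u₀ (pt p₀ p₁ θ) ξ, ξ⟫_ℝ ≤ (1 - θ) * ⟪matA Γ g x₀ u₀ p₀ ξ, ξ⟫_ℝ
            + θ * ⟪matA Γ g x₀ u₀ p₁ ξ, ξ⟫_ℝ - δ * θ * (1 - θ) * ‖p₁ - p₀‖ ^ 2 * ‖ξ‖ ^ 2)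
    (x : Vec n) (u : ℝ) (pb ξ : Vec n) :
    ConvexOn ℝ {q : Vec n | ⟪q, ξ⟫_ℝ = 0 ∧ (x, u, pb + q) ∈ U} fun q =>
      ⟪matA Γ g x u (pb + q) ξ, ξ⟫_ℝ - ⟪matA Γ g x u pb ξ, ξ⟫_ℝ - δ * ‖ξ‖ ^ 2 * ‖q‖ ^ 2 := by
  have hcomb : ∀ (q q' : Vec n) (a b : ℝ), a + b = 1 →
      ((x, u, pb + (a • q + b • q')) : Jet n) = a • (x, u, pb + q) + b • (x, u, pb + q') := by
    intro q q' a b hab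
    simp only [Prod.smul_mk, Prod.mk_add_mk, Prod.mk.injEq, smul_add, ← add_smul, smul_eq_mul,
      ← add_mul, hab, one_smul, one_mul, true_and]
    rw [add_add_add_comm, ← add_smul, hab, one_smul]
  refine ⟨?_, ?_⟩
  · rintro q ⟨hq, hqU⟩ q' ⟨hq', hqU'⟩ a b ha hb hab
    refine ⟨?_, ?_⟩
    · rw [inner_add_left, real_inner_smul_left, real_inner_smul_left, hq, hq']; simp
    · rw [hcomb q q' a b hab]
      exact hU hqU hqU' ha hb hab
  · rintro q ⟨hq, hqU⟩ q' ⟨hq', hqU'⟩ a b ha hb hab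
    have hseg : SegIn U x u (pb + q) (pb + q') := by
      rintro p ⟨a, b, ha, hb, hab, rfl⟩
      have h1 := hU hqU hqU' ha hb hab
      rw [← hcomb q q' a b hab] at h1
      convert h1 using 3
      rw [smul_add, smul_add, add_add_add_comm, ← add_smul, hab, one_smul]
    have hd : pb + q' - (pb + q) = q' - q := by abel
    have h1 := hA x u _ _ hseg ξ (by
      rw [hd, inner_sub_right, real_inner_comm, hq', real_inner_comm, hq, sub_zero]) b
      ⟨hb, by linarith⟩
    have ha' : 1 - b = a := by linarith
    have hpt : pt (pb + q) (pb + q') b = pb + (a • q + b • q') := by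
      rw [pt, ha', smul_add, smul_add, add_add_add_comm, ← add_smul, hab, one_smul]
    rw [hpt, hd, ha'] at h1
    have h2 : ‖a • q + b • q'‖ ^ 2 = a * ‖q‖ ^ 2 + b * ‖q'‖ ^ 2 - a * b * ‖q' - q‖ ^ 2 := by
      rw [← real_inner_self_eq_norm_sq, ← real_inner_self_eq_norm_sq, ← real_inner_self_eq_norm_sq,
        ← real_inner_self_eq_norm_sq]
      simp only [inner_add_left, inner_add_right, real_inner_smul_left, real_inner_smul_right,
        inner_sub_left, inner_sub_right, real_inner_comm q' q]
      rw [← ha']; ring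
    simp only [smul_eq_mul]
    rw [h2]
    have h3 : ⟪matA Γ g x u pb ξ, ξ⟫_ℝ = a * ⟪matA Γ g x u pb ξ, ξ⟫_ℝ
        + b * ⟪matA Γ g x u pb ξ, ξ⟫_ℝ := by rw [← add_mul, hab, one_mul]
    linarith

theorem ConvexOn.map_sum_le_of_zero {C : Set (Vec n)} {K : Vec n → ℝ} (hK : ConvexOn ℝ C K)
    (h0 : (0 : Vec n) ∈ C) (hK0 : K 0 = 0) {c : Fin n → ℝ} {q : Fin n → Vec n}
    (hc : ∀ i, 0 ≤ c i) (hs : ∑ i, c i ≤ 1) (hq : ∀ i, q i ∈ C) :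
    K (∑ i, c i • q i) ≤ ∑ i, c i * K (q i) := by
  have h1 := hK.map_add_sum_le (t := Finset.univ) (w := c) (p := q) (v := 1 - ∑ i, c i) (q := 0)
    (fun i _ => hc i) (by ring) (fun i _ => hq i) (by linarith) h0
  simpa [hK0] using h1

/-- The jet of `g (·, y, z)` at a point of a level set. -/
noncomputable def levelJet (Γ : Set (Trip n)) (g : Trip n → ℝ) (s : Par n) : Jet n :=
  (s.1, g (baseTrip s), gxF g (levelTrip Γ g s))

theorem matA_levelJet {Γ : Set (Trip n)} {g : Trip n → ℝ} (h1 : A1 Γ g) {s : Par n}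
    (hs : s ∈ levelDom Γ g) :
    matA Γ g s.1 (g (baseTrip s)) (gxF g (levelTrip Γ g s)) = gxx g s.1 s.2.1 (levelZ Γ g s) := by
  obtain ⟨hy, hz⟩ := h1.mapYZ_eq (x := s.1) (y := s.2.1) (z := levelZ Γ g s) (levelTrip_mem hs)
    (levelTrip_val hs) rfl
  rw [matA]
  change gxx g s.1 (mapY Γ g s.1 (g (baseTrip s)) (gx g s.1 s.2.1 (levelZ Γ g s)))
    (mapZ Γ g s.1 (g (baseTrip s)) (gx g s.1 s.2.1 (levelZ Γ g s))) = _
  rw [hy, hz]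

/-- The momentum at y is p̄ + B m with B = -g_z, and in directions orthogonal to m the Hessian of
the level function is the difference of the two A's divided by B. Jensen is applied to the B m with
weights cᵢ B(y)/B(yᵢ), the remaining weight going to q = 0. As B varies by at most a factor 2, the
requirement Σ cᵢ ≤ 1/2 keeps the total weight below 1. -/
theorem IsGeneratingFunction.level_hess_le {Γ : Set (Trip n)} {g : Trip n → ℝ}
    (hg : IsGeneratingFunction Γ g) (h1 : A1 Γ g) {U : Set (Jet n)} {δ : ℝ} (hU : Convex ℝ U)
    (hA : ∀ (x₀ : Vec n) (u₀ : ℝ) (p₀ p₁ : Vec n), SegIn U x₀ u₀ p₀ p₁ →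
      ∀ ξ : Vec n, ⟪ξ, p₁ - p₀⟫_ℝ = 0 → ∀ θ ∈ Icc (0 : ℝ) 1,
        ⟪matA Γ g x₀ u₀ (pt p₀ p₁ θ) ξ, ξ⟫_ℝ ≤ (1 - θ) * ⟪matA Γ g x₀ u₀ p₀ ξ, ξ⟫_ℝ
            + θ * ⟪matA Γ g x₀ u₀ p₁ ξ, ξ⟫_ℝ - δ * θ * (1 - θ) * ‖p₁ - p₀‖ ^ 2 * ‖ξ‖ ^ 2)
    {x y yb : Vec n} {zb : ℝ} {ys : Fin n → Vec n}
    (hb : (x, yb, zb) ∈ Γ ∧ (x, g (x, yb, zb), gxF g (x, yb, zb)) ∈ U)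
    (hy : (x, y, yb, zb) ∈ levelDom Γ g)
    (hys : ∀ i, (x, ys i, yb, zb) ∈ levelDom Γ g ∧ levelJet Γ g (x, ys i, yb, zb) ∈ U ∧
      -gzF g (levelTrip Γ g (x, y, yb, zb)) ≤ 2 * -gzF g (levelTrip Γ g (x, ys i, yb, zb)))
    {c : Fin n → ℝ} (hc : ∀ i, 0 ≤ c i) (hcs : ∑ i, c i ≤ 1 / 2)
    (hm : levelGrad Γ g (x, y, yb, zb) = ∑ i, c i • levelGrad Γ g (x, ys i, yb, zb)) {ξ : Vec n}
    (hξ : ∀ i, ⟪levelGrad Γ g (x, ys i, yb, zb), ξ⟫_ℝ = 0) :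
    ⟪fderiv ℝ (levelGrad Γ g) (x, y, yb, zb) (ξ, 0, 0, 0), ξ⟫_ℝ
      ≤ ∑ i, c i * ⟪fderiv ℝ (levelGrad Γ g) (x, ys i, yb, zb) (ξ, 0, 0, 0), ξ⟫_ℝ
        - δ * (∑ i, c i * (-gzF g (levelTrip Γ g (x, ys i, yb, zb))
            * ‖levelGrad Γ g (x, ys i, yb, zb)‖ ^ 2)
          - -gzF g (levelTrip Γ g (x, y, yb, zb)) * ‖levelGrad Γ g (x, y, yb, zb)‖ ^ 2)
          * ‖ξ‖ ^ 2 := by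
  set u := g (x, yb, zb) with hu
  set pb := gxF g (x, yb, zb) with hpb
  set K : Vec n → ℝ := fun q =>
    ⟪matA Γ g x u (pb + q) ξ, ξ⟫_ℝ - ⟪matA Γ g x u pb ξ, ξ⟫_ℝ - δ * ‖ξ‖ ^ 2 * ‖q‖ ^ 2 with hK
  set C : Set (Vec n) := {q : Vec n | ⟪q, ξ⟫_ℝ = 0 ∧ (x, u, pb + q) ∈ U} with hC
  have hconv : ConvexOn ℝ C K := convexOn_of_A3s_ineq hU hA x u pb ξ
  set B : Vec n → ℝ := fun y => -gzF g (levelTrip Γ g (x, y, yb, zb)) with hB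
  set m : Vec n → Vec n := fun y => levelGrad Γ g (x, y, yb, zb) with hmd
  have hBp : ∀ y, (x, y, yb, zb) ∈ levelDom Γ g → 0 < B y := fun y hy => by
    have := hg.gzF_neg (levelTrip_mem hy)
    simp only [hB]; linarith
  have hq : ∀ y, (x, y, yb, zb) ∈ levelDom Γ g →
      gxF g (levelTrip Γ g (x, y, yb, zb)) = pb + B y • m y := by
    intro y hy
    have h2 := hg.smul_levelGrad hy
    rw [← h2]; simp [hpb, baseTrip]
  have hmA : ∀ y, (x, y, yb, zb) ∈ levelDom Γ g → ⟪m y, ξ⟫_ℝ = 0 →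
      ⟪fderiv ℝ (levelGrad Γ g) (x, y, yb, zb) (ξ, 0, 0, 0), ξ⟫_ℝ
        = (B y)⁻¹ * K (B y • m y) + δ * (B y * ‖m y‖ ^ 2) * ‖ξ‖ ^ 2 := by
    intro y hy hmy
    have hBy := hBp y hy
    have h2 := matA_levelJet h1 hy
    rw [hq y hy] at h2
    have h3 : matA Γ g x u pb = gxx g x yb zb := by
      obtain ⟨e1, e2⟩ := h1.mapYZ_eq hb.1 rfl rfl
      rw [matA, hu, hpb]
      change gxx g x (mapY Γ g x (g (x, yb, zb)) (gx g x yb zb))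
        (mapZ Γ g x (g (x, yb, zb)) (gx g x yb zb)) = _
      rw [e1, e2]
    rw [hg.inner_fderiv_levelGrad hy hmy]
    simp only [hK]
    rw [h3]
    change (B y)⁻¹ * (⟪gxx g x y (levelZ Γ g (x, y, yb, zb)) ξ, ξ⟫_ℝ - ⟪gxx g x yb zb ξ, ξ⟫_ℝ) = _
    change matA Γ g x u (pb + B y • m y) = gxx g x y (levelZ Γ g (x, y, yb, zb)) at h2
    rw [h2, norm_smul, Real.norm_of_nonneg hBy.le]
    field_simp
    ring
  have hmy : ⟪m y, ξ⟫_ℝ = 0 := by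
    simp only [hmd, hm, sum_inner, real_inner_smul_left, hξ, mul_zero, Finset.sum_const_zero]
  have hmem : ∀ i, B (ys i) • m (ys i) ∈ C := by
    intro i
    refine ⟨by rw [real_inner_smul_left]; simp only [hmd, hξ, mul_zero], ?_⟩
    rw [← hq _ (hys i).1]
    exact (hys i).2.1
  have h0 : (0 : Vec n) ∈ C := ⟨inner_zero_left _, by rw [add_zero]; exact hb.2⟩
  have hK0 : K 0 = 0 := by simp [hK]
  have hBy := hBp y hy
  have hlam : ∑ i, c i * (B y / B (ys i)) ≤ 1 := by
    calc ∑ i, c i * (B y / B (ys i)) ≤ ∑ i, c i * 2 := by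
          refine Finset.sum_le_sum fun i _ => mul_le_mul_of_nonneg_left ?_ (hc i)
          rw [div_le_iff₀ (hBp _ (hys i).1)]
          exact (hys i).2.2
      _ ≤ 1 := by rw [← Finset.sum_mul]; linarith
  have hJ := (ConvexOn.map_sum_le_of_zero hconv h0 hK0
    (c := fun i => c i * (B y / B (ys i))) (q := fun i => B (ys i) • m (ys i))
    (fun i => mul_nonneg (hc i) (div_nonneg hBy.le (hBp _ (hys i).1).le)) hlam hmem)
  have hsum : ∑ i, (c i * (B y / B (ys i))) • B (ys i) • m (ys i) = B y • m y := by
    have : m y = ∑ i, c i • m (ys i) := hm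
    rw [this, Finset.smul_sum]
    refine Finset.sum_congr rfl fun i _ => ?_
    have := (hBp _ (hys i).1).ne'
    rw [smul_smul, smul_smul]
    congr 1
    field_simp
  rw [hsum] at hJ
  rw [hmA y hy hmy]
  have hR : ∑ i, c i * ⟪fderiv ℝ (levelGrad Γ g) (x, ys i, yb, zb) (ξ, 0, 0, 0), ξ⟫_ℝ
      = (B y)⁻¹ * ∑ i, c i * (B y / B (ys i)) * K (B (ys i) • m (ys i))
        + δ * (∑ i, c i * (B (ys i) * ‖m (ys i)‖ ^ 2)) * ‖ξ‖ ^ 2 := by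
    rw [Finset.mul_sum, Finset.mul_sum, Finset.sum_mul, ← Finset.sum_add_distrib]
    refine Finset.sum_congr rfl fun i _ => ?_
    rw [hmA _ (hys i).1 (hξ i)]
    have := (hBp _ (hys i).1).ne'
    field_simp
  rw [hR]
  have h5 := mul_le_mul_of_nonneg_left hJ (inv_nonneg.2 hBy.le)
  change _ ≤ _ - δ * (∑ i, c i * (B (ys i) * ‖m (ys i)‖ ^ 2) - B y * ‖m y‖ ^ 2) * ‖ξ‖ ^ 2
  linarith

end GenFun

/-! ### Existence of local models with uniform constants. -/

namespace GenFun

variable {n : ℕ}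

/-- The affine embedding `(x, η) ↦ (x, ȳ + Λ η, ȳ, z̄)` into the parameter space. -/
noncomputable def parAt (Λ : Vec n →L[ℝ] Vec n) (yb : Vec n) (zb : ℝ) (p : Vec n × Vec n) : Par n :=
  (p.1, yb + Λ p.2, yb, zb)

theorem hasFDerivAt_parAt (Λ : Vec n →L[ℝ] Vec n) (yb : Vec n) (zb : ℝ) (p : Vec n × Vec n) :
    HasFDerivAt (parAt Λ yb zb) ((ContinuousLinearMap.fst ℝ (Vec n) (Vec n)).prod
      ((Λ.comp (ContinuousLinearMap.snd ℝ (Vec n) (Vec n))).prod 0)) p :=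
  hasFDerivAt_fst.prodMk
    (((Λ.hasFDerivAt.comp p hasFDerivAt_snd).const_add yb).prodMk (hasFDerivAt_const _ _))

theorem contDiff_parAt (Λ : Vec n →L[ℝ] Vec n) (yb : Vec n) (zb : ℝ) :
    ContDiff ℝ 2 (parAt Λ yb zb) :=
  contDiff_fst.prodMk ((contDiff_const.add (Λ.contDiff.comp contDiff_snd)).prodMk contDiff_const)

section

variable {Γ : Set (Trip n)} {g : Trip n → ℝ}

theorem hasFDerivAt_levelZ_parAt (hg : IsGeneratingFunction Γ g) {Λ : Vec n →L[ℝ] Vec n}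
    {yb : Vec n} {zb : ℝ} {p : Vec n × Vec n} (hs : parAt Λ yb zb p ∈ levelDom Γ g) :
    HasFDerivAt (fun p => levelZ Γ g (parAt Λ yb zb p))
      ((innerSL ℝ (levelGrad Γ g (parAt Λ yb zb p))).coprod
        ((innerSL ℝ (mapQF g (levelTrip Γ g (parAt Λ yb zb p)))).comp Λ)) p := by
  have h1 := ((hg.contDiffAt_levelZ hs).differentiableAt (by norm_num)).hasFDerivAt.comp p
    (hasFDerivAt_parAt Λ yb zb p)
  refine h1.congr_fderiv ?_
  refine ContinuousLinearMap.ext fun v => ?_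
  exact hg.fderiv_levelZ hs v.1 (Λ v.2)

theorem fderiv_levelGrad_parAt (hg : IsGeneratingFunction Γ g) {Λ : Vec n →L[ℝ] Vec n}
    {yb : Vec n} {zb : ℝ} {p : Vec n × Vec n} (hs : parAt Λ yb zb p ∈ levelDom Γ g)
    (v : Vec n × Vec n) :
    fderiv ℝ (fun p => levelGrad Γ g (parAt Λ yb zb p)) p v
      = fderiv ℝ (levelGrad Γ g) (parAt Λ yb zb p) (v.1, Λ v.2, 0, 0) := by
  have h1 := (((hg.contDiffAt_levelGrad hs).differentiableAt (by norm_num)).hasFDerivAt.comp p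
    (hasFDerivAt_parAt Λ yb zb p)).fderiv
  change fderiv ℝ (fun p => levelGrad Γ g (parAt Λ yb zb p)) p = _ at h1
  rw [h1]; rfl

theorem compactlyIn_ball {j : Jet n} {ρ ρ' : ℝ} {U : Set (Jet n)} (h : closedBall j ρ ⊆ U)
    (hρ : ρ' ≤ ρ) : CompactlyIn (ball j ρ') U := by
  have h1 : closure (ball j ρ') ⊆ closedBall j ρ :=
    closure_ball_subset_closedBall.trans (closedBall_subset_closedBall hρ)
  exact ⟨(isCompact_closedBall j ρ).of_isClosed_subset isClosed_closure h1, h1.trans h⟩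

/-- In suitable coordinates, the functions `levelZ` form local models near each point. -/
theorem exists_localModel (hg : IsGeneratingFunction Γ g) (h1 : A1 Γ g) (h2 : A2 Γ g)
    (hA : A3s Γ g) {t₀ : Trip n} (ht₀ : t₀ ∈ Γ) {τ : ℝ} (hτ : 0 < τ) (hτ' : τ ≤ 1 / 2) :
    ∃ Λ Λi : Vec n →L[ℝ] Vec n, (∀ v, Λ (Λi v) = v) ∧ ∃ B₀ R r c₀ C₀ : ℝ,
      0 < B₀ ∧ 0 < R ∧ 0 < r ∧ 0 < c₀ ∧ 0 ≤ C₀ ∧ c₀ * r * R ≤ 1 ∧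
      ∀ (xb yb : Vec n) (zb : ℝ), (xb, yb, zb) ∈ ball t₀ R →
        LocalModel (fun x η => levelZ Γ g (parAt Λ yb zb (x, η)))
          (fun p => levelGrad Γ g (parAt Λ yb zb p))
          (fun x => Λ.adjoint (mapQF g (x, yb, zb))) xb R r τ c₀ C₀ ∧
        ∀ x ∈ ball xb R, ∀ η ∈ ball (0 : Vec n) r, parAt Λ yb zb (x, η) ∈ levelDom Γ g ∧
          B₀ / 2 ≤ -gzF g (levelTrip Γ g (parAt Λ yb zb (x, η))) ∧
          -gzF g (levelTrip Γ g (parAt Λ yb zb (x, η))) ≤ 2 * B₀ := by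
  obtain ⟨x₀, y₀, z₀⟩ := t₀
  set B₀ := -gzF g (x₀, y₀, z₀) with hB₀
  have hB₀p : 0 < B₀ := by have := hg.gzF_neg ht₀; linarith
  obtain ⟨L, hL⟩ := hg.exists_linE_equiv h2 ht₀
  -- The derivative of the level gradient in y at the base is B₀⁻¹E, so composing with Λ = B₀E⁻¹
  -- normalises it to the identity.
  set Λ : Vec n →L[ℝ] Vec n := B₀ • (L.symm : Vec n →L[ℝ] Vec n) with hΛ
  set Λi : Vec n →L[ℝ] Vec n := B₀⁻¹ • (L : Vec n →L[ℝ] Vec n) with hΛi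
  set s₀ : Par n := (x₀, y₀, y₀, z₀) with hs₀
  obtain ⟨hsd, hsT, hsG, -⟩ := hg.fderiv_levelGrad_snd ht₀ 0
  have hsE := fun η => (hg.fderiv_levelGrad_snd ht₀ η).2.2.2
  set j₀ : Jet n := (x₀, g (x₀, y₀, z₀), gxF g (x₀, y₀, z₀)) with hj₀
  have hjJ : j₀ ∈ jets Γ g := mem_jets ht₀
  obtain ⟨ρ₁, hρ₁, hball⟩ := Metric.nhds_basis_closedBall.mem_iff.1
    ((hg.isOpen_jets h1 h2).mem_nhds hjJ)
  -- A ball of jets is used because `level_hess_le` needs a convex set.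
  obtain ⟨δ, hδ, hAδ⟩ := hA _ (compactlyIn_ball hball le_rfl)
  set J : Vec n →L[ℝ] Par n := (0 : Vec n →L[ℝ] Vec n).prod (Λ.prod 0) with hJ
  -- conditions valid near the base point
  have hTc : ContinuousAt (levelTrip Γ g) s₀ := (hg.contDiffAt_levelTrip hsd).continuousAt
  have hzc : ContinuousAt (fun s => -gzF g (levelTrip Γ g s)) s₀ := by
    have h3 : ContinuousAt (gzF g) (levelTrip Γ g s₀) := by
      rw [hsT]; exact (hg.contDiffAt_gzF ht₀).continuousAt
    exact (h3.comp hTc).neg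
  have hz0 : -gzF g (levelTrip Γ g s₀) = B₀ := by rw [hsT]
  have e1 : ∀ᶠ s in 𝓝 s₀, s ∈ levelDom Γ g := hg.levelDom_mem_nhds hsd
  have e2 : ∀ᶠ s in 𝓝 s₀, 3 / 4 * B₀ < -gzF g (levelTrip Γ g s) :=
    hzc.eventually_const_lt (by simp only [hz0]; linarith)
  have e3 : ∀ᶠ s in 𝓝 s₀, -gzF g (levelTrip Γ g s) < 3 / 2 * B₀ :=
    hzc.eventually_lt_const (by simp only [hz0]; linarith)
  have e4 : ∀ᶠ s in 𝓝 s₀, ‖(fderiv ℝ (levelGrad Γ g) s).comp J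
      - ContinuousLinearMap.id ℝ (Vec n)‖ < τ := by
    have h3 : ContinuousAt (fderiv ℝ (levelGrad Γ g)) s₀ :=
      (hg.contDiffAt_levelGrad hsd).continuousAt_fderiv (by norm_num)
    refine ((h3.clm_comp continuousAt_const).sub continuousAt_const).norm.eventually_lt_const ?_
    have h4 : (fderiv ℝ (levelGrad Γ g) s₀).comp J - ContinuousLinearMap.id ℝ (Vec n) = 0 := by
      refine ContinuousLinearMap.ext fun η => ?_
      have h5 := hsE (Λ η)
      rw [← hL] at h5
      have h6 : (fderiv ℝ (levelGrad Γ g) s₀).comp J η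
          = fderiv ℝ (levelGrad Γ g) s₀ (0, Λ η, 0, 0) := rfl
      rw [sub_apply, h6, h5]
      simp only [hΛ, smul_apply, map_smul, ContinuousLinearEquiv.coe_coe,
        ContinuousLinearEquiv.apply_symm_apply, smul_smul]
      rw [← hB₀, inv_mul_cancel₀ hB₀p.ne', one_smul]
      simp
    change ‖(fderiv ℝ (levelGrad Γ g) s₀).comp J - ContinuousLinearMap.id ℝ (Vec n)‖ < τ
    rw [h4, norm_zero]; exact hτ
  have e5 : ∀ᶠ s in 𝓝 s₀, levelJet Γ g s ∈ ball j₀ ρ₁ := by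
    have h3 : ContinuousAt (levelJet Γ g) s₀ := by
      have h4 : ContinuousAt (gxF g) (levelTrip Γ g s₀) := by
        rw [hsT]; exact (hg.contDiffAt_gxF ht₀).continuousAt
      have h5 : ContinuousAt (fun s : Par n => g (baseTrip s)) s₀ :=
        ContinuousAt.comp (hg.differentiableAt ht₀).continuousAt
          contDiff_baseTrip.continuous.continuousAt
      exact continuousAt_fst.prodMk (h5.prodMk (h4.comp hTc))
    refine h3.eventually (isOpen_ball.mem_nhds ?_)
    have : levelJet Γ g s₀ = j₀ := by rw [levelJet, hsT]; rfl
    rw [this]; exact mem_ball_self hρ₁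
  obtain ⟨ρ, hρ, hρall⟩ := Metric.eventually_nhds_iff_ball.1
    ((((e1.and e2).and e3).and e4).and e5)
  set c₀ := δ * B₀ / 8 with hc₀
  have hc₀p : 0 < c₀ := by positivity
  set r := ρ / 2 / (‖Λ‖ + 1) with hr
  have hrp : 0 < r := by positivity
  have hΛr : ∀ η ∈ ball (0 : Vec n) r, ‖Λ η‖ < ρ / 2 := by
    intro η hη
    have h3 : ‖η‖ < r := by simpa using hη
    calc ‖Λ η‖ ≤ ‖Λ‖ * ‖η‖ := Λ.le_opNorm η
      _ ≤ (‖Λ‖ + 1) * ‖η‖ := by gcongr; linarith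
      _ < (‖Λ‖ + 1) * r := by gcongr
      _ = ρ / 2 := by rw [hr]; field_simp
  -- The second bound is chosen only to ensure c₀ r R ≤ 1.
  set R := min (ρ / 2) (1 / (c₀ * r)) with hR
  have hRp : 0 < R := lt_min (by positivity) (by positivity)
  have hRρ : R ≤ ρ / 2 := min_le_left _ _
  refine ⟨Λ, Λi, fun v => ?_, B₀, R, r, c₀, 4 * δ * B₀, hB₀p, hRp, hrp, hc₀p, by positivity, ?_,
    fun xb yb zb hbase => ?_⟩
  · simp [hΛ, hΛi, smul_smul, hB₀p.ne']
  · have := min_le_right (ρ / 2) (1 / (c₀ * r))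
    calc c₀ * r * R ≤ c₀ * r * (1 / (c₀ * r)) := by gcongr
      _ = 1 := by field_simp
  rw [← ball_prod_same, ← ball_prod_same] at hbase
  obtain ⟨hxb, hyb, hzb⟩ := hbase
  have hpar : ∀ x ∈ ball xb R, ∀ η ∈ ball (0 : Vec n) r, parAt Λ yb zb (x, η) ∈ ball s₀ ρ := by
    intro x hx η hη
    rw [hs₀, ← ball_prod_same, ← ball_prod_same, ← ball_prod_same]
    have h3 := hΛr η hη
    simp only [mem_ball] at hx hxb hyb hzb
    refine ⟨?_, ?_, ?_, ?_⟩ <;> simp only [parAt, mem_ball]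
    · linarith [dist_triangle x xb x₀]
    · have h4 := dist_triangle (yb + Λ η) yb y₀
      rw [dist_eq_norm (yb + Λ η) yb, add_sub_cancel_left] at h4
      linarith
    · linarith
    · linarith
  have hdom : ∀ x ∈ ball xb R, ∀ η ∈ ball (0 : Vec n) r, parAt Λ yb zb (x, η) ∈ levelDom Γ g :=
    fun x hx η hη => (hρall _ (hpar x hx η hη)).1.1.1.1
  have hz : (0 : Vec n) ∈ ball (0 : Vec n) r := mem_ball_self hrp
  have hpar0 : ∀ x, parAt Λ yb zb (x, 0) = (x, yb, yb, zb) := fun x => by simp [parAt]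
  have hbaseΓ : ∀ x ∈ ball xb R, (x, yb, zb) ∈ Γ := fun x hx => (hdom x hx 0 hz).1
  have hT0 : ∀ x ∈ ball xb R, levelTrip Γ g (parAt Λ yb zb (x, 0)) = (x, yb, zb) := fun x hx => by
    rw [hpar0]; exact (hg.fderiv_levelGrad_snd (hbaseΓ x hx) 0).2.1
  have hnear : ∀ x ∈ ball xb R, ∀ η ∈ ball (0 : Vec n) r, ∀ ζ,
      ‖fderiv ℝ (fun p => levelGrad Γ g (parAt Λ yb zb p)) (x, η) (0, ζ) - ζ‖ ≤ τ * ‖ζ‖ := by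
    intro x hx η hη ζ
    rw [fderiv_levelGrad_parAt hg (hdom x hx η hη)]
    have h3 := ContinuousLinearMap.le_of_opNorm_le _ (hρall _ (hpar x hx η hη)).1.2.le ζ
    exact h3
  have hmod : ∀ c C : ℝ, (∀ x ∈ ball xb R, ∀ y ∈ ball (0 : Vec n) r, ∀ ys : Fin n → Vec n,
    (∀ i, ys i ∈ ball (0 : Vec n) r) → ∀ c' : Fin n → ℝ, (∀ i, 0 ≤ c' i) → ∑ i, c' i ≤ 1 / 2 →
    levelGrad Γ g (parAt Λ yb zb (x, y)) = ∑ i, c' i • levelGrad Γ g (parAt Λ yb zb (x, ys i)) →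
    ∀ ξ, (∀ i, ⟪levelGrad Γ g (parAt Λ yb zb (x, ys i)), ξ⟫_ℝ = 0) →
    ⟪fderiv ℝ (fun p => levelGrad Γ g (parAt Λ yb zb p)) (x, y) (ξ, 0), ξ⟫_ℝ
      ≤ ∑ i, c' i *
        ⟪fderiv ℝ (fun p => levelGrad Γ g (parAt Λ yb zb p)) (x, ys i) (ξ, 0), ξ⟫_ℝ
      - (c * ∑ i, c' i * ‖ys i‖ ^ 2 - C * ‖y‖ ^ 2) * ‖ξ‖ ^ 2) →
      LocalModel (fun x η => levelZ Γ g (parAt Λ yb zb (x, η)))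
          (fun p => levelGrad Γ g (parAt Λ yb zb p))
          (fun x => Λ.adjoint (mapQF g (x, yb, zb))) xb R r τ c C := by
    intro c C hh
    refine ⟨hτ.le, ?_, ?_, ?_, ?_, ?_, hnear, ?_, hh⟩
    · intro η hη x hx
      refine ContDiffAt.contDiffWithinAt ?_
      exact ContDiffAt.comp (f := fun x => parAt Λ yb zb (x, η)) x
        (hg.contDiffAt_levelZ (hdom x hx η hη))
        ((contDiff_parAt Λ yb zb).comp (contDiff_id.prodMk contDiff_const)).contDiffAt
    · intro x hx η hη
      have h3 := (hasFDerivAt_levelZ_parAt hg (hdom x hx η hη)).comp (f := fun x => (x, η)) x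
        (hasFDerivAt_prodMk_left x η)
      refine h3.congr_fderiv ?_
      ext v; simp
    · intro x hx η hη
      exact ContDiffAt.comp (g := levelGrad Γ g) (x, η) (hg.contDiffAt_levelGrad (hdom x hx η hη))
        ((contDiff_parAt Λ yb zb).contDiffAt.of_le (by norm_num))
    · intro x hx
      rw [hpar0]; exact (hg.fderiv_levelGrad_snd (hbaseΓ x hx) 0).2.2.1
    · have h3 : ∀ x ∈ ball xb R, levelZ Γ g (parAt Λ yb zb (x, 0)) = zb := fun x hx => by
        rw [hpar0]; exact hg.dualFun_eq (hbaseΓ x hx)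
      intro x hx x' hx'
      exact (h3 x hx).trans (h3 x' hx').symm
    · intro x hx
      have h3 := (hasFDerivAt_levelZ_parAt hg (hdom x hx 0 hz)).comp (f := fun η => (x, η)) 0
        (hasFDerivAt_prodMk_right x 0)
      refine h3.congr_fderiv ?_
      ext v
      simp [hT0 x hx, ContinuousLinearMap.adjoint_inner_left]
  refine ⟨hmod _ _ ?_, fun x hx η hη => ⟨hdom x hx η hη, ?_, ?_⟩⟩
  · intro x hx η hη ys hys c hc hcs hm ξ hξ
    have hfd : ∀ η ∈ ball (0 : Vec n) r,
        fderiv ℝ (fun p => levelGrad Γ g (parAt Λ yb zb p)) (x, η) (ξ, 0)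
          = fderiv ℝ (levelGrad Γ g) (parAt Λ yb zb (x, η)) (ξ, 0, 0, 0) := by
      intro η hη
      rw [fderiv_levelGrad_parAt hg (hdom x hx η hη)]
      simp
    have hsz : ∀ η ∈ ball (0 : Vec n) r,
        ‖levelGrad Γ g (parAt Λ yb zb (x, η)) - η‖ ≤ τ * ‖η‖ := by
      intro η hη
      have h3 := norm_sub_le_of_fderiv_snd_near (m := fun p => levelGrad Γ g (parAt Λ yb zb p))
        hτ.le (fun z hz => ((hg.contDiffAt_levelGrad (hdom x hx z hz)).differentiableAt
          (by norm_num)).comp (x, z) (hasFDerivAt_parAt Λ yb zb (x, z)).differentiableAt)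
        (hnear x hx) hη hz
      have h4 : levelGrad Γ g (parAt Λ yb zb (x, 0)) = 0 := by
        rw [hpar0]; exact (hg.fderiv_levelGrad_snd (hbaseΓ x hx) 0).2.2.1
      simpa [h4] using h3
    have hB1 := fun η hη => (hρall _ (hpar x hx η hη)).1.1.1.2
    have hB2 := fun η hη => (hρall _ (hpar x hx η hη)).1.1.2
    have hjb : (x, g (x, yb, zb), gxF g (x, yb, zb)) ∈ ball j₀ ρ₁ := by
      have h3 := (hρall _ (hpar x hx 0 hz)).2
      rwa [levelJet, hT0 x hx] at h3
    have key := hg.level_hess_le h1 (convex_ball j₀ ρ₁)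
      (fun a b c d hs => hAδ a b c d fun p hp => hs p hp)
      (y := yb + Λ η) (ys := fun i => yb + Λ (ys i)) ⟨hbaseΓ x hx, hjb⟩ (hdom x hx η hη)
      (fun i => ⟨hdom x hx _ (hys i), (hρall _ (hpar x hx _ (hys i))).2, by
        have f1 := hB1 _ (hys i)
        have f2 := hB2 _ hη
        simp only [parAt] at f1 f2
        linarith⟩) hc hcs hm hξ
    rw [hfd η hη, Finset.sum_congr rfl fun i _ => by rw [hfd _ (hys i)]]
    refine key.trans (sub_le_sub_left (mul_le_mul_of_nonneg_right ?_ (by positivity)) _)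
    -- Passing from |m| to |η| costs a factor 1/2 or 3/2, and from -g_z to B₀ similar factors; this
    -- gives c₀ = δB₀/8 and C₀ = 4δB₀.
    have k1 : B₀ / 8 * ∑ i, c i * ‖ys i‖ ^ 2 ≤ ∑ i, c i *
        (-gzF g (levelTrip Γ g (x, yb + Λ (ys i), yb, zb))
          * ‖levelGrad Γ g (x, yb + Λ (ys i), yb, zb)‖ ^ 2) := by
      rw [Finset.mul_sum]
      refine Finset.sum_le_sum fun i _ => ?_
      have f1 := hB1 _ (hys i)
      have f3 := hsz _ (hys i)
      simp only [parAt] at f1 f3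
      have f4 := norm_le_norm_sub_add (ys i) (levelGrad Γ g (x, yb + Λ (ys i), yb, zb))
      rw [norm_sub_rev (ys i)] at f4
      have f5 : ‖ys i‖ / 2 ≤ ‖levelGrad Γ g (x, yb + Λ (ys i), yb, zb)‖ := by
        have : τ * ‖ys i‖ ≤ 1 / 2 * ‖ys i‖ := by gcongr
        linarith
      have f6 : B₀ / 2 * (‖ys i‖ / 2) ^ 2 ≤ -gzF g (levelTrip Γ g (x, yb + Λ (ys i), yb, zb))
          * ‖levelGrad Γ g (x, yb + Λ (ys i), yb, zb)‖ ^ 2 :=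
        mul_le_mul (by linarith) (pow_le_pow_left₀ (by positivity) f5 2) (by positivity)
          (by linarith)
      have f7 := mul_le_mul_of_nonneg_left f6 (hc i)
      linarith
    have k2 : -gzF g (levelTrip Γ g (x, yb + Λ η, yb, zb))
        * ‖levelGrad Γ g (x, yb + Λ η, yb, zb)‖ ^ 2 ≤ 4 * B₀ * ‖η‖ ^ 2 := by
      have f1 := hB2 _ hη
      have f3 := hsz _ hη
      simp only [parAt] at f1 f3
      have f4 := norm_le_norm_sub_add (levelGrad Γ g (x, yb + Λ η, yb, zb)) η
      have f5 : ‖levelGrad Γ g (x, yb + Λ η, yb, zb)‖ ≤ 3 / 2 * ‖η‖ := by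
        have : τ * ‖η‖ ≤ 1 / 2 * ‖η‖ := by gcongr
        linarith
      have f6 : -gzF g (levelTrip Γ g (x, yb + Λ η, yb, zb))
          * ‖levelGrad Γ g (x, yb + Λ η, yb, zb)‖ ^ 2 ≤ 3 / 2 * B₀ * (3 / 2 * ‖η‖) ^ 2 := by
        gcongr
      have : 0 ≤ B₀ * ‖η‖ ^ 2 := by positivity
      linarith
    have k3 := mul_le_mul_of_nonneg_left (sub_le_sub k1 k2) hδ.le
    refine le_trans (le_of_eq ?_) k3
    rw [hc₀]; ring
  · linarith [(hρall _ (hpar x hx η hη)).1.1.1.2]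
  · linarith [(hρall _ (hpar x hx η hη)).1.1.2]

end

end GenFun

/-! ### The quadratic gap for the generating function. -/

namespace GenFun

variable {n : ℕ}

/-- Near `t₀`, with constant `c`: if `g (·, y, z)` and `g (·, ȳ, z̄)` agree at `x̄`, with gradients
differing by `E e`, then the former is quadratically larger than the latter at the points `x` with
`⟪e, Q x - Q x̄⟫ ≥ 0`. -/
def GapAt (Γ : Set (Trip n)) (g : Trip n → ℝ) (t₀ : Trip n) (ρ c : ℝ) : Prop :=
  ∀ (xb yb : Vec n) (zb : ℝ) (x y : Vec n) (z : ℝ) (e : Vec n), (xb, yb, zb) ∈ ball t₀ ρ →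
    (xb, y, z) ∈ ball t₀ ρ → (x, y, z) ∈ ball t₀ ρ → g (xb, y, z) = g (xb, yb, zb) →
    linE g (xb, yb, zb) e = gxF g (xb, y, z) - gxF g (xb, yb, zb) →
    0 ≤ ⟪e, mapQF g (x, yb, zb) - mapQF g (xb, yb, zb)⟫_ℝ →
    z + c * ‖y - yb‖ ^ 2 * ‖mapQF g (x, yb, zb) - mapQF g (xb, yb, zb)‖ ^ 2
        ≤ dualFun Γ g (y, x, g (x, yb, zb)) ∧
      g (x, yb, zb) + c * ‖gxF g (xb, y, z) - gxF g (xb, yb, zb)‖ ^ 2 * ‖x - xb‖ ^ 2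
        ≤ g (x, y, z)

section

variable {Γ : Set (Trip n)} {g : Trip n → ℝ}

theorem mul_sq_le_of_le {c a p q X Y P S : ℝ} (hc : 0 ≤ c) (hP0 : 0 ≤ P) (hS0 : 0 ≤ S)
    (hp : 0 < p) (hq : 0 < q) (ha : a ≤ c / (p ^ 2 * q ^ 2))
    (hP : P ≤ p * X) (hS : S ≤ q * Y) : a * P ^ 2 * S ^ 2 ≤ c * X ^ 2 * Y ^ 2 := by
  calc a * P ^ 2 * S ^ 2 ≤ c / (p ^ 2 * q ^ 2) * (p * X) ^ 2 * (q * Y) ^ 2 := by gcongr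
    _ = c * X ^ 2 * Y ^ 2 := by field_simp

set_option maxHeartbeats 800000 in
theorem exists_gapAt (hg : IsGeneratingFunction Γ g) (h1 : A1 Γ g) (h2 : A2 Γ g)
    (hA : A3s Γ g) {t₀ : Trip n} (ht₀ : t₀ ∈ Γ) : ∃ ρ > 0, ∃ c > 0, GapAt Γ g t₀ ρ c := by
  set τ : ℝ := 1 / (400 * ((n : ℝ) ^ 2 + 1)) with hτ
  have hτp : 0 < τ := by positivity
  have hτn : τ * n ^ 2 ≤ 1 / 400 := by
    rw [hτ, div_mul_eq_mul_div, one_mul, div_le_div_iff₀ (by positivity) (by norm_num)]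
    nlinarith [sq_nonneg (n : ℝ)]
  have hτ2 : τ ≤ 1 / 2 := by
    rw [hτ, div_le_div_iff₀ (by positivity) (by norm_num)]
    nlinarith [sq_nonneg (n : ℝ)]
  obtain ⟨Λ, Λi, hΛ, B₀, R, r, c₀, C₀, hB₀, hR, hr, hc₀, hC₀, hcR, hmod⟩ :=
    exists_localModel hg h1 h2 hA ht₀ hτp hτ2
  obtain ⟨x₀, y₀, z₀⟩ := t₀
  set b := -gzF g (x₀, y₀, z₀) / 2 with hb
  have hgz := hg.gzF_neg ht₀
  have hbp : 0 < b := by linarith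
  have e1 : ∀ᶠ t in 𝓝 (x₀, y₀, z₀), t ∈ Γ ∧ gzF g t < -b :=
    (hg.isOpen.eventually_mem ht₀).and
      ((hg.contDiffAt_gzF ht₀).continuousAt.eventually_lt_const (by linarith))
  obtain ⟨ρ₂, hρ₂, hball⟩ := Metric.eventually_nhds_iff_ball.1 e1
  obtain ⟨hsd, hsT, -, -⟩ := hg.fderiv_levelGrad_snd ht₀ 0
  have e2 : ∀ᶠ s in 𝓝 ((x₀, y₀, y₀, z₀) : Par n),
      levelTrip Γ g s ∈ ball (x₀, y₀, z₀) ρ₂ := by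
    refine (hg.contDiffAt_levelTrip hsd).continuousAt.eventually (isOpen_ball.mem_nhds ?_)
    rw [hsT]; exact mem_ball_self hρ₂
  obtain ⟨ρ₃, hρ₃, hball'⟩ := Metric.eventually_nhds_iff_ball.1 e2
  set a := ‖Λ‖ + 1 with ha
  set d := 2 * (‖Λi‖ + 1) with hd
  have hap : 0 < a := by positivity
  have hdp : 0 < d := by positivity
  set ρ := min (min ρ₂ ρ₃) (min (R / 16) (r / d)) with hρ
  have hρp : 0 < ρ := lt_min (lt_min hρ₂ hρ₃) (lt_min (by positivity) (by positivity))
  have f1 : ρ ≤ ρ₂ := (min_le_left _ _).trans (min_le_left _ _)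
  have f2 : ρ ≤ ρ₃ := (min_le_left _ _).trans (min_le_right _ _)
  have f3 : ρ ≤ R / 16 := (min_le_right _ _).trans (min_le_left _ _)
  have f4 : ρ * d ≤ r := by
    rw [← le_div_iff₀ hdp]
    exact (min_le_right _ _).trans (min_le_right _ _)
  set c₁ := c₀ / 65536 with hc₁
  have hc₁p : 0 < c₁ := by positivity
  refine ⟨ρ, hρp, min (c₁ / (a ^ 2 * d ^ 2)) (b * c₁ / ((4 * B₀) ^ 2 * 1 ^ 2)),
    lt_min (by positivity) (by positivity), ?_⟩
  intro xb yb zb x y z e hbase hbz hxz hval he hpos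
  have hbase' := hbase
  have hbz' := hbz
  have hxz' := hxz
  rw [← ball_prod_same, ← ball_prod_same] at hbase' hbz' hxz'
  obtain ⟨m1, m2, m3⟩ := hbase'
  obtain ⟨-, m4, m5⟩ := hbz'
  obtain ⟨m6, -, -⟩ := hxz'
  simp only [mem_ball] at m1 m2 m3 m4 m5 m6
  have hbaseΓ : (xb, yb, zb) ∈ Γ := (hball _ (ball_subset_ball f1 hbase)).1
  have hbzΓ : (xb, y, z) ∈ Γ := (hball _ (ball_subset_ball f1 hbz)).1
  obtain ⟨M, hM⟩ := hmod xb yb zb (ball_subset_ball (by linarith) hbase)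
  have hxx : ‖x - xb‖ < R / 8 := by
    rw [← dist_eq_norm]
    linarith [dist_triangle_right x xb x₀]
  have hyy : ‖y - yb‖ < 2 * ρ := by
    rw [← dist_eq_norm]
    linarith [dist_triangle_right y yb y₀]
  set η := Λi (y - yb) with hη
  have hηr : η ∈ ball (0 : Vec n) r := by
    rw [mem_ball_zero_iff]
    calc ‖η‖ ≤ ‖Λi‖ * ‖y - yb‖ := Λi.le_opNorm _
      _ ≤ (‖Λi‖ + 1) * ‖y - yb‖ := by gcongr; linarith
      _ < (‖Λi‖ + 1) * (2 * ρ) := by gcongr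
      _ = ρ * d := by rw [hd]; ring
      _ ≤ r := f4
  have hpar : ∀ x, parAt Λ yb zb (x, η) = (x, y, yb, zb) := fun x => by
    simp [parAt, hη, hΛ]
  have hxbR : xb ∈ ball xb R := mem_ball_self hR
  have hxR8 : x ∈ ball xb (R / 8) := by rwa [mem_ball_iff_norm]
  have hxR : x ∈ ball xb R := ball_subset_ball (by linarith) hxR8
  have hZb : levelZ Γ g (xb, y, yb, zb) = z := hg.dualFun_eq_of_eq hbzΓ hval
  have hTb : levelTrip Γ g (xb, y, yb, zb) = (xb, y, z) := by rw [levelTrip, hZb]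
  have hsb := hM xb hxbR η hηr
  have hsx := hM x hxR η hηr
  rw [hpar] at hsb hsx
  have hB1 : 0 < -gzF g (xb, yb, zb) := by linarith [hg.gzF_neg hbaseΓ]
  have hB2 : 0 < -gzF g (xb, y, z) := by linarith [hg.gzF_neg hbzΓ]
  -- The model normalises gradients by -g_z at the level triple and their linearisation by -g_z at
  -- the base. The ratio k reconciles the two; being positive, it does not affect the half space.
  set k := -gzF g (xb, yb, zb) / -gzF g (xb, y, z) with hk
  have hkp : 0 < k := div_pos hB1 hB2
  have hgrad : gxF g (xb, y, z) - gxF g (xb, yb, zb)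
      = (-gzF g (xb, y, z)) • levelGrad Γ g (xb, y, yb, zb) := by
    have := hg.smul_levelGrad hsb.1
    rwa [hTb] at this
  have hE : fderiv ℝ (fun p => levelGrad Γ g (parAt Λ yb zb p)) (xb, 0) (0, k • Λi e)
      = levelGrad Γ g (parAt Λ yb zb (xb, η)) := by
    have hp0 : parAt Λ yb zb (xb, 0) = (xb, yb, yb, zb) := by simp [parAt]
    have hd0 : parAt Λ yb zb (xb, 0) ∈ levelDom Γ g := by
      rw [hp0]; exact (hg.fderiv_levelGrad_snd hbaseΓ 0).1
    rw [fderiv_levelGrad_parAt hg hd0, hp0, hpar]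
    simp only [map_smul, hΛ]
    rw [(hg.fderiv_levelGrad_snd hbaseΓ (k • e)).2.2.2, map_smul, he, hgrad, smul_smul, smul_smul]
    have hpq : ∀ p q : ℝ, p ≠ 0 → q ≠ 0 → p⁻¹ * (p / q) * q = 1 := fun p q hp hq => by field_simp
    rw [hk, hpq _ _ hB1.ne' hB2.ne', one_smul]
  have hposm : 0 ≤ ⟪k • Λi e, Λ.adjoint (mapQF g (x, yb, zb))
      - Λ.adjoint (mapQF g (xb, yb, zb))⟫_ℝ := by
    rw [← map_sub, ContinuousLinearMap.adjoint_inner_right, map_smul, hΛ, real_inner_smul_left]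
    positivity
  have hgap := M.quadratic_gap hR hr hc₀ hC₀ hτn hcR hxR8 hηr hE hposm
  simp only [hpar] at hgap
  rw [hZb, ← hc₁] at hgap
  have hy1 : ‖y - yb‖ ≤ a * ‖η‖ := by
    have h3 := Λ.le_opNorm η
    rw [hη, hΛ, ← hη] at h3
    refine h3.trans ?_
    gcongr
    linarith
  have hQ1 : ‖mapQF g (x, yb, zb) - mapQF g (xb, yb, zb)‖ ≤ d * ‖x - xb‖ := by
    -- Q of the model is Λ*Q. Invertibility of Λ through Λi converts its bound back to Q.
    set q := mapQF g (x, yb, zb) - mapQF g (xb, yb, zb) with hq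
    have h3 := M.norm_Q_sub_le hr hxR hxbR
    rw [← map_sub, ← hq] at h3
    have h4 : ‖Λ.adjoint q‖ ≤ 2 * ‖x - xb‖ := by
      have := norm_le_norm_sub_add (Λ.adjoint q) (x - xb)
      have := mul_le_mul_of_nonneg_right hτ2 (norm_nonneg (x - xb))
      have := norm_nonneg (x - xb)
      linarith
    have h5 : ‖q‖ ^ 2 ≤ 2 * ‖x - xb‖ * (‖Λi‖ * ‖q‖) := by
      rw [← real_inner_self_eq_norm_sq]
      nth_rw 2 [← hΛ q]
      rw [← ContinuousLinearMap.adjoint_inner_left]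
      refine (real_inner_le_norm _ _).trans ?_
      gcongr
      exact Λi.le_opNorm _
    rcases (norm_nonneg q).eq_or_lt with h6 | h6
    · rw [← h6]; positivity
    · have h7 : ‖q‖ ≤ 2 * ‖x - xb‖ * ‖Λi‖ := le_of_mul_le_mul_right (by linarith) h6
      rw [hd]
      have := norm_nonneg (x - xb)
      linarith
  refine ⟨?_, ?_⟩
  · have h3 := mul_sq_le_of_le hc₁p.le (norm_nonneg (y - yb)) (norm_nonneg _) hap hdp
      (min_le_left _ (b * c₁ / ((4 * B₀) ^ 2 * 1 ^ 2))) hy1 hQ1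
    have h4 : dualFun Γ g (y, x, g (x, yb, zb)) = levelZ Γ g (x, y, yb, zb) := rfl
    rw [h4]
    linarith
  · have hp1 : ‖gxF g (xb, y, z) - gxF g (xb, yb, zb)‖ ≤ 4 * B₀ * ‖η‖ := by
      have h3 := M.grad_near_zero hr hxbR hηr
      simp only [hpar] at h3
      have h4 : ‖levelGrad Γ g (xb, y, yb, zb)‖ ≤ 2 * ‖η‖ := by
        have := norm_le_norm_sub_add (levelGrad Γ g (xb, y, yb, zb)) η
        have := mul_le_mul_of_nonneg_right hτ2 (norm_nonneg η)
        have := norm_nonneg η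
        linarith
      have h5 := hsb.2.2
      rw [hTb] at h5
      rw [hgrad, norm_smul, Real.norm_of_nonneg hB2.le]
      calc _ ≤ 2 * B₀ * (2 * ‖η‖) := by gcongr
        _ = _ := by ring
    have h3 := mul_sq_le_of_le (by positivity : 0 ≤ b * c₁)
      (norm_nonneg (gxF g (xb, y, z) - gxF g (xb, yb, zb))) (norm_nonneg (x - xb))
      (by positivity : 0 < 4 * B₀) one_pos (min_le_right (c₁ / (a ^ 2 * d ^ 2)) _) hp1
      (le_of_eq (one_mul _).symm)
    set W := levelZ Γ g (x, y, yb, zb) with hW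
    have hzW : z ≤ W := by
      have : 0 ≤ c₁ * ‖η‖ ^ 2 * ‖x - xb‖ ^ 2 := by positivity
      linarith
    have hTx : (x, y, W) ∈ ball (x₀, y₀, z₀) ρ₂ := by
      refine hball' (x, y, yb, zb) (ball_subset_ball f2 ?_)
      rw [← ball_prod_same, ← ball_prod_same, ← ball_prod_same]
      exact ⟨m6, m4, m2, m3⟩
    have hseg : ∀ t ∈ Icc z W, (x, y, t) ∈ Γ ∧ gzF g (x, y, t) < -b := by
      intro t ht
      refine hball _ ?_
      have k1 := ball_subset_ball f1 hxz
      rw [← ball_prod_same, ← ball_prod_same] at hTx k1 ⊢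
      refine ⟨k1.1, k1.2.1, ?_⟩
      have k2 := k1.2.2
      have k3 := hTx.2.2
      simp only [Real.ball_eq_Ioo, mem_Ioo] at k2 k3 ⊢
      exact ⟨k2.1.trans_le ht.1, ht.2.trans_lt k3.2⟩
    -- The gap in z becomes a gap in g by integrating g_z < -b from z to W, where g(x,y,W) =
    -- g(x,ȳ,z̄). Both end points lie in a ball on which this bound holds.
    have hder : ∀ t ∈ Icc z W, HasDerivAt (fun t => g (x, y, t) + b * t)
        (gzF g (x, y, t) + b) t := by
      intro t ht
      have k1 := hg.differentiableAt (hseg t ht).1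
      have k2 := HasFDerivAt.partial_thd k1.hasFDerivAt
      rw [← gzF_eq k1] at k2
      exact k2.add (by simpa using (hasDerivAt_id t).const_mul b)
    have hanti := antitoneOn_of_hasDerivWithinAt_nonpos (convex_Icc z W)
      (fun t ht => (hder t ht).continuousAt.continuousWithinAt)
      (fun t ht => (hder t (interior_subset ht)).hasDerivWithinAt)
      (fun t ht => by linarith [(hseg t (interior_subset ht)).2])
    have k3 := hanti (left_mem_Icc.2 hzW) (right_mem_Icc.2 hzW) hzW
    have k4 : g (x, y, W) = g (x, yb, zb) := levelTrip_val hsx.1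
    simp only [k4] at k3
    have k5 : b * (c₁ * ‖η‖ ^ 2 * ‖x - xb‖ ^ 2) ≤ b * (W - z) := by
      gcongr; linarith
    linarith

end

end GenFun

/-! ### Uniform gaps on compact sets and invariance under duality. -/

namespace GenFun

variable {n : ℕ} {Γ : Set (Trip n)} {g : Trip n → ℝ}

theorem GapAt.mono {t t' : Trip n} {ρ ρ' c c' : ℝ} (h : GapAt Γ g t ρ c)
    (hs : ball t' ρ' ⊆ ball t ρ) (hc : c' ≤ c) : GapAt Γ g t' ρ' c' := by
  intro xb yb zb x y z e m1 m2 m3 hv he hp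
  obtain ⟨h1, h2⟩ := h xb yb zb x y z e (hs m1) (hs m2) (hs m3) hv he hp
  constructor
  · refine le_trans ?_ h1
    gcongr
  · refine le_trans ?_ h2
    gcongr

theorem exists_uniform_gapAt (hg : IsGeneratingFunction Γ g) (h1 : A1 Γ g) (h2 : A2 Γ g)
    (hA : A3s Γ g) {K : Set (Trip n)} (hK : IsCompact K) (hKΓ : K ⊆ Γ) :
    ∃ ρ > 0, ∃ c > 0, ∀ t ∈ K, GapAt Γ g t ρ c := by
  refine hK.induction_on (p := fun S => ∃ ρ > 0, ∃ c > 0, ∀ t ∈ S, GapAt Γ g t ρ c)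
    ⟨1, one_pos, 1, one_pos, fun t ht => ht.elim⟩ ?_ ?_ ?_
  · rintro S T hST ⟨ρ, hρ, c, hc, h⟩
    exact ⟨ρ, hρ, c, hc, fun t ht => h t (hST ht)⟩
  · rintro S T ⟨ρ, hρ, c, hc, h⟩ ⟨ρ', hρ', c', hc', h'⟩
    refine ⟨min ρ ρ', lt_min hρ hρ', min c c', lt_min hc hc', fun t ht => ?_⟩
    rcases ht with ht | ht
    · exact (h t ht).mono (ball_subset_ball (min_le_left _ _)) (min_le_left _ _)
    · exact (h' t ht).mono (ball_subset_ball (min_le_right _ _)) (min_le_right _ _)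
  · intro t ht
    obtain ⟨ρ, hρ, c, hc, h⟩ := exists_gapAt hg h1 h2 hA (hKΓ ht)
    refine ⟨ball t (ρ / 2), mem_nhdsWithin_of_mem_nhds (ball_mem_nhds t (by positivity)), ρ / 2,
      by positivity, c, hc, fun t' ht' => h.mono ?_ le_rfl⟩
    refine ball_subset_ball' ?_
    have := mem_ball.1 ht'
    linarith

/-- Points of the dual jet space are points `(y, z, Q)`. -/
theorem dual_mapYZ_spec (hg : IsGeneratingFunction Γ g) {y q : Vec n} {z : ℝ}
    (h : (y, z, q) ∈ jets (dualDomain Γ g) (dualFun Γ g)) :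
    (mapY (dualDomain Γ g) (dualFun Γ g) y z q, y, z) ∈ Γ ∧
      g (mapY (dualDomain Γ g) (dualFun Γ g) y z q, y, z)
        = mapZ (dualDomain Γ g) (dualFun Γ g) y z q ∧
      mapQF g (mapY (dualDomain Γ g) (dualFun Γ g) y z q, y, z) = q := by
  obtain ⟨k1, k2, k3⟩ := mapYZ_spec h
  have k4 := IsGeneratingFunction.dualFun_spec k1
  rw [k2] at k4
  refine ⟨k4.1, k4.2, ?_⟩
  rw [← hg.gxF_dualFun k4.1, k4.2]
  exact k3

/-- With base (x_m,y₀,z₀) at the middle momentum q_m, the other two momenta are q_m ± (q₁ - q₀)/2,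
so one of the corresponding x's lies in the favourable half space for any e. The z-form of the gap
for g at that x is a gap for g* at y. -/
theorem midpointGap_dual (hg : IsGeneratingFunction Γ g) (h1 : A1 Γ g) (h2 : A2 Γ g)
    (h1s : A1star Γ g) (hA : A3s Γ g) : MidpointGap (dualDomain Γ g) (dualFun Γ g) := by
  intro U' hU
  set Γd := dualDomain Γ g with hΓd
  set gd := dualFun Γ g with hgd
  have d1 : A1 Γd gd := hg.dual_A1 h1s
  have d2 : A2 Γd gd := hg.dual_A2 h2
  set T : Jet n → Trip n := fun j => (mapY Γd gd j.1 j.2.1 j.2.2, j.1, j.2.1) with hT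
  have hTc : ContinuousOn T (closure U') := by
    intro j hj
    have k1 := hg.dual.continuousAt_tripOf d1 d2 (hU.2 hj)
    have k2 : ContinuousAt T j :=
      (continuousAt_fst.comp (continuousAt_snd.comp k1)).prodMk
        (Continuous.continuousAt (by fun_prop))
    exact k2.continuousWithinAt
  have hTΓ : ∀ j ∈ closure U', T j ∈ Γ := fun j hj => (dual_mapYZ_spec hg (hU.2 hj)).1
  obtain ⟨ρ, hρ, c, hc, hgap⟩ := exists_uniform_gapAt hg h1 h2 hA (hU.1.image_of_continuousOn hTc)
    (by rintro _ ⟨j, hj, rfl⟩; exact hTΓ j hj)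
  obtain ⟨ℓ, hℓ, hunif⟩ := Metric.uniformContinuousOn_iff.1
    (hU.1.uniformContinuousOn_of_continuous hTc) ρ hρ
  refine ⟨c / 4, by positivity, ℓ, hℓ, fun y₀ z₀ q₀ q₁ hseg hq => ?_⟩
  set qm := pt q₀ q₁ (1 / 2) with hqm
  have hin : ∀ q ∈ segment ℝ q₀ q₁, (y₀, z₀, q) ∈ closure U' := fun q hq =>
    subset_closure (hseg q hq)
  have i0 := hin q₀ (left_mem_segment ℝ _ _)
  have i1 := hin q₁ (right_mem_segment ℝ _ _)
  have im := hin qm (pt_mem_segment _ _ (by norm_num))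
  obtain ⟨a0, b0, c0⟩ := dual_mapYZ_spec hg (hU.2 i0)
  obtain ⟨a1, b1, c1⟩ := dual_mapYZ_spec hg (hU.2 i1)
  obtain ⟨am, bm, cm⟩ := dual_mapYZ_spec hg (hU.2 im)
  have hclose : ∀ q, (y₀, z₀, q) ∈ closure U' → ‖q - qm‖ < ℓ →
      dist (mapY Γd gd y₀ z₀ q) (mapY Γd gd y₀ z₀ qm) < ρ := by
    intro q hqU hqn
    have k1 := hunif _ hqU _ im (by
      rw [Prod.dist_eq, Prod.dist_eq]
      simpa [dist_eq_norm] using hqn)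
    exact (le_max_left _ _).trans_lt k1
  set x0 := mapY Γd gd y₀ z₀ q₀ with hx0
  set x1 := mapY Γd gd y₀ z₀ q₁ with hx1
  set xm := mapY Γd gd y₀ z₀ qm with hxm
  have hG := hgap (xm, y₀, z₀) ⟨_, im, rfl⟩
  have d0 : q₀ - qm = -((1 / 2 : ℝ) • (q₁ - q₀)) := by
    rw [hqm, pt]; module
  have d1' : q₁ - qm = (1 / 2 : ℝ) • (q₁ - q₀) := by
    rw [hqm, pt]; module
  have n0 : ‖q₀ - qm‖ = 1 / 2 * ‖q₁ - q₀‖ := by rw [d0, norm_neg, norm_smul]; norm_num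
  have n1 : ‖q₁ - qm‖ = 1 / 2 * ‖q₁ - q₀‖ := by rw [d1', norm_smul]; norm_num
  have hlt : 1 / 2 * ‖q₁ - q₀‖ < ℓ := by linarith [norm_nonneg (q₁ - q₀)]
  have e0 := hclose q₀ i0 (by rw [n0]; exact hlt)
  have e1 := hclose q₁ i1 (by rw [n1]; exact hlt)
  -- the level function through the midpoint
  have hmd : (y₀, xm, g (xm, y₀, z₀)) ∈ Γd := IsGeneratingFunction.mem_dualDomain am
  have hm0 : gd (y₀, xm, g (xm, y₀, z₀)) = z₀ := hg.dualFun_eq am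
  have ev1 : ∀ᶠ y in 𝓝 y₀, (y, xm, g (xm, y₀, z₀)) ∈ Γd := hg.dual.eventually_mem_fst hmd
  have ev2 : ∀ᶠ y in 𝓝 y₀, gd (y, xm, g (xm, y₀, z₀)) ∈ ball z₀ ρ := by
    have k1 : ContinuousAt (fun y => gd (y, xm, g (xm, y₀, z₀))) y₀ :=
      (hg.dual.hasFDerivAt_fst hmd).continuousAt
    exact k1.eventually (isOpen_ball.mem_nhds (by
      change gd (y₀, xm, g (xm, y₀, z₀)) ∈ _
      rw [hm0]; exact mem_ball_self hρ))
  filter_upwards [ev1, ev2, ball_mem_nhds y₀ hρ] with y f1 f2 f3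
  set z := gd (y, xm, g (xm, y₀, z₀)) with hz
  obtain ⟨f4, f5⟩ := IsGeneratingFunction.dualFun_spec f1
  obtain ⟨L, hL⟩ := hg.exists_linE_equiv h2 am
  -- Here e depends on y, and so does the choice of the end point. The maximum of the two functions
  -- is what makes the conclusion independent of it.
  obtain ⟨e, he⟩ := L.surjective (gxF g (xm, y, z) - gxF g (xm, y₀, z₀))
  rw [hL] at he
  have hmb : ∀ x ∈ ball xm ρ, (x, y, z) ∈ ball (xm, y₀, z₀) ρ := by
    intro x hx
    rw [← ball_prod_same, ← ball_prod_same]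
    exact ⟨hx, f3, f2⟩
  have use : ∀ x q, x ∈ ball xm ρ → mapQF g (x, y₀, z₀) = q → 0 ≤ ⟪e, q - qm⟫_ℝ →
      ‖q - qm‖ = 1 / 2 * ‖q₁ - q₀‖ →
      z + c / 4 * ‖q₁ - q₀‖ ^ 2 * ‖y - y₀‖ ^ 2 ≤ gd (y, x, g (x, y₀, z₀)) := by
    intro x q hx hxq hpos hn
    have k1 := (hG xm y₀ z₀ x y z e (mem_ball_self hρ) (hmb xm (mem_ball_self hρ)) (hmb x hx) f5 he
      (by rwa [hxq, cm])).1
    rw [hxq, cm, hn] at k1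
    refine le_trans (le_of_eq ?_) k1
    ring
  rw [← bm, ← b0, ← b1]
  change z ≤ _
  rcases le_total 0 ⟪e, q₁ - q₀⟫_ℝ with hs | hs
  · have k1 := use x1 q₁ e1 c1 (by rw [d1', real_inner_smul_right]; positivity) n1
    have := le_max_right (gd (y, x0, g (x0, y₀, z₀))) (gd (y, x1, g (x1, y₀, z₀)))
    linarith
  · have k1 := use x0 q₀ e0 c0 (by
      rw [d0, inner_neg_right, real_inner_smul_right]; linarith) n0
    have := le_max_left (gd (y, x0, g (x0, y₀, z₀))) (gd (y, x1, g (x1, y₀, z₀)))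
    linarith

/-- Condition A3s is invariant under duality. -/
theorem A3s_dual_iff (hg : IsGeneratingFunction Γ g) (h1 : A1 Γ g) (h2 : A2 Γ g)
    (h1s : A1star Γ g) : A3s Γ g ↔ A3s (dualDomain Γ g) (dualFun Γ g) := by
  have key : ∀ {Γ : Set (Trip n)} {g : Trip n → ℝ}, IsGeneratingFunction Γ g → A1 Γ g → A2 Γ g →
      A1star Γ g → A3s Γ g → A3s (dualDomain Γ g) (dualFun Γ g) := fun hg h1 h2 h1s hA =>
    A3s_of_midpointGap hg.dual (hg.dual_A1 h1s) (hg.dual_A2 h2) (midpointGap_dual hg h1 h2 h1s hA)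
  -- The converse is the same implication applied to g*. The double dual is only known to equal g on
  -- Γ, hence the use of `A3s_congr`.
  refine ⟨key hg h1 h2 h1s, fun hd => ?_⟩
  have h3 := key hg.dual (hg.dual_A1 h1s) (hg.dual_A2 h2) (hg.dual_A1star h1) hd
  rw [hg.dualDomain_dual] at h3
  exact (A3s_congr hg.isOpen fun t ht => hg.dualFun_dual ht).1 h3

end GenFun

/-! ### A3s and A3s(2). -/

namespace GenFun

variable {n : ℕ} {Γ : Set (Trip n)} {g : Trip n → ℝ}

/-- The quadratic gap, expressed in terms of jets, uniformly on compact sets of jets. -/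
theorem exists_jetGap (hg : IsGeneratingFunction Γ g) (h1 : A1 Γ g) (h2 : A2 Γ g)
    (hA : A3s Γ g) {K : Set (Jet n)} (hK : IsCompact K) (hKU : K ⊆ jets Γ g) :
    ∃ ℓ > 0, ∃ ρ > 0, ∃ c > 0, ∀ (xb : Vec n) (u : ℝ) (p p' : Vec n), (xb, u, p) ∈ K →
      (xb, u, p') ∈ K → ‖p' - p‖ < ℓ → ∀ e,
      linE g (xb, mapY Γ g xb u p, mapZ Γ g xb u p) e = p' - p → ∀ x ∈ ball xb ρ,
      0 ≤ ⟪e, mapQF g (x, mapY Γ g xb u p, mapZ Γ g xb u p)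
        - mapQF g (xb, mapY Γ g xb u p, mapZ Γ g xb u p)⟫_ℝ →
      g (x, mapY Γ g xb u p, mapZ Γ g xb u p) + c * ‖p' - p‖ ^ 2 * ‖x - xb‖ ^ 2
        ≤ g (x, mapY Γ g xb u p', mapZ Γ g xb u p') := by
  have hTc : ContinuousOn (tripOf Γ g) K := fun j hj =>
    (hg.continuousAt_tripOf h1 h2 (hKU hj)).continuousWithinAt
  obtain ⟨ρ, hρ, c, hc, hgap⟩ := exists_uniform_gapAt hg h1 h2 hA (hK.image_of_continuousOn hTc)
    (by rintro _ ⟨j, hj, rfl⟩; exact (mapYZ_spec (hKU hj)).1)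
  obtain ⟨ℓ, hℓ, hunif⟩ := Metric.uniformContinuousOn_iff.1
    (hK.uniformContinuousOn_of_continuous hTc) ρ hρ
  refine ⟨ℓ, hℓ, ρ, hρ, c, hc, fun xb u p p' hp hp' hpp e he x hx hpos => ?_⟩
  obtain ⟨a1, a2, a3⟩ := mapYZ_spec (hKU hp)
  obtain ⟨b1, b2, b3⟩ := mapYZ_spec (hKU hp')
  have hd : tripOf Γ g (xb, u, p') ∈ ball (tripOf Γ g (xb, u, p)) ρ := by
    refine hunif _ hp' _ hp ?_
    rw [Prod.dist_eq, Prod.dist_eq]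
    simpa [dist_eq_norm] using hpp
  have hd' : (x, mapY Γ g xb u p', mapZ Γ g xb u p') ∈ ball (tripOf Γ g (xb, u, p)) ρ := by
    simp only [tripOf, ← ball_prod_same, mem_prod] at hd ⊢
    exact ⟨hx, hd.2⟩
  have := (hgap _ ⟨_, hp, rfl⟩ xb _ _ x _ _ e (mem_ball_self hρ) hd hd' (b2.trans a2.symm)
    (by rw [he]; exact (congrArg₂ (· - ·) b3 a3).symm) hpos).2
  rw [show gxF g (xb, mapY Γ g xb u p', mapZ Γ g xb u p') = p' from b3,
    show gxF g (xb, mapY Γ g xb u p, mapZ Γ g xb u p) = p from a3] at this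
  exact this

section Chain

variable {h : ℝ → ℝ} {b μ : ℝ}

/-- If at every point `h` gains quadratically to one of the sides, for small steps, then a gain to
the right persists until the end point. -/
theorem chain_right (hb : 0 < b)
    (H : ∀ θ ∈ Icc (0 : ℝ) 1, (∀ s, 0 ≤ s → s ≤ μ → θ + s ≤ 1 → h θ + b * s ^ 2 ≤ h (θ + s)) ∨
      (∀ s, 0 ≤ s → s ≤ μ → 0 ≤ θ - s → h θ + b * s ^ 2 ≤ h (θ - s)))
    {k : ℕ} (hk : 0 < k) (hkμ : 1 ≤ μ * k) {θ : ℝ} (hθ : 0 ≤ θ) (hθ1 : θ < 1)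
    (hr : ∀ s, 0 ≤ s → s ≤ μ → θ + s ≤ 1 → h θ + b * s ^ 2 ≤ h (θ + s)) :
    h θ + b / (k : ℝ) ^ 2 * (1 - θ) ^ 2 ≤ h 1 := by
  have hk' : (0 : ℝ) < k := by exact_mod_cast hk
  set s := (1 - θ) / k with hs
  have hs0 : 0 < s := div_pos (by linarith) hk'
  have hsμ : s ≤ μ := by
    rw [hs, div_le_iff₀ hk']; linarith
  have hsk : s * k = 1 - θ := by rw [hs]; field_simp
  have key : ∀ j : ℕ, j < k →
      (∀ s', 0 ≤ s' → s' ≤ μ → θ + j * s + s' ≤ 1 →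
        h (θ + j * s) + b * s' ^ 2 ≤ h (θ + j * s + s')) ∧ h θ + j * (b * s ^ 2) ≤ h (θ + j * s) := by
    intro j
    induction j with
    | zero => intro _; simpa using hr
    | succ j ih =>
      intro hj
      obtain ⟨ih1, ih2⟩ := ih (by omega)
      have hle : ((j : ℝ) + 1) * s ≤ k * s := by
        gcongr; exact_mod_cast hj.le
      have st := ih1 s hs0.le hsμ (by linarith)
      have e1 : θ + ((j + 1 : ℕ) : ℝ) * s = θ + j * s + s := by push_cast; ring
      have hpos : 0 < b * s ^ 2 := by positivity
      rw [e1]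
      refine ⟨?_, by push_cast; linarith⟩
      have hj0 : 0 ≤ (j : ℝ) * s := by positivity
      -- If the new point gained to the left instead, the previous value would exceed the new one,
      -- contrary to the step just made.
      rcases H (θ + j * s + s) ⟨by linarith, by linarith⟩ with h' | h'
      · exact h'
      · exfalso
        have := h' s hs0.le hsμ (by linarith)
        rw [add_sub_cancel_right] at this
        linarith
  obtain ⟨k1, k2⟩ := key (k - 1) (by omega)
  have e2 : ((k - 1 : ℕ) : ℝ) = k - 1 := by
    rw [Nat.cast_sub (by omega)]; simp
  have e3 : θ + ((k - 1 : ℕ) : ℝ) * s + s = 1 := by rw [e2]; linarith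
  have k3 := k1 s hs0.le hsμ e3.le
  rw [e3] at k3
  have k4 : 0 ≤ ((k - 1 : ℕ) : ℝ) * (b * s ^ 2) := by positivity
  have k5 : b / (k : ℝ) ^ 2 * (1 - θ) ^ 2 = b * s ^ 2 := by rw [hs]; field_simp
  linarith

/-- A leftward gain is a rightward one for t ↦ h(1 - t), so the chain reaches one of the end points
in every case. Only one step of the k equal ones is counted, which gives the factor 1/k². -/
theorem chain_max (hb : 0 < b)
    (H : ∀ θ ∈ Icc (0 : ℝ) 1, (∀ s, 0 ≤ s → s ≤ μ → θ + s ≤ 1 → h θ + b * s ^ 2 ≤ h (θ + s)) ∨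
      (∀ s, 0 ≤ s → s ≤ μ → 0 ≤ θ - s → h θ + b * s ^ 2 ≤ h (θ - s)))
    {k : ℕ} (hk : 0 < k) (hkμ : 1 ≤ μ * k) {θ : ℝ} (hθ : θ ∈ Icc (0 : ℝ) 1) :
    h θ ≤ max (h 0) (h 1) - b / (k : ℝ) ^ 2 * (θ * (1 - θ)) ^ 2 := by
  have hbk : 0 ≤ b / (k : ℝ) ^ 2 := by positivity
  have hθ0 := hθ.1
  have hθ1 := hθ.2
  have hm1 : b / (k : ℝ) ^ 2 * (θ * (1 - θ)) ^ 2 ≤ b / (k : ℝ) ^ 2 * (1 - θ) ^ 2 := by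
    gcongr
    nlinarith
  have hm2 : b / (k : ℝ) ^ 2 * (θ * (1 - θ)) ^ 2 ≤ b / (k : ℝ) ^ 2 * θ ^ 2 := by
    gcongr
    nlinarith
  rcases H θ hθ with hr | hl
  · rcases hθ1.eq_or_lt with rfl | hlt
    · simp
    · have := chain_right hb H hk hkμ hθ0 hlt hr
      have := le_max_right (h 0) (h 1)
      linarith
  · rcases hθ0.eq_or_lt with rfl | hlt
    · simp
    · have := chain_right (h := fun t => h (1 - t)) hb (μ := μ) (fun t ht => ?_) hk hkμ
        (θ := 1 - θ) (by linarith) (by linarith) (fun s s0 s1 s2 => ?_)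
      · simp only [sub_sub_cancel, sub_self] at this
        have := le_max_left (h 0) (h 1)
        linarith
      · rcases H (1 - t) ⟨by linarith [ht.2], by linarith [ht.1]⟩ with h' | h'
        · refine Or.inr fun s s0 s1 s2 => ?_
          have := h' s s0 s1 (by linarith)
          rwa [show 1 - t + s = 1 - (t - s) by ring] at this
        · refine Or.inl fun s s0 s1 s2 => ?_
          have := h' s s0 s1 (by linarith)
          rwa [show 1 - t - s = 1 - (t + s) by ring] at this
      · have := hl s s0 s1 (by linarith)
        rw [show θ - s = 1 - (1 - θ + s) by ring] at this
        simpa using this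

end Chain

/-- For fixed x, the vector e_t with E e_t = p₁ - p₀ at the jet of p_t decides by the sign of ⟨e_t,
ΔQ⟩ in which direction t ↦ g(x,y_t,z_t) gains. Uniformity of the gap on the closure of U' fixes the
number k of steps for all segments. -/
theorem A3sTwo_of_A3s (hg : IsGeneratingFunction Γ g) (h1 : A1 Γ g) (h2 : A2 Γ g)
    (hA : A3s Γ g) : A3sTwo Γ g := by
  intro U' hU
  obtain ⟨ℓ, hℓ, ρ, hρ, c, hc, hgap⟩ := exists_jetGap hg h1 h2 hA hU.1 hU.2
  obtain ⟨D, hD⟩ := hU.1.isBounded.exists_norm_le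
  have hDp : ∀ x u p, (x, u, p) ∈ U' → ‖p‖ ≤ D := fun x u p h =>
    ((norm_snd_le _).trans (norm_snd_le _)).trans (hD _ (subset_closure h))
  set M := 2 * |D| + 1 with hM
  have hM0 : 0 < M := by positivity
  set μ := ℓ / (2 * M) with hμ
  have hμ0 : 0 < μ := by positivity
  obtain ⟨k, hk⟩ := exists_nat_gt μ⁻¹
  have hk0 : (0 : ℝ) < k := (inv_pos.2 hμ0).trans hk
  have hkμ : 1 ≤ μ * k := by
    have := mul_lt_mul_of_pos_left hk hμ0
    rw [mul_inv_cancel₀ hμ0.ne'] at this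
    exact this.le
  refine ⟨c / k ^ 2, by positivity, fun x₀ u₀ p₀ p₁ hseg => ?_⟩
  have hin : ∀ θ ∈ Icc (0 : ℝ) 1, (x₀, u₀, pt p₀ p₁ θ) ∈ closure U' := fun θ hθ =>
    subset_closure (hseg _ (pt_mem_segment _ _ hθ))
  have hq : ‖p₁ - p₀‖ < M := by
    have k1 := hDp _ _ _ (hseg _ (right_mem_segment ℝ _ _))
    have k2 := hDp _ _ _ (hseg _ (left_mem_segment ℝ _ _))
    have := norm_sub_le p₁ p₀
    have := le_abs_self D
    linarith
  set y : ℝ → Vec n := fun θ => mapY Γ g x₀ u₀ (pt p₀ p₁ θ) with hy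
  set z : ℝ → ℝ := fun θ => mapZ Γ g x₀ u₀ (pt p₀ p₁ θ) with hz
  have hspec := fun θ (hθ : θ ∈ Icc (0 : ℝ) 1) => mapYZ_spec (hU.2 (hin θ hθ))
  -- Compactness of [0,1] gives one neighbourhood of x₀ valid for all θ.
  have htube : ∀ᶠ x in 𝓝 x₀, ∀ θ ∈ Icc (0 : ℝ) 1, (x, y θ, z θ) ∈ Γ := by
    refine isCompact_Icc.eventually_forall_of_forall_eventually fun θ hθ => ?_
    have hp : ContinuousAt (fun t : ℝ => ((x₀, u₀, pt p₀ p₁ t) : Jet n)) θ := by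
      unfold pt
      fun_prop
    have k1 : ContinuousAt (fun t : ℝ => tripOf Γ g (x₀, u₀, pt p₀ p₁ t)) θ :=
      ContinuousAt.comp (f := fun t : ℝ => ((x₀, u₀, pt p₀ p₁ t) : Jet n))
        (hg.continuousAt_tripOf h1 h2 (hU.2 (hin θ hθ))) hp
    have k2 : ContinuousAt (fun w : Vec n × ℝ => ((w.1, y w.2, z w.2) : Trip n)) (x₀, θ) :=
      continuousAt_fst.prodMk
        (ContinuousAt.comp (f := Prod.snd) (g := fun t => (y t, z t)) k1.snd continuousAt_snd)
    exact k2.eventually (hg.isOpen.mem_nhds (hspec θ hθ).1)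
  have e0 : pt p₀ p₁ 0 = p₀ := by simp [pt]
  have e1 : pt p₀ p₁ 1 = p₁ := by simp [pt]
  obtain ⟨N, hN, hNo, hxN⟩ := _root_.mem_nhds_iff.1 (htube.and (ball_mem_nhds x₀ hρ))
  refine ⟨N, hNo, hxN, fun x hx θ hθ => ⟨(hN hx).1 θ hθ, ?_⟩⟩
  have hxρ : x ∈ ball x₀ ρ := (hN hx).2
  rcases eq_or_ne x x₀ with rfl | hxx
  · have k1 := (hspec θ hθ).2.1
    have k2 := (hspec 0 (by simp)).2.1
    rw [e0] at k2
    rw [k1, k2]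
    simp
  rcases eq_or_ne p₁ p₀ with rfl | hpp
  · have : pt p₁ p₁ θ = p₁ := by unfold pt; module
    simp [this]
  have hn1 : 0 < ‖x - x₀‖ := norm_pos_iff.2 (sub_ne_zero.2 hxx)
  have hn2 : 0 < ‖p₁ - p₀‖ := norm_pos_iff.2 (sub_ne_zero.2 hpp)
  have hch := chain_max (h := fun θ => g (x, y θ, z θ)) (μ := μ)
    (b := c * ‖p₁ - p₀‖ ^ 2 * ‖x - x₀‖ ^ 2) (by positivity) (fun t ht => ?_)
    (by exact_mod_cast hk0) hkμ hθ
  · simp only [hy, hz, e0, e1] at hch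
    refine hch.trans (le_of_eq ?_)
    ring
  · obtain ⟨L, hL⟩ := hg.exists_linE_equiv h2 (hspec t ht).1
    set e := L.symm (p₁ - p₀) with he
    have hLe : linE g (x₀, y t, z t) e = p₁ - p₀ := by
      rw [← hL, he, L.apply_symm_apply]
    have use : ∀ s t', t' ∈ Icc (0 : ℝ) 1 → |s| ≤ μ → t' = t + s →
        0 ≤ ⟪s • e, mapQF g (x, y t, z t) - mapQF g (x₀, y t, z t)⟫_ℝ →
        g (x, y t, z t) + c * ‖p₁ - p₀‖ ^ 2 * ‖x - x₀‖ ^ 2 * s ^ 2 ≤ g (x, y t', z t') := by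
      rintro s t' ht' hs rfl hpos
      have hd : pt p₀ p₁ (t + s) - pt p₀ p₁ t = s • (p₁ - p₀) := by unfold pt; module
      have hdn : ‖pt p₀ p₁ (t + s) - pt p₀ p₁ t‖ = |s| * ‖p₁ - p₀‖ := by
        rw [hd, norm_smul, Real.norm_eq_abs]
      have := hgap x₀ u₀ _ _ (hin t ht) (hin _ ht') (by
        rw [hdn]
        calc |s| * ‖p₁ - p₀‖ ≤ μ * M := by gcongr
          _ = ℓ / 2 := by rw [hμ]; field_simp
          _ < ℓ := by linarith) (s • e) (by rw [map_smul, hd]; exact congrArg _ hLe) x hxρ hpos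
      rw [hdn, mul_pow, sq_abs] at this
      refine le_trans (le_of_eq ?_) this
      ring
    rcases le_total 0 ⟪e, mapQF g (x, y t, z t) - mapQF g (x₀, y t, z t)⟫_ℝ with hs | hs
    · refine Or.inl fun s s0 s1 s2 => ?_
      refine use s (t + s) ⟨by linarith [ht.1], s2⟩ (by rwa [abs_of_nonneg s0]) rfl ?_
      rw [real_inner_smul_left]; positivity
    · refine Or.inr fun s s0 s1 s2 => ?_
      have := use (-s) (t - s) ⟨s2, by linarith [ht.2]⟩ (by rwa [abs_neg, abs_of_nonneg s0])
        (sub_eq_add_neg _ _) (by rw [real_inner_smul_left]; nlinarith)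
      rwa [neg_sq] at this

theorem A3s_of_A3sTwo (hg : IsGeneratingFunction Γ g) (h1 : A1 Γ g) (h2 : A2 Γ g)
    (hA : A3sTwo Γ g) : A3s Γ g := by
  refine A3s_of_midpointGap hg h1 h2 fun U' hU => ?_
  obtain ⟨δ, hδ, H⟩ := hA U' hU
  -- At θ = 1/2 the factor (θ(1 - θ))² is 1/16. The length restriction is not needed, so 1 is
  -- arbitrary.
  refine ⟨δ / 16, by positivity, 1, one_pos, fun x₀ u₀ p₀ p₁ hseg _ => ?_⟩
  obtain ⟨N, hNo, hxN, hN⟩ := H x₀ u₀ p₀ p₁ hseg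
  filter_upwards [hNo.mem_nhds hxN] with x hx
  refine (hN x hx (1 / 2) (by norm_num)).2.trans (le_of_eq ?_)
  ring

end GenFun

/-! ### Charts by Q, sections near the base point, and A3s(1) implies A3s. -/

namespace GenFun

variable {n : ℕ} {Γ : Set (Trip n)} {g : Trip n → ℝ}

namespace IsGeneratingFunction

theorem exists_mapQ_equiv (hg : IsGeneratingFunction Γ g) (h2 : A2 Γ g) {x y : Vec n} {z : ℝ}
    (h : (x, y, z) ∈ Γ) : ∃ D : Vec n ≃L[ℝ] Vec n,
      HasStrictFDerivAt (fun x' => mapQF g (x', y, z)) (D : Vec n →L[ℝ] Vec n) x ∧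
      ∀ ξ e, ⟪D ξ, e⟫_ℝ = -(gzF g (x, y, z))⁻¹ * ⟪linE g (x, y, z) e, ξ⟫_ℝ := by
  set M : Vec n →L[ℝ] Vec n :=
    (fderiv ℝ (mapQF g) (x, y, z)).comp (ContinuousLinearMap.inl ℝ (Vec n) (Vec n × ℝ)) with hM
  have hMi : ∀ ξ e, ⟪M ξ, e⟫_ℝ = -(gzF g (x, y, z))⁻¹ * ⟪linE g (x, y, z) e, ξ⟫_ℝ := fun ξ e => by
    rw [← hg.inner_fderiv_mapQF_fst h]
    simp [hM, Prod.mk_zero_zero]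
  obtain ⟨L, hL⟩ := hg.exists_linE_equiv h2 h
  have hinj : Function.Injective M := by
    refine (injective_iff_map_eq_zero _).2 fun ξ hξ => ?_
    have := hMi ξ (L.symm ξ)
    rw [hξ, inner_zero_left, ← hL, L.apply_symm_apply, eq_comm, mul_eq_zero] at this
    exact inner_self_eq_zero.1 (this.resolve_left (neg_ne_zero.2 (inv_ne_zero (hg.gzF_neg h).ne)))
  refine ⟨(LinearEquiv.ofInjectiveEndo (M : Vec n →ₗ[ℝ] Vec n) hinj).toContinuousLinearEquiv,
    ?_, hMi⟩
  have hC : ContDiffAt ℝ 1 (fun x' => mapQF g (x', y, z)) x :=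
    ContDiffAt.comp x (f := fun x' => ((x', y, z) : Trip n)) (hg.contDiffAt_mapQF h)
      (contDiffAt_id.prodMk contDiffAt_const)
  exact hC.hasStrictFDerivAt' (f' := M) (HasFDerivAt.partial_fst
    ((hg.contDiffAt_mapQF h).differentiableAt (by norm_num)).hasFDerivAt) (by norm_num)

/-- The map `Q (·, y, z)` as a local chart. -/
theorem exists_mapQ_chart (hg : IsGeneratingFunction Γ g) (h2 : A2 Γ g) {x y : Vec n} {z : ℝ}
    (h : (x, y, z) ∈ Γ) : ∃ Φ : OpenPartialHomeomorph (Vec n) (Vec n), x ∈ Φ.source ∧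
      (∀ x' ∈ Φ.source, (x', y, z) ∈ Γ) ∧ ∀ x', Φ x' = mapQF g (x', y, z) := by
  obtain ⟨D, hD, -⟩ := hg.exists_mapQ_equiv h2 h
  have ho : IsOpen {x' : Vec n | (x', y, z) ∈ Γ} :=
    hg.isOpen.preimage (Continuous.prodMk_left ((y, z) : Vec n × ℝ))
  refine ⟨(hD.toOpenPartialHomeomorph _).restrOpen _ ho,
    ⟨hD.mem_toOpenPartialHomeomorph_source, h⟩, fun x' hx' => hx'.2, fun x' => rfl⟩

theorem hasFDerivAt_chart_symm (hg : IsGeneratingFunction Γ g) (h2 : A2 Γ g) {y : Vec n} {z : ℝ}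
    {Φ : OpenPartialHomeomorph (Vec n) (Vec n)} (hΓ : ∀ x' ∈ Φ.source, (x', y, z) ∈ Γ)
    (hΦ : ∀ x', Φ x' = mapQF g (x', y, z)) {w : Vec n} (hw : w ∈ Φ.target) :
    ∃ X : Vec n ≃L[ℝ] Vec n, HasFDerivAt Φ.symm (X : Vec n →L[ℝ] Vec n) w ∧
      ∀ v e, ⟪linE g (Φ.symm w, y, z) e, X v⟫_ℝ = -gzF g (Φ.symm w, y, z) * ⟪e, v⟫_ℝ := by
  have hs := hΓ _ (Φ.map_target hw)
  obtain ⟨D, hD, hDi⟩ := hg.exists_mapQ_equiv h2 hs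
  refine ⟨D.symm, Φ.hasFDerivAt_symm hw ?_, fun v e => ?_⟩
  · rw [show (Φ : Vec n → Vec n) = fun x' => mapQF g (x', y, z) from funext hΦ]
    exact hD.hasFDerivAt
  · have := hDi (D.symm v) e
    rw [D.apply_symm_apply] at this
    have hz := (hg.gzF_neg hs).ne
    rw [real_inner_comm v e, this]
    field_simp

end IsGeneratingFunction

theorem eventually_segIn {U : Set (Jet n)} (hU : IsOpen U) {x₀ : Vec n} {u₀ : ℝ} {p₀ p₁ : Vec n}
    (h : SegIn U x₀ u₀ p₀ p₁) : ∀ᶠ x in 𝓝 x₀, SegIn U x u₀ p₀ p₁ := by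
  have hc : IsCompact (segment ℝ p₀ p₁) := by
    rw [segment_eq_image]
    exact isCompact_Icc.image (by fun_prop)
  refine hc.eventually_forall_of_forall_eventually fun p hp => ?_
  have k : Continuous fun w : Vec n × Vec n => ((w.1, u₀, w.2) : Jet n) := by fun_prop
  exact k.continuousAt.eventually (hU.mem_nhds (h p hp))

/-- The domain conditions in the section are open and hold at x₀, so near x₀ only the sign of the
defining function matters. -/
theorem eventually_mem_section_iff (hg : IsGeneratingFunction Γ g) (h1 : A1 Γ g) (h2 : A2 Γ g)
    {x₀ : Vec n} {u₀ : ℝ} {p₀ p₁ : Vec n} (h : SegIn (jets Γ g) x₀ u₀ p₀ p₁) (δ : ℝ) :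
    ∀ᶠ x in 𝓝 x₀, x ∈ sectionS Γ g x₀ u₀ p₀ p₁ 1 δ ↔ hfun Γ g x₀ u₀ p₀ p₁ 1 δ x < 0 := by
  have e1 : pt p₀ p₁ 1 = p₁ := by simp [pt]
  filter_upwards [eventually_segIn (hg.isOpen_jets h1 h2) h,
    hg.eventually_mem_fst (mapYZ_spec (h _ (left_mem_segment ℝ _ _))).1,
    hg.eventually_mem_fst (mapYZ_spec (h _ (right_mem_segment ℝ _ _))).1] with x k1 k2 k3
  rw [sectionS, e1]
  exact ⟨fun k => k.2.2.2, fun k => ⟨k1, k2, k3, k⟩⟩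

theorem hfun_one (Γ : Set (Trip n)) (g : Trip n → ℝ) (x₀ : Vec n) (u₀ : ℝ) (p₀ p₁ : Vec n)
    (δ : ℝ) (x : Vec n) : hfun Γ g x₀ u₀ p₀ p₁ 1 δ x
      = g (x, mapY Γ g x₀ u₀ p₁, mapZ Γ g x₀ u₀ p₁) - g (x, mapY Γ g x₀ u₀ p₀, mapZ Γ g x₀ u₀ p₀)
        - δ / 2 * ‖p₁ - p₀‖ ^ 2 * ‖x - x₀‖ ^ 2 := by
  rw [hfun, show pt p₀ p₁ 1 = p₁ by simp [pt]]

theorem IsGeneratingFunction.hasFDerivAt_hfun_one (hg : IsGeneratingFunction Γ g) {x₀ : Vec n}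
    {u₀ : ℝ} {p₀ p₁ : Vec n} {δ : ℝ} {x : Vec n}
    (m0 : (x, mapY Γ g x₀ u₀ p₀, mapZ Γ g x₀ u₀ p₀) ∈ Γ)
    (m1 : (x, mapY Γ g x₀ u₀ p₁, mapZ Γ g x₀ u₀ p₁) ∈ Γ) :
    HasFDerivAt (hfun Γ g x₀ u₀ p₀ p₁ 1 δ)
      (innerSL ℝ (gx g x (mapY Γ g x₀ u₀ p₁) (mapZ Γ g x₀ u₀ p₁)
        - gx g x (mapY Γ g x₀ u₀ p₀) (mapZ Γ g x₀ u₀ p₀)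
        - (δ * ‖p₁ - p₀‖ ^ 2) • (x - x₀))) x := by
  have k := ((hg.hasFDerivAt_fst m1).sub (hg.hasFDerivAt_fst m0)).sub
    ((((hasFDerivAt_id x).sub_const x₀).norm_sq).const_mul (δ / 2 * ‖p₁ - p₀‖ ^ 2))
  rw [show hfun Γ g x₀ u₀ p₀ p₁ 1 δ = _ from funext (hfun_one Γ g x₀ u₀ p₀ p₁ δ)]
  refine k.congr_fderiv ?_
  ext ξ
  simp
  ring

/-- A convex section, whose boundary passes through `x₀`, lies on one side of its tangent
hyperplane in the coordinates `Q`. -/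
theorem eventually_inner_nonpos_of_section (hg : IsGeneratingFunction Γ g) (h1 : A1 Γ g)
    (h2 : A2 Γ g) (h1s : A1star Γ g) {x₀ : Vec n} {u₀ : ℝ} {p₀ p₁ : Vec n} {δ : ℝ}
    (h : SegIn (jets Γ g) x₀ u₀ p₀ p₁)
    (hloc : LocallyGConvexAt Γ g (sectionS Γ g x₀ u₀ p₀ p₁ 1 δ) x₀
      (mapY Γ g x₀ u₀ p₀) (mapZ Γ g x₀ u₀ p₀)) {e : Vec n}
    (he : linE g (x₀, mapY Γ g x₀ u₀ p₀, mapZ Γ g x₀ u₀ p₀) e = p₁ - p₀) :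
    ∀ᶠ x in 𝓝 x₀, x ∈ sectionS Γ g x₀ u₀ p₀ p₁ 1 δ →
      ⟪e, mapQF g (x, mapY Γ g x₀ u₀ p₀, mapZ Γ g x₀ u₀ p₀)
        - mapQF g (x₀, mapY Γ g x₀ u₀ p₀, mapZ Γ g x₀ u₀ p₀)⟫_ℝ ≤ 0 := by
  obtain ⟨N, hNo, hxN, hNΓ, hconv⟩ := hloc
  obtain ⟨a1, a2, a3⟩ := mapYZ_spec (h _ (left_mem_segment ℝ _ _))
  obtain ⟨b1, b2, b3⟩ := mapYZ_spec (h _ (right_mem_segment ℝ _ _))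
  have hev := eventually_mem_section_iff hg h1 h2 h δ
  have hF := hg.hasFDerivAt_hfun_one (δ := δ) a1 b1
  rw [a3, b3, sub_self, smul_zero, sub_zero] at hF
  have hF0 : hfun Γ g x₀ u₀ p₀ p₁ 1 δ x₀ = 0 := by
    rw [hfun_one, a2, b2]; simp
  set S := sectionS Γ g x₀ u₀ p₀ p₁ 1 δ with hS
  set F := hfun Γ g x₀ u₀ p₀ p₁ 1 δ with hFd
  set y := mapY Γ g x₀ u₀ p₀ with hy
  set z := mapZ Γ g x₀ u₀ p₀ with hz
  have hx0 : x₀ ∉ S := fun hx => by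
    have := hev.self_of_nhds.1 hx
    linarith
  filter_upwards [hNo.mem_nhds hxN] with x hxN' hxS
  by_contra! hpos
  obtain ⟨Φ, hΦ0, hΦΓ, hΦ⟩ := hg.exists_mapQ_chart h2 a1
  have hw : mapQF g (x₀, y, z) ∈ Φ.target := by rw [← hΦ]; exact Φ.map_source hΦ0
  have hsymm : Φ.symm (mapQF g (x₀, y, z)) = x₀ := by rw [← hΦ]; exact Φ.left_inv hΦ0
  obtain ⟨X, hX, hXi⟩ := hg.hasFDerivAt_chart_symm h2 hΦΓ hΦ hw
  rw [hsymm] at hXi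
  set Q₀ := mapQF g (x₀, y, z) with hQ₀
  set v := mapQF g (x, y, z) - Q₀ with hv
  have hline : HasDerivAt (fun t : ℝ => Q₀ + t • (-v)) (-v) 0 := by
    simpa using ((hasDerivAt_id (0 : ℝ)).smul_const (-v)).const_add Q₀
  have hl0 : Q₀ + (0 : ℝ) • (-v) = Q₀ := by simp
  have hγ : HasDerivAt (fun t : ℝ => Φ.symm (Q₀ + t • (-v))) (X (-v)) 0 :=
    HasFDerivAt.comp_hasDerivAt (0 : ℝ) (l := Φ.symm) (l' := (X : Vec n →L[ℝ] Vec n))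
      (by rw [hl0]; exact hX) hline
  have hFγ : HasDerivAt (fun t : ℝ => F (Φ.symm (Q₀ + t • (-v)))) (⟪p₁ - p₀, X (-v)⟫_ℝ) 0 :=
    HasFDerivAt.comp_hasDerivAt (0 : ℝ) (l := F) (f := fun t : ℝ => Φ.symm (Q₀ + t • (-v)))
      (l' := innerSL ℝ (p₁ - p₀)) (by simp only [hl0, hsymm]; exact hF) hγ
  -- If x lay on the wrong side, moving from Q₀ in the direction opposite to x would decrease the
  -- defining function and so enter the section.
  have hneg : ⟪p₁ - p₀, X (-v)⟫_ℝ < 0 := by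
    rw [← he, hXi, inner_neg_right]
    nlinarith [mul_pos (neg_pos.2 (hg.gzF_neg a1)) hpos]
  have hev1 : ∀ᶠ t in 𝓝[>] (0 : ℝ), F (Φ.symm (Q₀ + t • (-v))) < 0 := by
    have k1 := (hasDerivAt_iff_tendsto_slope.1 hFγ).eventually (gt_mem_nhds hneg)
    have k2 := nhdsWithin_mono (0 : ℝ) (fun t (ht : 0 < t) => (ne_of_gt ht : t ≠ 0)) k1
    filter_upwards [k2, self_mem_nhdsWithin] with t ht (ht0 : 0 < t)
    change slope _ 0 t < 0 at ht
    rw [slope_def_field, hl0, hsymm, hF0, sub_zero, sub_zero, div_neg_iff] at ht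
    rcases ht with ht | ht
    · linarith [ht.2]
    · exact ht.1
  have hγc : Tendsto (fun t : ℝ => Φ.symm (Q₀ + t • (-v))) (𝓝 0) (𝓝 x₀) := by
    have := hγ.continuousAt.tendsto
    rwa [hl0, hsymm] at this
  have hlc : Tendsto (fun t : ℝ => Q₀ + t • (-v)) (𝓝 0) (𝓝 Q₀) := by
    have := hline.continuousAt.tendsto
    rwa [hl0] at this
  have hev2 : ∀ᶠ t in 𝓝 (0 : ℝ), (Φ.symm (Q₀ + t • (-v)) ∈ S ↔ F (Φ.symm (Q₀ + t • (-v))) < 0) ∧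
      Φ.symm (Q₀ + t • (-v)) ∈ N ∧ Q₀ + t • (-v) ∈ Φ.target :=
    (hγc.eventually hev).and ((hγc.eventually (hNo.mem_nhds hxN)).and
      (hlc.eventually (Φ.open_target.mem_nhds hw)))
  obtain ⟨t, ⟨ht1, ⟨ht2, ht3, ht4⟩⟩, ht0⟩ :=
    ((hev1.and (hev2.filter_mono nhdsWithin_le_nhds)).and self_mem_nhdsWithin).exists
  have ht0' : 0 < t := ht0
  have hQt : mapQF g (Φ.symm (Q₀ + t • (-v)), y, z) = Q₀ + t • (-v) := by
    rw [← hΦ, Φ.right_inv ht4]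
  -- These weights make Q₀ the convex combination of the two image points. Convexity and A1* then
  -- put x₀ itself in the section, although the defining function vanishes there.
  have hmem := hconv ⟨_, ⟨ht2.2 ht1, ht3⟩, hQt⟩ ⟨x, ⟨hxS, hxN'⟩, rfl⟩
    (a := 1 / (1 + t)) (b := t / (1 + t)) (by positivity) (by positivity) (by field_simp)
  obtain ⟨x', ⟨hx'S, hx'N⟩, hx'⟩ := hmem
  have hx'0 : mapQ g x' y z = mapQ g x₀ y z := by
    refine hx'.trans ?_
    change _ • _ + (t / (1 + t)) • mapQF g (x, y, z) = Q₀
    rw [show mapQF g (x, y, z) = Q₀ + v by rw [hv]; abel]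
    have e1 : (1 / (1 + t)) • (Q₀ + t • (-v)) + (t / (1 + t)) • (Q₀ + v)
        = (1 / (1 + t) + t / (1 + t)) • Q₀ + (t / (1 + t) - 1 / (1 + t) * t) • v := by module
    rw [e1, show 1 / (1 + t) + t / (1 + t) = 1 by field_simp,
      show t / (1 + t) - 1 / (1 + t) * t = 0 by ring, one_smul, zero_smul, add_zero]
  have := h1s y z (hNΓ x' ⟨hx'S, hx'N⟩) a1 hx'0
  exact hx0 (this ▸ hx'S)

/-- The sections from p_m to p₀ and to p₁ lie in opposite closed half spaces in the coordinates Q. A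
point violating the midpoint gap would be interior to both, making ⟨Q,e⟩ locally constant there and
contradicting the invertibility of Q_x. -/
theorem A3s_of_A3sOne (hg : IsGeneratingFunction Γ g) (h1 : A1 Γ g) (h2 : A2 Γ g)
    (h1s : A1star Γ g) (hA : A3sOne Γ g) : A3s Γ g := by
  refine A3s_of_midpointGap hg h1 h2 fun U' hU => ?_
  obtain ⟨δ, hδ, H⟩ := hA U' hU
  -- Both half segments have length |p₁ - p₀|/2, and (δ/2)(1/2)² = δ/8.
  refine ⟨δ / 8, by positivity, 1, one_pos, fun x₀ u₀ p₀ p₁ hseg _ => ?_⟩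
  rcases eq_or_ne p₁ p₀ with rfl | hpp
  · have : pt p₁ p₁ (1 / 2) = p₁ := by unfold pt; module
    refine Eventually.of_forall fun x => ?_
    rw [this]
    simp
  have hm := pt_mem_segment p₀ p₁ (θ := 1 / 2) (by norm_num)
  set pm := pt p₀ p₁ (1 / 2) with hpm
  have s0 : SegIn U' x₀ u₀ pm p₀ := hseg.sub hm (left_mem_segment ℝ _ _)
  have s1 : SegIn U' x₀ u₀ pm p₁ := hseg.sub hm (right_mem_segment ℝ _ _)
  have j0 : SegIn (jets Γ g) x₀ u₀ pm p₀ := fun p hp => hU.2 (subset_closure (s0 p hp))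
  have j1 : SegIn (jets Γ g) x₀ u₀ pm p₁ := fun p hp => hU.2 (subset_closure (s1 p hp))
  have d0 : p₀ - pm = -((1 / 2 : ℝ) • (p₁ - p₀)) := by rw [hpm, pt]; module
  have d1 : p₁ - pm = (1 / 2 : ℝ) • (p₁ - p₀) := by rw [hpm, pt]; module
  have n0 : ‖p₀ - pm‖ = 1 / 2 * ‖p₁ - p₀‖ := by rw [d0, norm_neg, norm_smul]; norm_num
  have n1 : ‖p₁ - pm‖ = 1 / 2 * ‖p₁ - p₀‖ := by rw [d1, norm_smul]; norm_num
  have mm := (mapYZ_spec (j0 _ (left_mem_segment ℝ _ _))).1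
  have m0 := (mapYZ_spec (j0 _ (right_mem_segment ℝ _ _))).1
  have m1 := (mapYZ_spec (j1 _ (right_mem_segment ℝ _ _))).1
  obtain ⟨L, hL⟩ := hg.exists_linE_equiv h2 mm
  set e := L.symm (p₁ - pm) with he
  have hLe : linE g (x₀, mapY Γ g x₀ u₀ pm, mapZ Γ g x₀ u₀ pm) e = p₁ - pm := by
    rw [← hL, he, L.apply_symm_apply]
  have hLe' : linE g (x₀, mapY Γ g x₀ u₀ pm, mapZ Γ g x₀ u₀ pm) (-e) = p₀ - pm := by
    rw [map_neg, hLe, d0, d1]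
  have he0 : e ≠ 0 := by
    intro h0
    rw [h0, map_zero, d1, eq_comm, smul_eq_zero, sub_eq_zero] at hLe
    exact hLe.elim (by norm_num) hpp
  have ev := (((eventually_mem_section_iff hg h1 h2 j0 δ).and
    (eventually_mem_section_iff hg h1 h2 j1 δ)).and
    ((eventually_inner_nonpos_of_section hg h1 h2 h1s j0 (H _ _ _ _ s0) hLe').and
    (eventually_inner_nonpos_of_section hg h1 h2 h1s j1 (H _ _ _ _ s1) hLe))).and
    ((hg.eventually_mem_fst mm).and ((hg.eventually_mem_fst m0).and (hg.eventually_mem_fst m1)))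
  filter_upwards [ev.eventually_nhds] with x hx
  have hxx := hx.self_of_nhds
  by_contra! hcon
  have l0 := (le_max_left (g (x, mapY Γ g x₀ u₀ p₀, mapZ Γ g x₀ u₀ p₀))
    (g (x, mapY Γ g x₀ u₀ p₁, mapZ Γ g x₀ u₀ p₁)))
  have l1 := (le_max_right (g (x, mapY Γ g x₀ u₀ p₀, mapZ Γ g x₀ u₀ p₀))
    (g (x, mapY Γ g x₀ u₀ p₁, mapZ Γ g x₀ u₀ p₁)))
  have neg0 : hfun Γ g x₀ u₀ pm p₀ 1 δ x < 0 := by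
    rw [hfun_one, n0]; nlinarith
  have neg1 : hfun Γ g x₀ u₀ pm p₁ 1 δ x < 0 := by
    rw [hfun_one, n1]; nlinarith
  have c0 := (hg.hasFDerivAt_hfun_one (δ := δ) hxx.2.1 hxx.2.2.1).continuousAt
  have c1 := (hg.hasFDerivAt_hfun_one (δ := δ) hxx.2.1 hxx.2.2.2).continuousAt
  have hzero : ∀ᶠ x' in 𝓝 x, ⟪mapQF g (x', mapY Γ g x₀ u₀ pm, mapZ Γ g x₀ u₀ pm), e⟫_ℝ
      = ⟪mapQF g (x₀, mapY Γ g x₀ u₀ pm, mapZ Γ g x₀ u₀ pm), e⟫_ℝ := by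
    filter_upwards [hx, c0.eventually (gt_mem_nhds neg0), c1.eventually (gt_mem_nhds neg1)]
      with x' hx' k0 k1
    have r0 := hx'.1.2.1 (hx'.1.1.1.2 k0)
    have r1 := hx'.1.2.2 (hx'.1.1.2.2 k1)
    rw [inner_neg_left, inner_sub_right] at r0
    rw [inner_sub_right] at r1
    rw [real_inner_comm, real_inner_comm (_ : Vec n) e] at *
    linarith
  obtain ⟨D, hD, -⟩ := hg.exists_mapQ_equiv h2 hxx.2.1
  have hd1 := hD.hasFDerivAt.inner ℝ (hasFDerivAt_const e x)
  have hd2 := hd1.congr_of_eventuallyEq (f₁ := fun _ =>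
    ⟪mapQF g (x₀, mapY Γ g x₀ u₀ pm, mapZ Γ g x₀ u₀ pm), e⟫_ℝ) (hzero.mono fun _ h => h.symm)
  have hd3 := congrArg (fun T : Vec n →L[ℝ] ℝ => T (D.symm e))
    (hd2.unique (hasFDerivAt_const _ x))
  have : ⟪e, e⟫_ℝ = 0 := by simpa using hd3
  exact he0 (inner_self_eq_zero.1 this)

end GenFun

/-! ### A3s implies A3s(1). -/

namespace GenFun

variable {n : ℕ} {Γ : Set (Trip n)} {g : Trip n → ℝ}

/-- Comparison of second derivatives of two functions with parallel gradients, along a curve on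
which the first has a maximum and the second a minimum. -/
theorem hessian_le_along_curve {E : Type*} [NormedAddCommGroup E] [InnerProductSpace ℝ E]
    {P₁ P₂ : E → ℝ} {G₁ G₂ : E → E} {H₁ H₂ : E →L[ℝ] E} {x ξ : E} {θ : ℝ} (hθ : 0 ≤ θ)
    (h1 : ∀ᶠ y in 𝓝 x, HasFDerivAt P₁ (innerSL ℝ (G₁ y)) y) (k1 : HasFDerivAt G₁ H₁ x)
    (h2 : ∀ᶠ y in 𝓝 x, HasFDerivAt P₂ (innerSL ℝ (G₂ y)) y) (k2 : HasFDerivAt G₂ H₂ x)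
    (hG : G₂ x = θ • G₁ x) {γ : ℝ → E} (hγ : HasDerivAt γ ξ 0) (hγ0 : γ 0 = x)
    (hmax : ∀ᶠ t in 𝓝 (0 : ℝ), P₁ (γ t) ≤ P₁ x) (hmin : ∀ᶠ t in 𝓝 (0 : ℝ), P₂ x ≤ P₂ (γ t)) :
    θ * ⟪H₁ ξ, ξ⟫_ℝ ≤ ⟪H₂ ξ, ξ⟫_ℝ := by
  have hv : Tendsto (fun t => γ t - x) (𝓝[≠] 0) (𝓝 0) := by
    have := (hγ.continuousAt.tendsto.sub_const x).mono_left (nhdsWithin_le_nhds (s := {0}ᶜ))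
    rwa [hγ0, sub_self] at this
  have hs : ∀ᶠ t : ℝ in 𝓝[≠] 0, t ≠ 0 := self_mem_nhdsWithin
  have hξ : Tendsto (fun t : ℝ => t⁻¹ • (γ t - x)) (𝓝[≠] 0) (𝓝 ξ) := by
    have := hasDerivAt_iff_tendsto_slope.1 hγ
    refine this.congr fun t => ?_
    rw [slope_def_module, hγ0, sub_zero]
  have t1 := tendsto_taylor_two h1 k1 (s := id) hv hs hξ
  have t2 := tendsto_taylor_two h2 k2 (s := id) hv hs hξ
  have := le_of_tendsto_of_tendsto (t1.const_mul θ) t2 (by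
    filter_upwards [hmax.filter_mono nhdsWithin_le_nhds, hmin.filter_mono nhdsWithin_le_nhds]
      with t ht1 ht2
    rw [add_sub_cancel, hG, real_inner_smul_left, ← mul_div_assoc]
    refine div_le_div_of_nonneg_right ?_ (by positivity)
    nlinarith)
  linarith

theorem CompactlyIn.exists_thickening {U' U : Set (Jet n)} (h : CompactlyIn U' U)
    (hU : IsOpen U) : ∃ V : Set (Jet n), IsOpen V ∧ closure U' ⊆ V ∧ CompactlyIn V U := by
  obtain ⟨r, hr, hrU⟩ := h.1.exists_cthickening_subset_open hU h.2
  have hc : closure (thickening r (closure U')) ⊆ cthickening r (closure U') :=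
    closure_thickening_subset_cthickening _ _
  exact ⟨thickening r (closure U'), isOpen_thickening, self_subset_thickening hr _,
    h.1.cthickening.of_isClosed_subset isClosed_closure hc, hc.trans hrU⟩

/-- Let `F` have, along a segment in the coordinates `Q (·, y, z)`, a local maximum at `x`. Then
its second derivatives along the segment are controlled by `A`. -/
theorem mul_hessian_le_of_localMax (hg : IsGeneratingFunction Γ g) (h2 : A2 Γ g)
    {y : Vec n} {z : ℝ} {Φ : OpenPartialHomeomorph (Vec n) (Vec n)}
    (hΓ : ∀ x' ∈ Φ.source, (x', y, z) ∈ Γ) (hΦ : ∀ x', Φ x' = mapQF g (x', y, z))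
    {x : Vec n} (hx : x ∈ Φ.source) {F : Vec n → ℝ} {G : Vec n → Vec n} {H : Vec n →L[ℝ] Vec n}
    (hF : ∀ᶠ x' in 𝓝 x, HasFDerivAt F (innerSL ℝ (G x')) x') (hG : HasFDerivAt G H x)
    {e : Vec n} (he : linE g (x, y, z) e = G x) {θ : ℝ} (hθ : 0 ≤ θ)
    (hj : (x, g (x, y, z), gx g x y z + θ • G x) ∈ jets Γ g)
    (hgap : ∀ᶠ x' in 𝓝 x, 0 ≤ ⟪e, mapQF g (x', y, z) - mapQF g (x, y, z)⟫_ℝ → g (x', y, z) ≤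
      g (x', mapY Γ g x (g (x, y, z)) (gx g x y z + θ • G x),
        mapZ Γ g x (g (x, y, z)) (gx g x y z + θ • G x)))
    {v : Vec n} (hv : v ≠ 0)
    (hmax : IsLocalMax (fun t : ℝ => F (Φ.symm (mapQF g (x, y, z) + t • v))) 0) :
    ∃ ξ ≠ 0, ⟪ξ, G x⟫_ℝ = 0 ∧ θ * ⟪H ξ, ξ⟫_ℝ
      ≤ ⟪matA Γ g x (g (x, y, z)) (gx g x y z + θ • G x) ξ, ξ⟫_ℝ - ⟪gxx g x y z ξ, ξ⟫_ℝ := by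
  have hm := hΓ x hx
  obtain ⟨m1, m2, m3⟩ := mapYZ_spec hj
  set Q := mapQF g (x, y, z) with hQ
  have hw : Q ∈ Φ.target := by rw [hQ, ← hΦ]; exact Φ.map_source hx
  have hsymm : Φ.symm Q = x := by rw [hQ, ← hΦ]; exact Φ.left_inv hx
  obtain ⟨X, hX, hXi⟩ := hg.hasFDerivAt_chart_symm h2 hΓ hΦ hw
  rw [hsymm] at hXi
  have hline : HasDerivAt (fun t : ℝ => Q + t • v) v 0 := by
    simpa using ((hasDerivAt_id (0 : ℝ)).smul_const v).const_add Q
  have hl0 : Q + (0 : ℝ) • v = Q := by simp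
  have hγ : HasDerivAt (fun t : ℝ => Φ.symm (Q + t • v)) (X v) 0 :=
    HasFDerivAt.comp_hasDerivAt (0 : ℝ) (l := Φ.symm) (l' := (X : Vec n →L[ℝ] Vec n))
      (by rw [hl0]; exact hX) hline
  have hγ0 : Φ.symm (Q + (0 : ℝ) • v) = x := by rw [hl0, hsymm]
  have hFγ : HasDerivAt (fun t : ℝ => F (Φ.symm (Q + t • v))) (⟪G x, X v⟫_ℝ) 0 :=
    HasFDerivAt.comp_hasDerivAt (0 : ℝ) (l := F) (f := fun t : ℝ => Φ.symm (Q + t • v))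
      (l' := innerSL ℝ (G x)) (by simp only [hγ0]; exact hF.self_of_nhds) hγ
  have hperp : ⟪G x, X v⟫_ℝ = 0 := hmax.hasDerivAt_eq_zero hFγ
  -- The segment is tangent to the boundary of the half space of the gap, so the comparison function
  -- is nonnegative along it and has a minimum at x, where F has a maximum.
  have hev : ⟪e, v⟫_ℝ = 0 := by
    have := hXi v e
    rw [he, hperp, eq_comm, mul_eq_zero] at this
    exact this.resolve_left (neg_ne_zero.2 (hg.gzF_neg hm).ne)
  refine ⟨X v, by simpa using hv, by rw [real_inner_comm, hperp], ?_⟩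
  set Y := mapY Γ g x (g (x, y, z)) (gx g x y z + θ • G x) with hY
  set Z := mapZ Γ g x (g (x, y, z)) (gx g x y z + θ • G x) with hZ
  have hγc : Tendsto (fun t : ℝ => Φ.symm (Q + t • v)) (𝓝 0) (𝓝 x) := by
    have := hγ.continuousAt.tendsto
    rwa [hγ0] at this
  have hlc : Tendsto (fun t : ℝ => Q + t • v) (𝓝 0) (𝓝 Q) := by
    have := hline.continuousAt.tendsto
    rwa [hl0] at this
  have key := hessian_le_along_curve (P₂ := fun x' => g (x', Y, Z) - g (x', y, z))
    (G₂ := fun x' => gx g x' Y Z - gx g x' y z) (H₂ := gxx g x Y Z - gxx g x y z) hθ hF hG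
    (by
      filter_upwards [hg.eventually_hasFDerivAt_fst m1, hg.eventually_hasFDerivAt_fst hm]
        with x' k1 k2
      rw [map_sub]
      exact k1.sub k2)
    ((hg.hasFDerivAt_gx m1).sub (hg.hasFDerivAt_gx hm)) (by rw [m3]; abel) hγ hγ0
    (by
      filter_upwards [hmax] with t ht
      rwa [hγ0] at ht)
    (by
      filter_upwards [hγc.eventually hgap, hlc.eventually (Φ.open_target.mem_nhds hw)]
        with t k1 k2
      rw [m2, sub_self, sub_nonneg]
      refine k1 ?_
      rw [← hΦ, Φ.right_inv k2, add_sub_cancel_left, real_inner_smul_right, hev, mul_zero])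
  simpa [matA, inner_sub_left] using key

/-- Uniform convexity of `A` in `p`, orthogonally to `G x`, excludes local maxima of `F` along
segments in the coordinates `Q (·, y, z)`. -/
theorem not_isLocalMax_of_uniform_convexity (hg : IsGeneratingFunction Γ g)
    (h2 : A2 Γ g) {y : Vec n} {z : ℝ} {Φ : OpenPartialHomeomorph (Vec n) (Vec n)}
    (hΓ : ∀ x' ∈ Φ.source, (x', y, z) ∈ Γ) (hΦ : ∀ x', Φ x' = mapQF g (x', y, z))
    {x : Vec n} (hx : x ∈ Φ.source) {F : Vec n → ℝ} {G : Vec n → Vec n} {H : Vec n →L[ℝ] Vec n}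
    {κ δ : ℝ} (hF : ∀ᶠ x' in 𝓝 x, HasFDerivAt F (innerSL ℝ (G x')) x')
    (hG : HasFDerivAt G (H - gxx g x y z - κ • ContinuousLinearMap.id ℝ (Vec n)) x)
    {e : Vec n} (he : linE g (x, y, z) e = G x) {θ : ℝ} (hθ : 0 < θ) (hθ2 : θ ≤ 1 / 2)
    (hj : (x, g (x, y, z), gx g x y z + θ • G x) ∈ jets Γ g)
    (hgap : ∀ᶠ x' in 𝓝 x, 0 ≤ ⟪e, mapQF g (x', y, z) - mapQF g (x, y, z)⟫_ℝ → g (x', y, z) ≤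
      g (x', mapY Γ g x (g (x, y, z)) (gx g x y z + θ • G x),
        mapZ Γ g x (g (x, y, z)) (gx g x y z + θ • G x)))
    (hconv : ∀ ξ, ⟪ξ, G x⟫_ℝ = 0 → ⟪matA Γ g x (g (x, y, z)) (gx g x y z + θ • G x) ξ, ξ⟫_ℝ
      ≤ (1 - θ) * ⟪gxx g x y z ξ, ξ⟫_ℝ
        + θ * ⟪matA Γ g x (g (x, y, z)) (gx g x y z + G x) ξ, ξ⟫_ℝ
        - δ * θ * (1 - θ) * ‖G x‖ ^ 2 * ‖ξ‖ ^ 2)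
    (hH : ‖H - matA Γ g x (g (x, y, z)) (gx g x y z + G x)‖ ≤ κ)
    (hδ : 0 ≤ δ) (hκ : 4 * κ < δ * ‖G x‖ ^ 2) {v : Vec n} (hv : v ≠ 0) :
    ¬ IsLocalMax (fun t : ℝ => F (Φ.symm (mapQF g (x, y, z) + t • v))) 0 := by
  intro hmax
  obtain ⟨ξ, hξ0, hξG, hξ⟩ :=
    mul_hessian_le_of_localMax hg h2 hΓ hΦ hx hF hG he hθ.le hj hgap hv hmax
  have hc := hconv ξ hξG
  have hdiff : ⟪matA Γ g x (g (x, y, z)) (gx g x y z + G x) ξ, ξ⟫_ℝ - ⟪H ξ, ξ⟫_ℝ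
      ≤ κ * ‖ξ‖ ^ 2 := by
    rw [← inner_sub_left, ← sub_apply]
    calc _ ≤ ‖(matA Γ g x (g (x, y, z)) (gx g x y z + G x) - H) ξ‖ * ‖ξ‖ :=
          real_inner_le_norm _ _
      _ ≤ (κ * ‖ξ‖) * ‖ξ‖ := by
          gcongr
          refine (ContinuousLinearMap.le_opNorm _ _).trans ?_
          gcongr
          rwa [norm_sub_rev]
      _ = κ * ‖ξ‖ ^ 2 := by ring
  have hHξ : ⟪(H - gxx g x y z - κ • ContinuousLinearMap.id ℝ (Vec n)) ξ, ξ⟫_ℝ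
      = ⟪H ξ, ξ⟫_ℝ - ⟪gxx g x y z ξ, ξ⟫_ℝ - κ * ‖ξ‖ ^ 2 := by
    simp [inner_sub_left, real_inner_smul_left]
  rw [hHξ] at hξ
  have hξn : 0 < ‖ξ‖ ^ 2 := pow_pos (norm_pos_iff.2 hξ0) 2
  -- One κ comes from the quadratic term of F, the other from replacing H by A. Dividing by θ leaves
  -- a bound that does not degenerate however small θ is.
  have hfin : δ * (1 - θ) * ‖G x‖ ^ 2 * ‖ξ‖ ^ 2 ≤ 2 * κ * ‖ξ‖ ^ 2 := by
    refine le_of_mul_le_mul_left ?_ hθ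
    have := mul_le_mul_of_nonneg_left hdiff hθ.le
    linarith
  have h3 : δ * (1 - θ) * ‖G x‖ ^ 2 ≤ 2 * κ := le_of_mul_le_mul_right hfin hξn
  have h4 : δ * (1 / 2) * ‖G x‖ ^ 2 ≤ δ * (1 - θ) * ‖G x‖ ^ 2 := by
    gcongr
    linarith
  linarith

/-- A function without local maxima along segments has convex sublevel sets. -/
theorem convex_sublevel_of_not_isLocalMax {E : Type*} [NormedAddCommGroup E] [NormedSpace ℝ E]
    {B : Set E} (hB : Convex ℝ B) {f : E → ℝ} (hf : ∀ w ∈ B, ContinuousAt f w)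
    (hmax : ∀ w ∈ B, ∀ v ≠ 0, ¬ IsLocalMax (fun t : ℝ => f (w + t • v)) 0) :
    Convex ℝ {w | w ∈ B ∧ f w < 0} := by
  rintro a ⟨ha, hfa⟩ b ⟨hb, hfb⟩ s t hs ht hst
  have hab := hB ha hb hs ht hst
  refine ⟨hab, ?_⟩
  by_contra! hcon
  have hmemB : ∀ τ ∈ Icc (0 : ℝ) 1, a + τ • (b - a) ∈ B := by
    intro τ hτ
    have := hB ha hb (a := 1 - τ) (b := τ) (by linarith [hτ.2]) hτ.1 (by ring)
    rwa [show a + τ • (b - a) = (1 - τ) • a + τ • b by module]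
  set φ : ℝ → ℝ := fun τ => f (a + τ • (b - a)) with hφ
  have hφc : ContinuousOn φ (Icc 0 1) := by
    intro τ hτ
    have k3 : ContinuousAt (fun τ : ℝ => a + τ • (b - a)) τ := by fun_prop
    exact (ContinuousAt.comp (g := f) (f := fun τ : ℝ => a + τ • (b - a))
      (hf _ (hmemB τ hτ)) k3).continuousWithinAt
  obtain ⟨τ, hτ, hτmax⟩ := isCompact_Icc.exists_isMaxOn ⟨0, by simp⟩ hφc
  have hφt : 0 ≤ φ τ := by
    have : φ t ≤ φ τ := hτmax ⟨ht, by linarith⟩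
    refine le_trans ?_ this
    simp only [hφ]
    rwa [show a + t • (b - a) = s • a + t • b by
      rw [show s = 1 - t by linarith]; module]
  have hφ0 : φ 0 < 0 := by simpa [hφ] using hfa
  have hφ1 : φ 1 < 0 := by simpa [hφ] using hfb
  have hτ0 : τ ≠ 0 := by rintro rfl; linarith
  have hτ1 : τ ≠ 1 := by rintro rfl; linarith
  have hτmem : Icc (0 : ℝ) 1 ∈ 𝓝 τ :=
    Icc_mem_nhds (lt_of_le_of_ne hτ.1 hτ0.symm) (lt_of_le_of_ne hτ.2 hτ1)
  have hba : b - a ≠ 0 := by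
    intro h0
    have : φ τ = φ 0 := by simp [hφ, h0]
    linarith
  refine hmax _ (hmemB τ hτ) (b - a) hba ?_
  have hlm : IsLocalMax φ τ := hτmax.isLocalMax hτmem
  have hsh : Tendsto (fun t : ℝ => τ + t) (𝓝 0) (𝓝 τ) := by
    have : Continuous fun t : ℝ => τ + t := by fun_prop
    simpa using this.tendsto 0
  filter_upwards [hsh.eventually hlm] with t' ht'
  simp only [hφ] at ht'
  rw [zero_smul, add_zero, add_assoc, ← add_smul]
  exact ht'

/-- Enlarging U' to V leaves room for the jets p + sG(x) at points x near x₀. Such x is compared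
with the function of momentum p + θG(x), for which the gap is available; the Hessian of g(·,y₁,z₁)
at x is close to A at p + G(x), with equality at x₀. -/
theorem A3sOne_of_A3s (hg : IsGeneratingFunction Γ g) (h1 : A1 Γ g) (h2 : A2 Γ g)
    (hA : A3s Γ g) : A3sOne Γ g := by
  intro U' hU
  obtain ⟨V, hVo, hUV, hV⟩ := hU.exists_thickening (hg.isOpen_jets h1 h2)
  obtain ⟨δ, hδ, hA3⟩ := hA V hV
  obtain ⟨ℓ, hℓ, ρ, hρ, c, hc, hgap⟩ := exists_jetGap hg h1 h2 hA hV.1 hV.2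
  -- With κ = δ|p₁ - p₀|²/16 and |G|² > |p₁ - p₀|²/2 near x₀, the condition 4κ < δ|G|² holds.
  refine ⟨δ / 16, by positivity, fun x₀ u₀ p₀ p₁ hseg => ?_⟩
  have hj : SegIn (jets Γ g) x₀ u₀ p₀ p₁ := fun p hp => hU.2 (subset_closure (hseg p hp))
  obtain ⟨a1, a2, a3⟩ := mapYZ_spec (hj _ (left_mem_segment ℝ _ _))
  obtain ⟨b1, b2, b3⟩ := mapYZ_spec (hj _ (right_mem_segment ℝ _ _))
  rcases eq_or_ne p₁ p₀ with rfl | hpp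
  · have : sectionS Γ g x₀ u₀ p₁ p₁ 1 (δ / 16) = ∅ := by
      refine eq_empty_of_forall_notMem fun x hx => ?_
      have := hx.2.2.2
      rw [hfun_one] at this
      simp at this
    rw [this]
    exact ⟨univ, isOpen_univ, mem_univ _, by simp [GConvex, convex_empty]⟩
  have hq : 0 < ‖p₁ - p₀‖ := norm_pos_iff.2 (sub_ne_zero.2 hpp)
  have hsec := eventually_mem_section_iff hg h1 h2 hj (δ / 16)
  have hder := fun x => hg.hasFDerivAt_hfun_one (x₀ := x₀) (u₀ := u₀) (p₀ := p₀) (p₁ := p₁)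
    (δ := δ / 16) (x := x)
  set S := sectionS Γ g x₀ u₀ p₀ p₁ 1 (δ / 16) with hS
  set F := hfun Γ g x₀ u₀ p₀ p₁ 1 (δ / 16) with hF
  set y₀ := mapY Γ g x₀ u₀ p₀ with hy₀
  set z₀ := mapZ Γ g x₀ u₀ p₀ with hz₀
  set y₁ := mapY Γ g x₀ u₀ p₁ with hy₁
  set z₁ := mapZ Γ g x₀ u₀ p₁ with hz₁
  set κ := δ / 16 * ‖p₁ - p₀‖ ^ 2 with hκ
  have hκ0 : 0 < κ := by positivity
  set G : Vec n → Vec n := fun x => gx g x y₁ z₁ - gx g x y₀ z₀ - κ • (x - x₀) with hG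
  have hGx₀ : G x₀ = p₁ - p₀ := by simp only [hG, a3, b3]; simp
  have cG0 : ContinuousAt (fun x => gx g x y₀ z₀) x₀ := (hg.hasFDerivAt_gx a1).continuousAt
  have cG1 : ContinuousAt (fun x => gx g x y₁ z₁) x₀ := (hg.hasFDerivAt_gx b1).continuousAt
  have cg0 : ContinuousAt (fun x => g (x, y₀, z₀)) x₀ := (hg.hasFDerivAt_fst a1).continuousAt
  have cg1 : ContinuousAt (fun x => g (x, y₁, z₁)) x₀ := (hg.hasFDerivAt_fst b1).continuousAt
  have cG : ContinuousAt G x₀ := (cG1.sub cG0).sub (by fun_prop)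
  -- conditions that hold near `x₀`
  have ev1 : ∀ᶠ x in 𝓝 x₀, ∀ s ∈ Icc (0 : ℝ) 1,
      (x, g (x, y₀, z₀), gx g x y₀ z₀ + s • G x) ∈ V := by
    refine isCompact_Icc.eventually_forall_of_forall_eventually fun s hs => ?_
    have k : ContinuousAt (fun w : Vec n × ℝ =>
        ((w.1, g (w.1, y₀, z₀), gx g w.1 y₀ z₀ + w.2 • G w.1) : Jet n)) (x₀, s) :=
      continuousAt_fst.prodMk ((cg0.comp (f := Prod.fst) (x := (x₀, s)) continuousAt_fst).prodMk
        ((cG0.comp (f := Prod.fst) (x := (x₀, s)) continuousAt_fst).add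
          (continuousAt_snd.smul (cG.comp (f := Prod.fst) (x := (x₀, s)) continuousAt_fst))))
    refine k.eventually (hVo.mem_nhds ?_)
    simp only [a2, a3, hGx₀]
    refine hUV (subset_closure (hseg _ ?_))
    rw [show p₀ + s • (p₁ - p₀) = pt p₀ p₁ s by unfold pt; module]
    exact pt_mem_segment _ _ hs
  have ev2 : ∀ᶠ x in 𝓝 x₀, ‖p₁ - p₀‖ ^ 2 / 2 < ‖G x‖ ^ 2 := by
    have k : ContinuousAt (fun x => ‖G x‖ ^ 2) x₀ := cG.norm.pow 2
    refine k.eventually (lt_mem_nhds ?_)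
    change _ < ‖G x₀‖ ^ 2
    rw [hGx₀]
    linarith [pow_pos hq 2]
  have ev3 : ∀ᶠ x in 𝓝 x₀, ‖gxx g x y₁ z₁
      - matA Γ g x (g (x, y₀, z₀)) (gx g x y₀ z₀ + G x)‖ < κ := by
    have k1 : ContinuousAt (fun x => gxx g x y₁ z₁) x₀ :=
      ContinuousAt.comp (f := fun x => ((x, y₁, z₁) : Trip n)) (x := x₀)
        (hg.continuousAt_gxx b1) (by fun_prop)
    have k2 : ContinuousAt (fun x => ((x, g (x, y₀, z₀), gx g x y₀ z₀ + G x) : Jet n)) x₀ :=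
      continuousAt_id.prodMk (cg0.prodMk (cG0.add cG))
    have e1 : ((x₀, g (x₀, y₀, z₀), gx g x₀ y₀ z₀ + G x₀) : Jet n) = (x₀, u₀, p₁) := by
      rw [a2, a3, hGx₀, add_sub_cancel]
    have k3 : ContinuousAt
        (fun x => matA Γ g x (g (x, y₀, z₀)) (gx g x y₀ z₀ + G x)) x₀ :=
      ContinuousAt.comp (g := fun j : Jet n => matA Γ g j.1 j.2.1 j.2.2)
        (f := fun x => ((x, g (x, y₀, z₀), gx g x y₀ z₀ + G x) : Jet n)) (x := x₀)
        (by rw [e1]; exact hg.continuousAt_matA h1 h2 (hj _ (right_mem_segment ℝ _ _))) k2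
    refine (k1.sub k3).norm.eventually (gt_mem_nhds ?_)
    change ‖gxx g x₀ y₁ z₁ - matA Γ g x₀ (g (x₀, y₀, z₀)) (gx g x₀ y₀ z₀ + G x₀)‖ < κ
    rw [a2, a3, hGx₀, add_sub_cancel, matA, sub_self, norm_zero]
    exact hκ0
  obtain ⟨Φ, hΦ0, hΦΓ, hΦ⟩ := hg.exists_mapQ_chart h2 a1
  have hw₀ : Φ x₀ ∈ Φ.target := Φ.map_source hΦ0
  have hsymm : Tendsto Φ.symm (𝓝 (Φ x₀)) (𝓝 x₀) := by
    have := (Φ.symm.continuousAt (x := Φ x₀) hw₀).tendsto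
    rwa [Φ.left_inv hΦ0] at this
  have hnomax : ∀ x ∈ Φ.source, (x, y₁, z₁) ∈ Γ →
      (∀ s ∈ Icc (0 : ℝ) 1, (x, g (x, y₀, z₀), gx g x y₀ z₀ + s • G x) ∈ V) →
      ‖p₁ - p₀‖ ^ 2 / 2 < ‖G x‖ ^ 2 →
      ‖gxx g x y₁ z₁ - matA Γ g x (g (x, y₀, z₀)) (gx g x y₀ z₀ + G x)‖ < κ → ∀ v ≠ 0,
      ¬ IsLocalMax (fun t : ℝ => F (Φ.symm (mapQF g (x, y₀, z₀) + t • v))) 0 := by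
    intro x hxs hm1 hVx hn hmat v hv
    have hm0 := hΦΓ x hxs
    have hG0 : 0 < ‖G x‖ ^ 2 := lt_of_le_of_lt (by positivity) hn
    have hG1 : 0 < ‖G x‖ := by
      rcases (norm_nonneg (G x)).eq_or_lt with h | h
      · rw [← h] at hG0; norm_num at hG0
      · exact h
    obtain ⟨L, hL⟩ := hg.exists_linE_equiv h2 hm0
    set e := L.symm (G x) with he
    have hLe : linE g (x, y₀, z₀) e = G x := by rw [← hL, he, L.apply_symm_apply]
    -- Small enough for p + θG to be within the range of the jet gap, and at most 1/2 so that 1 - θ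
    -- is bounded below.
    set θ := min (1 / 2) (ℓ / (2 * ‖G x‖)) with hθ
    have hθ0 : 0 < θ := lt_min (by norm_num) (by positivity)
    have hθh : θ ≤ 1 / 2 := min_le_left _ _
    have hθ1 : θ ∈ Icc (0 : ℝ) 1 := ⟨hθ0.le, by linarith⟩
    have hθℓ : θ * ‖G x‖ < ℓ := by
      calc θ * ‖G x‖ ≤ ℓ / (2 * ‖G x‖) * ‖G x‖ := by gcongr; exact min_le_right _ _
        _ = ℓ / 2 := by field_simp
        _ < ℓ := by linarith
    have hbase : mapY Γ g x (g (x, y₀, z₀)) (gx g x y₀ z₀) = y₀ ∧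
        mapZ Γ g x (g (x, y₀, z₀)) (gx g x y₀ z₀) = z₀ := h1.mapYZ_eq hm0 rfl rfl
    have hgp := hgap x (g (x, y₀, z₀)) (gx g x y₀ z₀) (gx g x y₀ z₀ + θ • G x)
      (subset_closure (by simpa using hVx 0 (by simp))) (subset_closure (hVx θ hθ1))
      (by rw [add_sub_cancel_left, norm_smul, Real.norm_of_nonneg hθ0.le]; exact hθℓ)
      (θ • e) (by rw [hbase.1, hbase.2, map_smul, hLe, add_sub_cancel_left])
    rw [hbase.1, hbase.2] at hgp
    have hFev : ∀ᶠ x' in 𝓝 x, HasFDerivAt F (innerSL ℝ (G x')) x' := by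
      filter_upwards [hg.eventually_mem_fst hm0, hg.eventually_mem_fst hm1] with x' k0 k1
      exact hder x' k0 k1
    have hGd : HasFDerivAt G (gxx g x y₁ z₁ - gxx g x y₀ z₀
        - κ • ContinuousLinearMap.id ℝ (Vec n)) x :=
      ((hg.hasFDerivAt_gx hm1).sub (hg.hasFDerivAt_gx hm0)).sub
        (((hasFDerivAt_id x).sub_const x₀).const_smul κ)
    refine not_isLocalMax_of_uniform_convexity hg h2 hΦΓ hΦ hxs hFev hGd hLe hθ0 hθh
      (hV.2 (subset_closure (hVx θ hθ1))) ?_ ?_ hmat.le hδ.le ?_ hv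
    · filter_upwards [ball_mem_nhds x hρ] with x' hx' hpos
      have := hgp x' hx' (by rw [real_inner_smul_left]; positivity)
      refine le_trans ?_ this
      have : 0 ≤ c * ‖gx g x y₀ z₀ + θ • G x - gx g x y₀ z₀‖ ^ 2 * ‖x' - x‖ ^ 2 := by positivity
      linarith
    · intro ξ hξG
      have hsegV : SegIn V x (g (x, y₀, z₀)) (gx g x y₀ z₀) (gx g x y₀ z₀ + G x) := by
        intro p hp
        rw [segment_eq_image'] at hp
        obtain ⟨s, hs, rfl⟩ := hp
        simpa using hVx s hs
      have hconv := hA3 _ _ _ _ hsegV ξ (by rwa [add_sub_cancel_left]) θ hθ1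
      have e1 : pt (gx g x y₀ z₀) (gx g x y₀ z₀ + G x) θ = gx g x y₀ z₀ + θ • G x := by
        unfold pt; module
      have e2 : matA Γ g x (g (x, y₀, z₀)) (gx g x y₀ z₀) = gxx g x y₀ z₀ := by
        rw [matA, hbase.1, hbase.2]
      rwa [e1, e2, add_sub_cancel_left] at hconv
    · have : δ * (‖p₁ - p₀‖ ^ 2 / 2) < δ * ‖G x‖ ^ 2 := by gcongr
      rw [hκ]
      have : 0 < δ * ‖p₁ - p₀‖ ^ 2 := by positivity
      linarith
  have evx := hsec.and ((hg.eventually_mem_fst b1).and (ev1.and (ev2.and ev3)))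
  obtain ⟨r, hr, hB⟩ := Metric.eventually_nhds_iff_ball.1
    ((hsymm.eventually evx).and (Φ.open_target.mem_nhds hw₀))
  have hBt : ball (Φ x₀) r ⊆ Φ.target := fun w hw => (hB w hw).2
  refine ⟨Φ.source ∩ Φ ⁻¹' ball (Φ x₀) r, Φ.isOpen_inter_preimage isOpen_ball,
    ⟨hΦ0, mem_preimage.2 (mem_ball_self hr)⟩, fun x hx => hΦΓ x hx.2.1, ?_⟩
  -- In the chart Q the neighbourhood is a ball, so the image of the section is a sublevel set on a
  -- convex set.
  have himage : (fun x => mapQ g x y₀ z₀) '' (S ∩ (Φ.source ∩ Φ ⁻¹' ball (Φ x₀) r))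
      = {w | w ∈ ball (Φ x₀) r ∧ F (Φ.symm w) < 0} := by
    ext w
    constructor
    · rintro ⟨x, ⟨hxS, hxs, hxb⟩, rfl⟩
      have e1 : mapQ g x y₀ z₀ = Φ x := (hΦ x).symm
      have hxb' : Φ x ∈ ball (Φ x₀) r := hxb
      have k := (hB _ hxb').1.1
      rw [Φ.left_inv hxs] at k
      simp only [e1, mem_ofPred_eq, Φ.left_inv hxs]
      exact ⟨hxb', k.1 hxS⟩
    · rintro ⟨hw, hFw⟩
      have k := (hB w hw).1.1
      refine ⟨Φ.symm w, ⟨k.2 hFw, Φ.map_target (hBt hw), ?_⟩, ?_⟩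
      · rw [mem_preimage, Φ.right_inv (hBt hw)]
        exact hw
      · exact (hΦ _).symm.trans (Φ.right_inv (hBt hw))
  rw [himage]
  refine convex_sublevel_of_not_isLocalMax (convex_ball _ _) (f := fun w => F (Φ.symm w))
    (fun w hw => ?_) (fun w hw v hv => ?_)
  · exact ContinuousAt.comp (g := F) (f := Φ.symm)
      (hder _ (hΦΓ _ (Φ.map_target (hBt hw))) (hB _ hw).1.2.1).continuousAt
      (Φ.symm.continuousAt (hBt hw))
  obtain ⟨-, hm1, hVx, hn, hmat⟩ := (hB w hw).1
  have hxs : Φ.symm w ∈ Φ.source := Φ.map_target (hBt hw)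
  have hxw : w = mapQF g (Φ.symm w, y₀, z₀) := by rw [← hΦ, Φ.right_inv (hBt hw)]
  rw [hxw]
  exact hnomax _ hxs hm1 hVx hn hmat v hv

end GenFun

theorem theorem2p2 (n : ℕ) (Γ : Set (GenFun.Trip n)) (g : GenFun.Trip n → ℝ)
    (hg : GenFun.IsGeneratingFunction Γ g)
    (h1 : GenFun.A1 Γ g) (h2 : GenFun.A2 Γ g) (h1s : GenFun.A1star Γ g) :
    (GenFun.A3s Γ g ↔ GenFun.A3s (GenFun.dualDomain Γ g) (GenFun.dualFun Γ g)) ∧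
    (GenFun.A3s Γ g ↔ GenFun.A3sOne Γ g) ∧
    (GenFun.A3s Γ g ↔ GenFun.A3sTwo Γ g) :=
  ⟨GenFun.A3s_dual_iff hg h1 h2 h1s,
    ⟨GenFun.A3sOne_of_A3s hg h1 h2, GenFun.A3s_of_A3sOne hg h1 h2 h1s⟩,
    ⟨GenFun.A3sTwo_of_A3s hg h1 h2, GenFun.A3s_of_A3sTwo hg h1 h2⟩⟩
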